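/- **Heterogeneous server capacities, Poisson requests, generally distributed servers.** Requests form a Poisson process $0<r_1\le r_2\le\cdots$ of rate $\lambda>0$ on $[0,\infty)$. Servers are located at $s_j=X_1+\cdots+X_j$, where the $X_j\ge 0$ are i.i.d. with law $F_X$, mean $1/\mu$ $(\mu>0)$ and finite variance $\sigma_X^2$. Server $j$ has capacity $\mathcal C_j$, where the $\mathcal C_j$ are i.i.d. with $\Pr(\mathcal C_j=i)=p_i$, $\sum_{i=1}^c p_i=1$, $p_0=0$, $p_c>0$. The requests, the distances $X_j$ and the capacities are independent. Put $\rho=\lambda/\mu$, $\overline{\mathcal C}=\sum_{i=1}^c ip_i$, and assume $\rho<\overline{\mathcal C}$. Requests are allocated by the Move To Right policy: going from left to right, each request is allocated to the nearest server to its right (in the order of the indices $j$) with remaining capacity. Let $H_j$ be the number of requests located to the left of (or at) server $j$ that are allocated to a later server, and let $D_i$ be the distance from request $i$ to its server. Put $P_i=\sum_{j=i}^c p_j$, $k_v=\frac1{v!}\int_0^\infty e^{-\lambda\nu}(\lambda\nu)^v\,dF_X(\nu)$ and $K(z)=\int_0^\infty e^{-\lambda(1-z)\nu}\,dF_X(\nu)$.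 Then: 1. Almost surely every request is allocated to a server. For $|z|\le1$, $K(z)=\sum_{v\ge0}k_vz^v$. The sequence $(H_j)_{j\ge1}$ is a Markov chain, started as if $H_0=0$, with transition matrix $$M_{m,0}=\sum_{i=0}^{c-m}k_iP_{i+m}\ (m\le c),\quad M_{m,l}=\sum_{i=0}^{c}k_{i+l-m}p_i\ (m\le l,\ l\neq0),\quad M_{m,l}=\sum_{i=m-l}^{c}k_{i+l-m}p_i\ (l<m\le c+l,\ l\ne0),$$ and $M_{m,l}=0$ otherwise. It has exactly one stationary probability distribution $\pi=(\pi_j)_{j\ge0}$, and $\Pr(H_n=l)\to\pi_l$ for every $l$. 2. For $x\in\mathbb C^c$ let $E_x=\sum_{m=0}^{c-1}x_m\sum_{i=m}^{c-1}k_{i-m}P_{i+1}$ and $$A_x(z)=z^cE_x-\sum_{j=0}^{c-1}x_j\sum_{m=1}^{c-j}z^{c-m}\sum_{i=m+j}^{c}k_{i-(m+j)}p_i,\qquad B(z)=z^c-K(z)\sum_{i=0}^{c}p_{c-i}z^i .$$ With $N(z)=\sum_{j\ge0}\pi_jz^j$, for every $|z|\le1$: if $B(z)\neq0$ then $N(z)=A_\pi(z)/B(z)$,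 and if $B(z)=0$ then $A_\pi(z)=0$. 3. $B$ has exactly $c-1$ zeros in $\{|z|<1\}$, counted with multiplicity. Its only zero on $\{|z|=1\}$ is $z=1$, where its derivative relative to the closed unit disk is $\overline{\mathcal C}-\rho>0$. 4. These zeros determine $\pi_0,\dots,\pi_{c-1}$: a vector $x\in\mathbb C^c$ equals $(\pi_0,\dots,\pi_{c-1})$ if and only if $A_x$ vanishes at every zero of $B$ in $\{|z|<1\}$ to at least the order of that zero, and $A_x(z)/B(z)\to1$ as $z\to1$, $|z|<1$. If $B$ has $c-1$ distinct zeros $\xi_1,\dots,\xi_{c-1}$ in $\{|z|<1\}$, the $c$ linear forms $x\mapsto A_x(\xi_q)$ $(1\le q\le c-1)$ and $x\mapsto A_x'(1)$ are linearly independent. 5. $\overline H:=\sum_j j\pi_j$ is finite and $N'(z)\to\overline H$ as $z\to1$, $|z|<1$. Each $D_i$ is integrable, and the expected request distance $\mathbb E[D]:=\lim_{n\to\infty}\frac1n\sum_{i=1}^n\mathbb E[D_i]$ exists and equals $$\mathbb E[D]=\frac1\rho\int_0^\infty\Big(\overline H\nu+\tfrac12\lambda\nu^2\Big)dF_X(\nu)=\frac1\rho\left[\frac{\overline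 H}{\mu}+\frac{\lambda}{2}\left(\sigma_X^2+\frac1{\mu^2}\right)\right].$$ -/

import Mathlib

open MeasureTheory ProbabilityTheory Filter Topology
open scoped NNReal

namespace HetPRGS

noncomputable section

/-! ### The spatial model -/

/-- Number of points of the sequence `r` in the interval `(a, b]`. -/
def count (r : ℕ → ℝ) (a b : ℝ) : ℕ := {i | a < r i ∧ r i ≤ b}.ncard

/-- `r 0 ≤ r 1 ≤ ...` are the points of a Poisson process of rate `lam` on `[0, ∞)`: the sequence is
locally finite, the numbers of points in the consecutive intervals of any grid are independent, and
the number of points in `(a, b]` is Poisson with mean `lam * (b - a)`. -/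
structure IsPoissonProcess {Ω : Type*} [MeasurableSpace Ω] (P : Measure Ω) (lam : ℝ)
    (r : ℕ → Ω → ℝ) : Prop where
  measurable : ∀ i, Measurable (r i)
  pos : ∀ᵐ ω ∂P, 0 < r 0 ω
  mono : ∀ᵐ ω ∂P, Monotone fun i => r i ω
  locallyFinite : ∀ᵐ ω ∂P, Tendsto (fun i => r i ω) atTop atTop
  indep : ∀ t : ℕ → ℝ, 0 ≤ t 0 → Monotone t →
    iIndepFun (fun (n : ℕ) (ω : Ω) => count (fun i => r i ω) (t n) (t (n + 1))) P
  law : ∀ a b : ℝ, 0 ≤ a → a ≤ b →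
    P.map (fun ω => count (fun i => r i ω) a b) = poissonMeasure (lam * (b - a)).toNNReal

/-- `p` is a probability distribution on `{1, ..., c}` that charges `c`. -/
structure IsCapacityLaw (c : ℕ) (p : ℕ → ℝ) : Prop where
  nonneg : ∀ j, 0 ≤ p j
  support : ∀ j, j ∉ Finset.Icc 1 c → p j = 0
  sum_eq_one : ∑ j ∈ Finset.Icc 1 c, p j = 1
  top_pos : 0 < p c

/-- Mean capacity. -/
def meanCap (c : ℕ) (p : ℕ → ℝ) : ℝ := ∑ j ∈ Finset.Icc 1 c, (j : ℝ) * p j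

/-- Heterogeneous service network with Poisson requests and generally distributed servers.
`r i` is the location of request `i`, `X j` the distance from server `j - 1` (from the origin if
`j = 0`) to server `j`, and `C j` the capacity of server `j`. The request process, the inter-server
distances (i.i.d. with law `ν`) and the capacities (i.i.d. with law `p`) are independent. -/
structure IsNetwork {Ω : Type*} [MeasurableSpace Ω] (P : Measure Ω) (lam : ℝ) (ν : Measure ℝ)
    (p : ℕ → ℝ) (r X : ℕ → Ω → ℝ) (C : ℕ → Ω → ℕ) : Prop where
  poisson : IsPoissonProcess P lam r
  measurable_dist : ∀ j, Measurable (X j)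
  measurable_cap : ∀ j, Measurable (C j)
  law_dist : ∀ j, P.map (X j) = ν
  law_cap : ∀ j i, P.real {ω | C j ω = i} = p i
  indep_dist_cap : ∀ j, IndepFun (X j) (C j) P
  indep_servers : iIndepFun (fun (j : ℕ) (ω : Ω) => (X j ω, C j ω)) P
  indep_requests : IndepFun (fun (ω : Ω) (i : ℕ) => r i ω)
    (fun (ω : Ω) (j : ℕ) => (X j ω, C j ω)) P

/-- Server locations obtained from the inter-server distances. -/
def serverLoc (X : ℕ → ℝ) (j : ℕ) : ℝ := ∑ k ∈ Finset.range (j + 1), X k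

/-- Move To Right: going through the requests from left to right, request `i` is allocated to the
first server to its right that has not exhausted its capacity on earlier requests. -/
def mtr (r s : ℕ → ℝ) (C : ℕ → ℕ) (i : ℕ) : ℕ :=
  sInf {j | r i ≤ s j ∧ (Finset.univ.filter fun k : Fin i => mtr r s C k = j).card < C j}
termination_by i
decreasing_by all_goals exact Fin.isLt _

/-- Number of requests that traverse the point just after server `j`, i.e. requests located
to the left of server `j` and allocated to a later server. -/
def crossing (r s : ℕ → ℝ) (C : ℕ → ℕ) (j : ℕ) : ℕ := {i | r i ≤ s j ∧ j < mtr r s C i}.ncard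

/-- Distance between request `i` and its server. -/
def reqDist (r s : ℕ → ℝ) (C : ℕ → ℕ) (i : ℕ) : ℝ := s (mtr r s C i) - r i

/-! ### The embedded chain and its generating function -/

/-- Laplace-Stieltjes transform of the inter-server distance. -/
def lst (ν : Measure ℝ) (s : ℂ) : ℂ := ∫ x, Complex.exp (-(s * (x : ℂ))) ∂ν

/-- Probability of `v` new requests between two consecutive servers. -/
def kProb (lam : ℝ) (ν : Measure ℝ) (v : ℕ) : ℝ :=
  ∫ x, Real.exp (-(lam * x)) * (lam * x) ^ v / (v.factorial : ℝ) ∂ν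

/-- `K(z) = F_X^*(lam (1 - z))`. -/
def K (lam : ℝ) (ν : Measure ℝ) (z : ℂ) : ℂ := lst ν ((lam : ℂ) * (1 - z))

/-- Probability that the capacity is at least `i`. -/
def tailCap (c : ℕ) (p : ℕ → ℝ) (i : ℕ) : ℝ := ∑ j ∈ Finset.Icc i c, p j

/-- Transition matrix of the embedded chain. -/
def trans (c : ℕ) (p k : ℕ → ℝ) (m l : ℕ) : ℝ :=
  if l = 0 then
    if m ≤ c then ∑ i ∈ Finset.range (c - m + 1), k i * tailCap c p (i + m) else 0
  else if m ≤ l then ∑ i ∈ Finset.range (c + 1), k (i + l - m) * p i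
  else if m ≤ c + l then ∑ i ∈ Finset.Icc (m - l) c, k (i + l - m) * p i
  else 0

/-- Stationary probability distribution of a transition matrix on `ℕ`. -/
structure IsStationary (M : ℕ → ℕ → ℝ) (π : ℕ → ℝ) : Prop where
  nonneg : ∀ j, 0 ≤ π j
  hasSum_one : HasSum π 1
  invariant : ∀ l, HasSum (fun m => π m * M m l) (π l)

/-- Generating function `N(z)`. -/
def pgf (π : ℕ → ℝ) (z : ℂ) : ℂ := ∑' j, (π j : ℂ) * z ^ j

/-- `E_x = x_0 ∑_{i=0}^{c-1} k_i P_{i+1} + ∑_{m=1}^{c-1} x_m ∑_{i=m}^{c-1} k_{i-m} P_{i+1}`. -/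
def emptyTerm (c : ℕ) (p k : ℕ → ℝ) (x : ℕ → ℂ) : ℂ :=
  ∑ m ∈ Finset.range c, x m * ∑ i ∈ Finset.Ico m c, ((k (i - m) * tailCap c p (i + 1) : ℝ) : ℂ)

/-- Numerator of the generating function, for unknowns `x_0, ..., x_{c-1}`. -/
def num (c : ℕ) (p k : ℕ → ℝ) (x : ℕ → ℂ) (z : ℂ) : ℂ :=
  z ^ c * emptyTerm c p k x -
    ∑ j ∈ Finset.range c, x j * ∑ m ∈ Finset.Icc 1 (c - j),
      z ^ (c - m) * ∑ i ∈ Finset.Icc (m + j) c, ((k (i - (m + j)) * p i : ℝ) : ℂ)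

/-- Denominator of the generating function. -/
def den (c : ℕ) (p : ℕ → ℝ) (lam : ℝ) (ν : Measure ℝ) (z : ℂ) : ℂ :=
  z ^ c - K lam ν z * ∑ i ∈ Finset.range (c + 1), (p (c - i) : ℂ) * z ^ i

end

end HetPRGS

/-! The allocation is a discrete queue in disguise. A request passes a server to its right only when
that server is already full, so the number carried past consecutive servers obeys the Lindley
recursion `L (j+1) = (L j + N j - C j)⁺`, where `N j` counts the requests in the gap before server
`j` (`partialCrossing_succ`, `crossing_eq_lindley`). Integrating the Poisson process first, with the
servers frozen, shows that the triples of gap length, arrivals and capacity are i.i.d.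
(`lintegral_prod_gapData`). Hence `H` is the backlog chain of this queue, shifted by one server.

Existence of the limit uses order and a second moment. The recursion is monotone and starts at `0`,
so the backlog increases stochastically. The quadratic drift inequality bounds the averages of the
mean backlogs, because the drift, `lam / μ - meanCap`, is negative; monotonicity turns this into a
uniform bound (`exists_mean_bound`). Therefore the tails converge, no mass escapes, the limit has
finite mean, and the one-step equations pass to the limit.

Multiplying the balance equations by powers of `z` gives `den * pgf = num` on the closed disc. On
the unit circle the subtracted term of `den` has modulus below `1` except at `z = 1`, where the
strict comparison needed for Rouché breaks down. Instead, `den z / ((z - 1) z ^ (c - 1))` avoids the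
negative real axis just inside the circle: near `1` because the derivative there is positive,
elsewhere as a quotient of two numbers with positive real part. Its logarithm is then a primitive,
so `den` has as many zeros inside as `(z - 1) z ^ (c - 1)`, that is `c - 1`.

The numerator is a polynomial of degree at most `c` that always vanishes at `1`. A homogeneous
solution of the boundary equations would give it `c - 1` zeros inside and a double zero at `1`,
which is too many; and the map from unknowns to numerators is injective because `p c` and `k 0` are
nonzero. So `π 0, ..., π (c - 1)` are determined, and the balance equations give the other `π n`
recursively.

For the distances, the first `n` requests together travel to their next servers, and then cover each
later gap as many times as there are requests carried across it. The second part is a Lindley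
recursion fed by these `n` requests only, and the length of a gap is independent of the backlog
entering it. About `n / ρ` servers matter: domination by the limit law and a Chernoff bound give the
upper estimate, truncation and a Wald inequality the lower one (`tendsto_accBacklog`). In the first
part a gap contributes `lam E[X²] / 2` on average, and the elementary renewal theorem counts the
gaps (`tendsto_meanResidual`). -/

namespace HetPRGS

set_option linter.unusedSectionVars false

open scoped ENNReal

noncomputable section

section

/-! ### Deterministic properties of the Move To Right allocation -/

/-- Number of requests with index below `n` that are allocated to server `j`. -/
def load (r s : ℕ → ℝ) (C : ℕ → ℕ) (n j : ℕ) : ℕ :=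
  ((Finset.range n).filter fun i => mtr r s C i = j).card

/-- Number of requests with index below `n` that traverse the point just after server `j`. -/
def partialCrossing (r s : ℕ → ℝ) (C : ℕ → ℕ) (n j : ℕ) : ℕ :=
  ((Finset.range n).filter fun i => r i ≤ s j ∧ j < mtr r s C i).card

/-- Lindley recursion: backlog after `j` servers. -/
def lindley (N C : ℕ → ℕ) : ℕ → ℕ
  | 0 => 0
  | j + 1 => lindley N C j + N j - C j

/-- Arrivals per gap if only the first `n` requests are kept. -/
def truncArr (N : ℕ → ℕ) (n j : ℕ) : ℕ := min (N j) (n - ∑ i ∈ Finset.range j, N i)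

/-- Every request finds a server. -/
def Allocated (r s : ℕ → ℝ) (C : ℕ → ℕ) : Prop :=
  ∀ i, ∃ j, r i ≤ s j ∧ (Finset.univ.filter fun k : Fin i => mtr r s C k = j).card < C j

section Deterministic

variable {r s : ℕ → ℝ} {C : ℕ → ℕ}

lemma card_fin_filter_eq_load (i j : ℕ) :
    (Finset.univ.filter fun k : Fin i => mtr r s C k = j).card = load r s C i j := by
  rw [load, Finset.card_filter, Finset.card_filter,
    Fin.sum_univ_eq_sum_range (fun k => if mtr r s C k = j then 1 else 0)]

lemma mtr_eq (i : ℕ) : mtr r s C i = sInf {j | r i ≤ s j ∧ load r s C i j < C j} := by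
  rw [mtr]
  simp only [card_fin_filter_eq_load]

lemma mtr_mem (h : Allocated r s C) (i : ℕ) :
    r i ≤ s (mtr r s C i) ∧ load r s C i (mtr r s C i) < C (mtr r s C i) := by
  have hne : {j | r i ≤ s j ∧ load r s C i j < C j}.Nonempty := by
    obtain ⟨j, hj⟩ := h i
    rw [card_fin_filter_eq_load] at hj
    exact ⟨j, hj⟩
  have := Nat.sInf_mem hne
  rwa [← mtr_eq] at this

lemma le_load_of_lt_mtr {i j : ℕ} (hj : r i ≤ s j) (hlt : j < mtr r s C i) :
    C j ≤ load r s C i j := by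
  by_contra hcon
  rw [mtr_eq] at hlt
  exact absurd (Nat.sInf_le (s := {j | r i ≤ s j ∧ load r s C i j < C j}) ⟨hj, not_le.1 hcon⟩)
    (not_le.2 hlt)

lemma load_succ (n j : ℕ) :
    load r s C (n + 1) j = load r s C n j + if mtr r s C n = j then 1 else 0 := by
  unfold load
  rw [Finset.range_add_one, Finset.filter_insert]
  split_ifs with h
  · rw [Finset.card_insert_of_notMem (by simp)]
  · rfl

lemma load_mono (j : ℕ) : Monotone fun n => load r s C n j :=
  monotone_nat_of_le_succ fun n => by
    show load r s C n j ≤ load r s C (n + 1) j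
    rw [load_succ]; exact Nat.le_add_right _ _

lemma load_le (h : Allocated r s C) (n j : ℕ) : load r s C n j ≤ C j := by
  induction n with
  | zero => simp [load]
  | succ n ih =>
    rw [load_succ]
    split_ifs with hn
    · have := (mtr_mem h n).2
      rw [hn] at this
      exact this
    · simpa using ih

/-- Truncated subtraction is exact here for a dichotomy. If nobody is carried past `j`, all
candidates were served and fit within the capacity. If somebody is, server `j` was already full at
that moment and stays full, so exactly `C j` candidates are removed. -/
lemma partialCrossing_eq_sub (h : Allocated r s C) (n j : ℕ) :
    partialCrossing r s C n j =
      ((Finset.range n).filter fun i => r i ≤ s j ∧ j ≤ mtr r s C i).card - C j := by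
  have hU : ((Finset.range n).filter fun i => r i ≤ s j ∧ j ≤ mtr r s C i).card =
      partialCrossing r s C n j + load r s C n j := by
    unfold partialCrossing load
    rw [← Finset.card_union_of_disjoint]
    · congr 1
      ext i
      simp only [Finset.mem_filter, Finset.mem_range, Finset.mem_union]
      constructor
      · rintro ⟨h1, h2, h3⟩
        rcases h3.lt_or_eq with h4 | h4
        · exact Or.inl ⟨h1, h2, h4⟩
        · exact Or.inr ⟨h1, h4.symm⟩
      · rintro (⟨h1, h2, h3⟩ | ⟨h1, h2⟩)
        · exact ⟨h1, h2, h3.le⟩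
        · exact ⟨h1, h2 ▸ (mtr_mem h i).1, h2.ge⟩
    · rw [Finset.disjoint_left]
      intro i hi hi'
      simp only [Finset.mem_filter] at hi hi'
      omega
  rcases Nat.eq_zero_or_pos (partialCrossing r s C n j) with h0 | h0
  · have := load_le h n j
    omega
  · obtain ⟨i, hi⟩ := Finset.card_pos.1 h0
    simp only [Finset.mem_filter, Finset.mem_range] at hi
    have h1 := le_load_of_lt_mtr hi.2.1 hi.2.2
    have h2 := load_mono (r := r) (s := s) (C := C) j hi.1.le
    have h3 := load_le h n j
    simp only at h2
    omega

lemma partialCrossing_zero (h : Allocated r s C) (n : ℕ) :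
    partialCrossing r s C n 0 = ((Finset.range n).filter fun i => r i ≤ s 0).card - C 0 := by
  rw [partialCrossing_eq_sub h]
  simp

/-- The candidates for server `j + 1` are those carried past `j` together with the requests of the
gap between the two. Monotone locations guarantee that a request of this gap cannot have been served
at `j` or earlier. -/
lemma partialCrossing_succ (h : Allocated r s C) (hs : Monotone s) (n j : ℕ) :
    partialCrossing r s C n (j + 1) = partialCrossing r s C n j +
      ((Finset.range n).filter fun i => s j < r i ∧ r i ≤ s (j + 1)).card - C (j + 1) := by
  rw [partialCrossing_eq_sub h n (j + 1)]
  congr 1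
  unfold partialCrossing
  rw [← Finset.card_union_of_disjoint]
  · congr 1
    ext i
    simp only [Finset.mem_filter, Finset.mem_range, Finset.mem_union]
    constructor
    · rintro ⟨h1, h2, h3⟩
      rcases le_or_gt (r i) (s j) with h4 | h4
      · exact Or.inl ⟨h1, h4, h3⟩
      · exact Or.inr ⟨h1, h4, h2⟩
    · rintro (⟨h1, h2, h3⟩ | ⟨h1, h2, h3⟩)
      · exact ⟨h1, h2.trans (hs (Nat.le_succ j)), h3⟩
      · refine ⟨h1, h3, ?_⟩
        by_contra hcon
        exact absurd ((mtr_mem h i).1.trans (hs (by omega : mtr r s C i ≤ j))) (not_le.2 h2)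
  · rw [Finset.disjoint_left]
    intro i hi hi'
    simp only [Finset.mem_filter] at hi hi'
    exact absurd hi.2.1 (not_le.2 hi'.2.1)

/-- Pigeonhole: `i` earlier requests cannot fill `i + 1` servers of positive capacity, and such a
block of servers exists to the right of request `i`. -/
lemma Allocated.of_tendsto (hs : Tendsto s atTop atTop) (hC : ∀ j, 1 ≤ C j) :
    Allocated r s C := by
  intro i
  obtain ⟨m, hm⟩ := eventually_atTop.1 (hs.eventually_ge_atTop (r i))
  by_contra hcon
  push Not at hcon
  have hsub : Finset.Ico m (m + i + 1) ⊆ (Finset.range i).image (mtr r s C) := by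
    intro j hj
    rw [Finset.mem_Ico] at hj
    have h1 := hcon j (hm j hj.1)
    rw [card_fin_filter_eq_load] at h1
    obtain ⟨k, hk⟩ := Finset.card_pos.1 (lt_of_lt_of_le (hC j) h1)
    rw [Finset.mem_filter] at hk
    exact Finset.mem_image.2 ⟨k, hk⟩
  have h1 := Finset.card_le_card hsub
  have h2 := (Finset.card_image_le (s := Finset.range i) (f := mtr r s C))
  simp only [Nat.card_Ico, Finset.card_range] at h1 h2
  omega

/-! ### Counting requests -/

section Count

variable (hpos : 0 < r 0) (hmono : Monotone r) (htop : Tendsto r atTop atTop)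

include hpos hmono htop

/-- This equivalence between indices and locations characterizes the counting function, and reduces
the later counting identities to arithmetic on intervals of indices. -/
lemma lt_count_iff (i : ℕ) (x : ℝ) : i < count r 0 x ↔ r i ≤ x := by
  have hset : {i | 0 < r i ∧ r i ≤ x} = {i | r i ≤ x} := by
    ext i
    exact ⟨fun h => h.2, fun h => ⟨hpos.trans_le (hmono (Nat.zero_le i)), h⟩⟩
  obtain ⟨m, hm⟩ := eventually_atTop.1 (htop.eventually_gt_atTop x)
  have hex : ∃ m, x < r m := ⟨m, hm m le_rfl⟩
  classical
  have hset' : {i | r i ≤ x} = (Finset.range (Nat.find hex) : Set ℕ) := by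
    ext i
    simp only [Set.mem_ofPred_eq, Finset.coe_range, Set.mem_Iio]
    constructor
    · intro h
      by_contra hcon
      exact absurd ((Nat.find_spec hex).trans_le (hmono (not_lt.1 hcon))) (not_lt.2 h)
    · intro h
      exact not_lt.1 (Nat.find_min hex h)
  have hc : count r 0 x = Nat.find hex := by
    rw [count, hset, hset', Set.ncard_coe_finset, Finset.card_range]
  have h2 : i ∈ {i | r i ≤ x} ↔ i ∈ (Finset.range (Nat.find hex) : Set ℕ) := by rw [hset']
  rw [hc]
  simpa using h2.symm

lemma count_eq_sub (a b : ℝ) :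
    count r a b = count r 0 b - count r 0 a := by
  have : {i | a < r i ∧ r i ≤ b} = (Finset.Ico (count r 0 a) (count r 0 b) : Set ℕ) := by
    ext i
    rw [Finset.coe_Ico, Set.mem_Ico, lt_count_iff hpos hmono htop, ← not_lt,
      lt_count_iff hpos hmono htop, not_le, Set.mem_ofPred_eq]
  rw [count, this, Set.ncard_coe_finset, Nat.card_Ico]

lemma count_mono {a b : ℝ} (hab : a ≤ b) : count r 0 a ≤ count r 0 b := by
  by_contra hcon
  have h1 := (lt_count_iff hpos hmono htop _ _).1 (not_le.1 hcon)
  exact absurd ((lt_count_iff hpos hmono htop _ _).2 (h1.trans hab)) (lt_irrefl _)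

lemma count_self_zero : count r 0 0 = 0 := by
  by_contra hcon
  exact absurd ((lt_count_iff hpos hmono htop 0 0).1 (Nat.pos_of_ne_zero hcon)) (not_le.2 hpos)

variable {t : ℕ → ℝ} (ht0 : t 0 = 0) (ht : Monotone t)

include ht0 ht

lemma sum_count (j : ℕ) :
    ∑ i ∈ Finset.range j, count r (t i) (t (i + 1)) = count r 0 (t j) := by
  induction j with
  | zero => simp [ht0, count_self_zero hpos hmono htop]
  | succ j ih =>
    have h1 : t j ≤ t (j + 1) := ht (Nat.le_succ j)
    rw [Finset.sum_range_succ, ih, count_eq_sub hpos hmono htop (t j) (t (j + 1))]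
    have := count_mono hpos hmono htop h1
    omega

lemma card_filter_gap (n j : ℕ) :
    ((Finset.range n).filter fun i => t j < r i ∧ r i ≤ t (j + 1)).card =
      truncArr (fun j => count r (t j) (t (j + 1))) n j := by
  have h1 : t j ≤ t (j + 1) := ht (Nat.le_succ j)
  have h2 := count_mono hpos hmono htop h1
  have : ((Finset.range n).filter fun i => t j < r i ∧ r i ≤ t (j + 1)) =
      Finset.Ico (count r 0 (t j)) (min n (count r 0 (t (j + 1)))) := by
    ext i
    rw [Finset.mem_filter, Finset.mem_Ico, lt_min_iff, lt_count_iff hpos hmono htop,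
      ← not_lt (a := i) (b := count r 0 (t j)), lt_count_iff hpos hmono htop, not_le, Finset.mem_range]
    tauto
  rw [this, Nat.card_Ico, truncArr, sum_count hpos hmono htop ht0 ht,
    count_eq_sub hpos hmono htop (t j) (t (j + 1))]
  omega

/-- Server `j` sits at `t (j + 1)`, and `lindley` starts with the empty backlog before any server;
hence the index `j + 1` on the right. -/
lemma partialCrossing_eq_lindley (h : Allocated r (fun j => t (j + 1)) C) (n j : ℕ) :
    partialCrossing r (fun j => t (j + 1)) C n j =
      lindley (truncArr (fun j => count r (t j) (t (j + 1))) n) C (j + 1) := by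
  induction j with
  | zero =>
    rw [partialCrossing_zero h, lindley, lindley, ← card_filter_gap hpos hmono htop ht0 ht]
    have : ∀ i, 0 < r i := fun i => hpos.trans_le (hmono (Nat.zero_le i))
    simp [ht0, this]
  | succ j ih =>
    rw [partialCrossing_succ h (fun a b hab => ht (by omega)), ih,
      card_filter_gap hpos hmono htop ht0 ht, lindley.eq_2 _ _ (j + 1)]

end Count

lemma lindley_congr {N N' C : ℕ → ℕ} {j : ℕ} (h : ∀ i < j, N i = N' i) :
    lindley N C j = lindley N' C j := by
  induction j with
  | zero => rfl
  | succ j ih =>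
    rw [lindley, lindley, ih fun i hi => h i (by omega), h j (by omega)]

lemma truncArr_of_sum_le {N : ℕ → ℕ} {n j : ℕ} (h : ∑ i ∈ Finset.range (j + 1), N i ≤ n) :
    truncArr N n j = N j := by
  rw [Finset.sum_range_succ] at h
  unfold truncArr
  omega

lemma lindley_truncArr_eq {N C : ℕ → ℕ} {n j : ℕ} (h : ∑ i ∈ Finset.range j, N i ≤ n) :
    lindley (truncArr N n) C j = lindley N C j := by
  refine lindley_congr fun i hi => truncArr_of_sum_le (le_trans ?_ h)
  exact Finset.sum_le_sum_of_subset (Finset.range_subset_range.2 hi)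

lemma lindley_truncArr_le (N C : ℕ → ℕ) (n j : ℕ) :
    lindley (truncArr N n) C j ≤ lindley N C j := by
  induction j with
  | zero => rfl
  | succ j ih =>
    rw [lindley, lindley]
    have : truncArr N n j ≤ N j := min_le_left _ _
    omega

lemma sum_truncArr_le (N : ℕ → ℕ) (n j : ℕ) : ∑ i ∈ Finset.range j, truncArr N n i ≤ n := by
  have : ∑ i ∈ Finset.range j, truncArr N n i ≤ min n (∑ i ∈ Finset.range j, N i) := by
    induction j with
    | zero => simp
    | succ j ih =>
      rw [Finset.sum_range_succ, Finset.sum_range_succ]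
      have h1 : truncArr N n j ≤ N j := min_le_left _ _
      have h2 : truncArr N n j ≤ n - ∑ i ∈ Finset.range j, N i := min_le_right _ _
      omega
  exact this.trans (min_le_left _ _)

lemma lindley_le_sum (N C : ℕ → ℕ) (j : ℕ) : lindley N C j ≤ ∑ i ∈ Finset.range j, N i := by
  induction j with
  | zero => simp [lindley]
  | succ j ih =>
    rw [lindley, Finset.sum_range_succ]
    omega

lemma lindley_truncArr_le_right (N C : ℕ → ℕ) (n j : ℕ) : lindley (truncArr N n) C j ≤ n :=
  (lindley_le_sum _ _ _).trans (sum_truncArr_le _ _ _)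

/-- Once the first `n` requests have arrived, every server reduces the backlog. -/
lemma lindley_truncArr_depletion {N C : ℕ → ℕ} (hC : ∀ j, 1 ≤ C j) {n m : ℕ}
    (h : n ≤ ∑ i ∈ Finset.range m, N i) (d : ℕ) :
    lindley (truncArr N n) C (m + d) ≤ min (lindley N C m) n - d := by
  induction d with
  | zero =>
    exact le_min (lindley_truncArr_le _ _ _ _) (lindley_truncArr_le_right _ _ _ _)
  | succ d ih =>
    rw [← add_assoc, lindley]
    have h1 : truncArr N n (m + d) = 0 := by
      have : ∑ i ∈ Finset.range m, N i ≤ ∑ i ∈ Finset.range (m + d), N i :=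
        Finset.sum_le_sum_of_subset (Finset.range_subset_range.2 (Nat.le_add_right _ _))
      unfold truncArr
      omega
    have := hC (m + d)
    omega

/-- Keeping just the requests located up to server `j` loses nothing: these are finitely many, and
the truncation of the input is invisible to the first `j + 1` steps of the recursion. -/
lemma crossing_eq_lindley (hpos : 0 < r 0) (hmono : Monotone r) (htop : Tendsto r atTop atTop)
    {t : ℕ → ℝ} (ht0 : t 0 = 0) (ht : Monotone t)
    (h : Allocated r (fun j => t (j + 1)) C) (j : ℕ) :
    crossing r (fun j => t (j + 1)) C j =
      lindley (fun j => count r (t j) (t (j + 1))) C (j + 1) := by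
  have h1 : crossing r (fun j => t (j + 1)) C j =
      partialCrossing r (fun j => t (j + 1)) C (count r 0 (t (j + 1))) j := by
    unfold crossing partialCrossing
    rw [← Set.ncard_coe_finset]
    congr 1
    ext i
    simp only [Set.mem_ofPred_eq, Finset.coe_filter, Finset.mem_range,
      lt_count_iff hpos hmono htop]
    tauto
  rw [h1, partialCrossing_eq_lindley hpos hmono htop ht0 ht h, lindley_truncArr_eq]
  rw [sum_count hpos hmono htop ht0 ht]

/-! ### Travelled distances -/

/-- Distance from request `i` to the next server. -/
def residual (r t : ℕ → ℝ) (i : ℕ) : ℝ≥0∞ :=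
  ∑' j, if t j < r i ∧ r i ≤ t (j + 1) then ENNReal.ofReal (t (j + 1) - r i) else 0

/-- Total distance from the requests of a gap `(a, b]` to its right end. -/
def gapDist (r : ℕ → ℝ) (a b : ℝ) : ℝ≥0∞ :=
  ∑' i, if a < r i ∧ r i ≤ b then ENNReal.ofReal (b - r i) else 0

/-- The trip splits at the servers: a first piece up to the next server, then one whole gap for
every server that is passed, which telescopes. Working in `ℝ≥0∞` makes the later exchanges of sums
and integrals free of summability conditions. -/
lemma ofReal_reqDist (hpos : 0 < r 0) (hmono : Monotone r) {t : ℕ → ℝ} (ht0 : t 0 = 0)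
    (ht : Monotone t) (h : Allocated r (fun j => t (j + 1)) C) (i : ℕ) :
    ENNReal.ofReal (reqDist r (fun j => t (j + 1)) C i) = residual r t i +
      ∑' j, ENNReal.ofReal (t (j + 2) - t (j + 1)) *
        (if r i ≤ t (j + 1) ∧ j < mtr r (fun j => t (j + 1)) C i then 1 else 0) := by
  set M := mtr r (fun j => t (j + 1)) C i with hM
  have hMle : r i ≤ t (M + 1) := (mtr_mem h i).1
  have hri : t 0 < r i := ht0 ▸ hpos.trans_le (hmono (Nat.zero_le i))
  have hex : ∃ a, r i ≤ t (a + 1) := ⟨M, hMle⟩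
  classical
  set a := Nat.find hex with ha
  have ha1 : r i ≤ t (a + 1) := Nat.find_spec hex
  have ha2 : ∀ b ≤ a, t b < r i := by
    intro b hb
    rcases b with _ | b
    · exact hri
    · exact not_le.1 (Nat.find_min hex (show b < a by omega))
  have haM : a ≤ M := Nat.find_min' hex hMle
  have hres : residual r t i = ENNReal.ofReal (t (a + 1) - r i) := by
    unfold residual
    rw [tsum_eq_single a]
    · rw [if_pos ⟨ha2 a le_rfl, ha1⟩]
    · intro b hb
      rw [if_neg]
      rintro ⟨h1, h2⟩
      rcases lt_or_gt_of_ne hb with h3 | h3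
      · exact absurd h2 (not_le.2 (ha2 (b + 1) (by omega)))
      · exact absurd (ha1.trans (ht (show a + 1 ≤ b by omega))) (not_le.2 h1)
  have hsum : (∑' j, ENNReal.ofReal (t (j + 2) - t (j + 1)) *
        (if r i ≤ t (j + 1) ∧ j < M then (1 : ℝ≥0∞) else 0)) =
      ∑ j ∈ Finset.Ico a M, ENNReal.ofReal (t (j + 2) - t (j + 1)) := by
    rw [tsum_eq_sum (s := Finset.Ico a M)]
    · refine Finset.sum_congr rfl fun j hj => ?_
      rw [Finset.mem_Ico] at hj
      rw [if_pos ⟨ha1.trans (ht (by omega)), hj.2⟩, mul_one]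
    · intro j hj
      rw [Finset.mem_Ico] at hj
      rw [if_neg, mul_zero]
      rintro ⟨h1, h2⟩
      exact hj ⟨Nat.find_min' hex h1, h2⟩
  rw [hsum, hres, ← ENNReal.ofReal_sum_of_nonneg
    (fun j _ => sub_nonneg.2 (ht (by omega))), ← ENNReal.ofReal_add (sub_nonneg.2 ha1)
    (Finset.sum_nonneg fun j _ => sub_nonneg.2 (ht (by omega)))]
  congr 1
  have := Finset.sum_Ico_sub (fun j => t (j + 1)) haM
  simp only [add_assoc, Nat.reduceAdd] at this
  rw [this, reqDist]
  ring

/-- After exchanging the sums, the gap following server `j` is counted once for each of the first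
`n` requests carried past `j`. -/
lemma sum_ofReal_reqDist (hpos : 0 < r 0) (hmono : Monotone r) {t : ℕ → ℝ} (ht0 : t 0 = 0)
    (ht : Monotone t) (h : Allocated r (fun j => t (j + 1)) C) (n : ℕ) :
    ∑ i ∈ Finset.range n, ENNReal.ofReal (reqDist r (fun j => t (j + 1)) C i) =
      ∑ i ∈ Finset.range n, residual r t i +
      ∑' j, ENNReal.ofReal (t (j + 2) - t (j + 1)) *
        (partialCrossing r (fun j => t (j + 1)) C n j : ℝ≥0∞) := by
  simp_rw [ofReal_reqDist hpos hmono ht0 ht h]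
  rw [Finset.sum_add_distrib]
  congr 1
  rw [← Summable.tsum_finsetSum (fun _ _ => ENNReal.summable)]
  refine tsum_congr fun j => ?_
  rw [← Finset.mul_sum, Finset.sum_boole]
  rfl

lemma sum_residual (t : ℕ → ℝ) (n : ℕ) :
    ∑ i ∈ Finset.range n, residual r t i = ∑' j, ∑ i ∈ Finset.range n,
      if t j < r i ∧ r i ≤ t (j + 1) then ENNReal.ofReal (t (j + 1) - r i) else 0 := by
  unfold residual
  rw [← Summable.tsum_finsetSum (fun _ _ => ENNReal.summable)]

/-- The gap cut by the `n`-th request is awkward, so the residual distances are sandwiched: here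
every gap that begins before `n` requests have arrived is counted entirely; in `le_sum_residual`
only gaps completed by the first `n` requests are counted. -/
lemma sum_residual_le (hpos : 0 < r 0) (hmono : Monotone r) (htop : Tendsto r atTop atTop)
    (t : ℕ → ℝ) (n : ℕ) :
    ∑ i ∈ Finset.range n, residual r t i ≤
      ∑' j, if count r 0 (t j) < n then gapDist r (t j) (t (j + 1)) else 0 := by
  rw [sum_residual]
  refine ENNReal.tsum_le_tsum fun j => ?_
  split_ifs with hj
  · exact ENNReal.sum_le_tsum _
  · refine (Finset.sum_eq_zero fun i hi => if_neg ?_).le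
    rintro ⟨h1, -⟩
    rw [Finset.mem_range] at hi
    exact absurd ((lt_count_iff hpos hmono htop i (t j)).1 (by omega)) (not_le.2 h1)

lemma le_sum_residual (hpos : 0 < r 0) (hmono : Monotone r) (htop : Tendsto r atTop atTop)
    (t : ℕ → ℝ) (n : ℕ) :
    (∑' j, if count r 0 (t (j + 1)) ≤ n then gapDist r (t j) (t (j + 1)) else 0) ≤
      ∑ i ∈ Finset.range n, residual r t i := by
  rw [sum_residual]
  refine ENNReal.tsum_le_tsum fun j => ?_
  split_ifs with hj
  · unfold gapDist
    rw [tsum_eq_sum (s := Finset.range n)]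
    intro i hi
    refine if_neg ?_
    rintro ⟨-, h2⟩
    have := (lt_count_iff hpos hmono htop i _).2 h2
    rw [Finset.mem_range] at hi
    omega
  · exact zero_le

end Deterministic

end

section

/-! ### Joint law of gaps, arrivals and capacities -/

/-- A measurable expression for the cardinality. It also holds for infinite sets, where both
`Set.ncard` and `toReal ⊤` are `0`, so measurability of `count` needs no almost sure restriction. -/
lemma count_eq_floor (r : ℕ → ℝ) (a b : ℝ) :
    count r a b = ⌊(∑' i, if a < r i ∧ r i ≤ b then (1 : ℝ≥0∞) else 0).toReal⌋₊ := by
  have h1 : (∑' i, if a < r i ∧ r i ≤ b then (1 : ℝ≥0∞) else 0) =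
      ({i | a < r i ∧ r i ≤ b}.encard : ℝ≥0∞) := by
    rw [← ENNReal.tsum_set_one, tsum_subtype {i | a < r i ∧ r i ≤ b} (fun _ => (1 : ℝ≥0∞))]
    refine tsum_congr fun i => ?_
    simp [Set.indicator_apply]
  rw [h1, count, Set.ncard]
  cases {i | a < r i ∧ r i ≤ b}.encard using ENat.recTopCoe with
  | top => simp
  | coe n => simp

lemma tsum_indicator_eq_count {r : ℕ → ℝ} (htop : Tendsto r atTop atTop) (a b : ℝ) :
    (∑' i, if a < r i ∧ r i ≤ b then (1 : ℝ≥0∞) else 0) = count r a b := by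
  have h1 : (∑' i, if a < r i ∧ r i ≤ b then (1 : ℝ≥0∞) else 0) =
      ({i | a < r i ∧ r i ≤ b}.encard : ℝ≥0∞) := by
    rw [← ENNReal.tsum_set_one, tsum_subtype {i | a < r i ∧ r i ≤ b} (fun _ => (1 : ℝ≥0∞))]
    refine tsum_congr fun i => ?_
    simp [Set.indicator_apply]
  have hfin : {i | a < r i ∧ r i ≤ b}.Finite := by
    obtain ⟨m, hm⟩ := eventually_atTop.1 (htop.eventually_gt_atTop b)
    refine (Set.finite_Iio m).subset fun i hi => ?_
    by_contra hcon
    exact absurd (hm i (not_lt.1 hcon)) (not_lt.2 hi.2)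
  rw [h1, count, ← hfin.cast_ncard_eq]
  simp

lemma measurableSet_gap {α : Type*} [MeasurableSpace α] {f a b : α → ℝ} (hf : Measurable f)
    (ha : Measurable a) (hb : Measurable b) : MeasurableSet {x | a x < f x ∧ f x ≤ b x} :=
  (measurableSet_lt ha hf).inter (measurableSet_le hf hb)

lemma measurable_count {α : Type*} [MeasurableSpace α] {ρ : α → ℕ → ℝ} {a b : α → ℝ}
    (hρ : Measurable ρ) (ha : Measurable a) (hb : Measurable b) :
    Measurable fun x => count (ρ x) (a x) (b x) := by
  simp_rw [count_eq_floor]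
  refine Nat.measurable_floor.comp (ENNReal.measurable_toReal.comp ?_)
  refine Measurable.tsum fun i => ?_
  exact Measurable.ite (measurableSet_gap ((measurable_pi_apply i).comp hρ) ha hb)
    measurable_const measurable_const

lemma measurable_gapDist {α : Type*} [MeasurableSpace α] {ρ : α → ℕ → ℝ} {a b : α → ℝ}
    (hρ : Measurable ρ) (ha : Measurable a) (hb : Measurable b) :
    Measurable fun x => gapDist (ρ x) (a x) (b x) := by
  unfold gapDist
  refine Measurable.tsum fun i => ?_
  have hi := (measurable_pi_apply i).comp hρ
  exact Measurable.ite (measurableSet_gap hi ha hb)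
    (ENNReal.measurable_ofReal.comp (hb.sub hi)) measurable_const

/-- Partial sums of the distances: the origin followed by the server locations. -/
def grid (x : ℕ → ℝ) (n : ℕ) : ℝ := ∑ k ∈ Finset.range n, x k

lemma grid_zero (x : ℕ → ℝ) : grid x 0 = 0 := rfl

lemma grid_succ (x : ℕ → ℝ) (n : ℕ) : grid x (n + 1) = grid x n + x n :=
  Finset.sum_range_succ _ _

lemma grid_mono {x : ℕ → ℝ} (hx : ∀ n, 0 ≤ x n) : Monotone (grid x) :=
  monotone_nat_of_le_succ fun n => by rw [grid_succ]; linarith [hx n]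

/-- Law of the number of requests in an interval of length `x`. -/
abbrev gapLaw (lam x : ℝ) : Measure ℕ := poissonMeasure (lam * x).toNNReal

lemma lintegral_gapLaw (lam x : ℝ) (f : ℕ → ℝ≥0∞) :
    ∫⁻ v, f v ∂gapLaw lam x = ∑' v, f v * ENNReal.ofReal
      (Real.exp (-((lam * x).toNNReal : ℝ)) * ((lam * x).toNNReal : ℝ) ^ v / (v.factorial : ℝ)) := by
  rw [lintegral_countable']
  simp_rw [poissonMeasure_singleton]

lemma measurable_lintegral_gapLaw {α : Type*} [MeasurableSpace α] (lam : ℝ) {x : α → ℝ}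
    (hx : Measurable x) {f : α → ℕ → ℝ≥0∞} (hf : ∀ v, Measurable fun a => f a v) :
    Measurable fun a => ∫⁻ v, f a v ∂gapLaw lam (x a) := by
  simp_rw [lintegral_gapLaw]
  refine Measurable.tsum fun v => (hf v).mul (ENNReal.measurable_ofReal.comp ?_)
  have : Measurable fun a => (((lam * x a).toNNReal : ℝ≥0) : ℝ) :=
    ((hx.const_mul lam).real_toNNReal).coe_nnreal_real
  exact ((Real.measurable_exp.comp this.neg).mul (this.pow_const v)).div_const _

section Network

variable {Ω : Type*} [MeasurableSpace Ω] {P : Measure Ω} [IsProbabilityMeasure P] {lam : ℝ}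
  {ν : Measure ℝ} {p : ℕ → ℝ} {r X : ℕ → Ω → ℝ} {C : ℕ → Ω → ℕ}

/-- Number of requests in the gap before server `j`. -/
def arrivals (r X : ℕ → Ω → ℝ) (j : ℕ) (ω : Ω) : ℕ :=
  count (fun i => r i ω) (grid (fun n => X n ω) j) (grid (fun n => X n ω) (j + 1))

/-- Distance, arrivals and capacity associated with server `j`. -/
def gapData (r X : ℕ → Ω → ℝ) (C : ℕ → Ω → ℕ) (j : ℕ) (ω : Ω) : ℝ × ℕ × ℕ :=
  (X j ω, arrivals r X j ω, C j ω)

namespace IsNetwork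

variable (h : IsNetwork P lam ν p r X C)

include h

lemma measurable_requests : Measurable fun (ω : Ω) (i : ℕ) => r i ω :=
  measurable_pi_lambda _ h.poisson.measurable

lemma measurable_servers : Measurable fun (ω : Ω) (j : ℕ) => (X j ω, C j ω) :=
  measurable_pi_lambda _ fun j => (h.measurable_dist j).prodMk (h.measurable_cap j)

lemma measurable_grid (n : ℕ) : Measurable fun ω => grid (fun k => X k ω) n :=
  Finset.measurable_fun_sum _ fun k _ => h.measurable_dist k

lemma measurable_arrivals (j : ℕ) : Measurable (arrivals r X j) :=
  measurable_count h.measurable_requests (h.measurable_grid j) (h.measurable_grid (j + 1))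

lemma measurable_gapData (j : ℕ) : Measurable (gapData r X C j) :=
  (h.measurable_dist j).prodMk ((h.measurable_arrivals j).prodMk (h.measurable_cap j))

/-- Requests and servers are integrated separately. -/
lemma lintegral_requests_servers {Φ : (ℕ → ℝ) × (ℕ → ℝ × ℕ) → ℝ≥0∞} (hΦ : Measurable Φ) :
    ∫⁻ ω, Φ (fun i => r i ω, fun j => (X j ω, C j ω)) ∂P =
      ∫⁻ ω, ∫⁻ ω', Φ (fun i => r i ω', fun j => (X j ω, C j ω)) ∂P ∂P := by
  have h1 := h.measurable_requests
  have h2 := h.measurable_servers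
  have := Measure.isProbabilityMeasure_map (μ := P) h1.aemeasurable
  have := Measure.isProbabilityMeasure_map (μ := P) h2.aemeasurable
  rw [← lintegral_map (f := Φ) hΦ (h1.prodMk h2),
    h.indep_requests.map_prod_eq_prod_map_map h1.aemeasurable h2.aemeasurable,
    lintegral_prod_symm _ hΦ.aemeasurable, lintegral_map (hΦ.lintegral_prod_left') h2]
  refine lintegral_congr fun ω => ?_
  exact lintegral_map (f := fun x => Φ (x, fun j => (X j ω, C j ω)))
    (hΦ.comp measurable_prodMk_right) h1

lemma ae_dist_nonneg (hν : ν (Set.Iio 0) = 0) : ∀ᵐ ω ∂P, ∀ j, 0 ≤ X j ω := by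
  rw [ae_all_iff]
  intro j
  rw [ae_iff]
  have : {a | ¬0 ≤ X j a} = X j ⁻¹' Set.Iio 0 := by ext; simp
  rw [this, ← Measure.map_apply (h.measurable_dist j) measurableSet_Iio, h.law_dist j, hν]

lemma iIndepFun_count {x : ℕ → ℝ} (hx : ∀ n, 0 ≤ x n) :
    iIndepFun (fun (n : ℕ) (ω : Ω) => count (fun i => r i ω) (grid x n) (grid x (n + 1))) P :=
  h.poisson.indep _ (grid_zero x).ge (grid_mono hx)

lemma lintegral_count {a b : ℝ} (ha : 0 ≤ a) (hab : a ≤ b) (f : ℕ → ℝ≥0∞) :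
    ∫⁻ ω, f (count (fun i => r i ω) a b) ∂P = ∫⁻ v, f v ∂gapLaw lam (b - a) := by
  rw [gapLaw, ← h.poisson.law a b ha hab, lintegral_map (measurable_of_countable f)
    (measurable_count h.measurable_requests measurable_const measurable_const)]

/-- With the servers frozen, the gaps form a deterministic grid, on which the counts are independent
Poisson variables whose means depend only on the gap lengths. The inner integral thus factorizes,
and independence of the servers factorizes the outer one. Independence and the common law of the gap
data both follow from this formula. -/
lemma lintegral_prod_gapData (hν : ν (Set.Iio 0) = 0) (S : Finset ℕ)
    {F : ℕ → ℝ × ℕ × ℕ → ℝ≥0∞} (hF : ∀ j, Measurable (F j)) :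
    ∫⁻ ω, ∏ j ∈ S, F j (gapData r X C j ω) ∂P =
      ∏ j ∈ S, ∫⁻ ω, ∫⁻ v, F j (X j ω, v, C j ω) ∂gapLaw lam (X j ω) ∂P := by
  have hg : ∀ n, Measurable fun q : (ℕ → ℝ) × (ℕ → ℝ × ℕ) => grid (fun k => (q.2 k).1) n := by
    intro n
    unfold grid
    fun_prop
  have hΦ : Measurable fun q : (ℕ → ℝ) × (ℕ → ℝ × ℕ) => ∏ j ∈ S, F j ((q.2 j).1,
      count q.1 (grid (fun k => (q.2 k).1) j) (grid (fun k => (q.2 k).1) (j + 1)), (q.2 j).2) := by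
    refine Finset.measurable_fun_prod _ fun j _ => (hF j).comp ?_
    exact Measurable.prodMk (by fun_prop)
      (Measurable.prodMk (measurable_count measurable_fst (hg j) (hg (j + 1))) (by fun_prop))
  have h1 : ∫⁻ ω, ∏ j ∈ S, F j (gapData r X C j ω) ∂P = ∫⁻ ω, ∫⁻ ω', ∏ j ∈ S, F j (X j ω,
      count (fun i => r i ω') (grid (fun k => X k ω) j) (grid (fun k => X k ω) (j + 1)),
      C j ω) ∂P ∂P := h.lintegral_requests_servers hΦ
  rw [h1]
  have hG : ∀ j, Measurable fun y : ℝ × ℕ => ∫⁻ v, F j (y.1, v, y.2) ∂gapLaw lam y.1 := by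
    intro j
    exact measurable_lintegral_gapLaw lam measurable_fst fun v => (hF j).comp (by fun_prop)
  have h2 : ∫⁻ ω, ∏ j ∈ S, ∫⁻ v, F j (X j ω, v, C j ω) ∂gapLaw lam (X j ω) ∂P =
      ∏ j ∈ S, ∫⁻ ω, ∫⁻ v, F j (X j ω, v, C j ω) ∂gapLaw lam (X j ω) ∂P := by
    generalize hGdef : (fun j (y : ℝ × ℕ) => ∫⁻ v, F j (y.1, v, y.2) ∂gapLaw lam y.1) = G
    have hG' : ∀ j, Measurable (G j) := fun j => hGdef ▸ hG j
    have hGe : ∀ j ω, ∫⁻ v, F j (X j ω, v, C j ω) ∂gapLaw lam (X j ω) = G j (X j ω, C j ω) :=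
      fun j ω => hGdef ▸ rfl
    simp_rw [hGe]
    exact lintegral_prod_eq_prod_lintegral_of_indepFun S
      (fun j ω => G j (X j ω, C j ω)) (h.indep_servers.comp G hG')
      fun j => (hG' j).comp ((h.measurable_dist j).prodMk (h.measurable_cap j))
  rw [← h2]
  refine lintegral_congr_ae ?_
  filter_upwards [h.ae_dist_nonneg hν] with ω hω
  refine (lintegral_prod_eq_prod_lintegral_of_indepFun S
    (fun j ω' => F j (X j ω, count (fun i => r i ω') (grid (fun k => X k ω) j)
      (grid (fun k => X k ω) (j + 1)), C j ω))
    ((h.iIndepFun_count hω).comp (fun j v => F j (X j ω, v, C j ω))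
      fun j => measurable_of_countable _)
    (fun j => (measurable_of_countable (fun v => F j (X j ω, v, C j ω))).comp
      (measurable_count h.measurable_requests measurable_const measurable_const))).trans ?_
  refine Finset.prod_congr rfl fun j _ => ?_
  have h0 : 0 ≤ grid (fun k => X k ω) j := (grid_zero fun k => X k ω) ▸
    grid_mono hω (Nat.zero_le j)
  rw [h.lintegral_count h0 (grid_mono hω (Nat.le_succ j)) (fun v => F j (X j ω, v, C j ω)),
    grid_succ, add_sub_cancel_left]

lemma lintegral_gapData (hν : ν (Set.Iio 0) = 0) (j : ℕ) {F : ℝ × ℕ × ℕ → ℝ≥0∞}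
    (hF : Measurable F) :
    ∫⁻ ω, F (gapData r X C j ω) ∂P =
      ∫⁻ ω, ∫⁻ v, F (X j ω, v, C j ω) ∂gapLaw lam (X j ω) ∂P := by
  simpa using h.lintegral_prod_gapData hν {j} (F := fun _ => F) fun _ => hF

theorem iIndepFun_gapData (hν : ν (Set.Iio 0) = 0) : iIndepFun (gapData r X C) P := by
  rw [iIndepFun_iff_measure_inter_preimage_eq_mul]
  classical
  intro S B hB
  -- Measurability of `B j` is known only for `j ∈ S`; elsewhere the set is replaced by `∅`, which
  -- the product over `S` does not see.
  have hB' : ∀ j, MeasurableSet (if j ∈ S then B j else ∅) := by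
    intro j
    split_ifs with hj
    · exact hB j hj
    · exact MeasurableSet.empty
  have hm : ∀ j, Measurable ((if j ∈ S then B j else ∅).indicator fun _ => (1 : ℝ≥0∞)) :=
    fun j => measurable_const.indicator (hB' j)
  have h1 := h.lintegral_prod_gapData hν S hm
  simp_rw [← fun j => h.lintegral_gapData hν j (hm j)] at h1
  have h2 : ∀ j ∈ S, ∫⁻ ω, (if j ∈ S then B j else ∅).indicator (fun _ => (1 : ℝ≥0∞))
      (gapData r X C j ω) ∂P = P (gapData r X C j ⁻¹' B j) := by
    intro j hj
    rw [if_pos hj, ← lintegral_indicator_one (h.measurable_gapData j (hB j hj))]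
    rfl
  rw [Finset.prod_congr rfl h2] at h1
  rw [← h1, ← lintegral_indicator_one (Finset.measurableSet_biInter S
    fun j hj => h.measurable_gapData j (hB j hj))]
  refine lintegral_congr fun ω => ?_
  have h3 : ∏ j ∈ S, (if j ∈ S then B j else ∅).indicator (fun _ => (1 : ℝ≥0∞))
      (gapData r X C j ω) = ∏ j ∈ S, if gapData r X C j ω ∈ B j then (1 : ℝ≥0∞) else 0 := by
    refine Finset.prod_congr rfl fun j hj => ?_
    rw [if_pos hj, Set.indicator_apply]
  rw [h3, Finset.prod_boole, Set.indicator_apply]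
  simp

lemma identDistrib_servers (j : ℕ) :
    IdentDistrib (fun ω => (X j ω, C j ω)) (fun ω => (X 0 ω, C 0 ω)) P P where
  aemeasurable_fst := ((h.measurable_dist j).prodMk (h.measurable_cap j)).aemeasurable
  aemeasurable_snd := ((h.measurable_dist 0).prodMk (h.measurable_cap 0)).aemeasurable
  map_eq := by
    rw [(h.indep_dist_cap j).map_prod_eq_prod_map_map (h.measurable_dist j).aemeasurable
      (h.measurable_cap j).aemeasurable, (h.indep_dist_cap 0).map_prod_eq_prod_map_map
      (h.measurable_dist 0).aemeasurable (h.measurable_cap 0).aemeasurable, h.law_dist, h.law_dist]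
    congr 1
    refine Measure.ext_of_singleton fun i => ?_
    rw [Measure.map_apply (h.measurable_cap j) (measurableSet_singleton i),
      Measure.map_apply (h.measurable_cap 0) (measurableSet_singleton i)]
    have := (h.law_cap j i).trans (h.law_cap 0 i).symm
    rwa [measureReal_def, measureReal_def, ENNReal.toReal_eq_toReal_iff' (measure_ne_top _ _)
      (measure_ne_top _ _)] at this

theorem identDistrib_gapData (hν : ν (Set.Iio 0) = 0) (j : ℕ) :
    IdentDistrib (gapData r X C j) (gapData r X C 0) P P where
  aemeasurable_fst := (h.measurable_gapData j).aemeasurable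
  aemeasurable_snd := (h.measurable_gapData 0).aemeasurable
  map_eq := by
    refine Measure.ext_of_lintegral _ fun F hF => ?_
    rw [lintegral_map hF (h.measurable_gapData j), lintegral_map hF (h.measurable_gapData 0),
      h.lintegral_gapData hν j hF, h.lintegral_gapData hν 0 hF]
    have hG : Measurable fun y : ℝ × ℕ => ∫⁻ v, F (y.1, v, y.2) ∂gapLaw lam y.1 :=
      measurable_lintegral_gapLaw lam measurable_fst fun v => hF.comp (by fun_prop)
    exact ((h.identDistrib_servers j).comp hG).lintegral_eq

end IsNetwork

end Network

end

section

/-! ### The transition matrix -/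

/-- Conditioning on the capacity `i` rather than on the arrivals: the queue empties when there are
at most `i - m` arrivals. The truncated bound `i + 1 - m` makes the sum empty for `m > i`, which
covers all cases of the matrix entry uniformly. -/
lemma trans_zero_right (c : ℕ) (p k : ℕ → ℝ) (m : ℕ) :
    trans c p k m 0 = ∑ i ∈ Finset.range (c + 1), p i * ∑ v ∈ Finset.range (i + 1 - m), k v := by
  rw [trans, if_pos rfl]
  split_ifs with hm
  · simp_rw [tailCap, Finset.mul_sum]
    rw [Finset.sum_comm' (t' := Finset.range (c + 1)) (s' := fun i => Finset.range (i + 1 - m))]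
    · exact Finset.sum_congr rfl fun i _ => Finset.sum_congr rfl fun v _ => mul_comm _ _
    · intro v i
      simp only [Finset.mem_range, Finset.mem_Icc]
      omega
  · refine (Finset.sum_eq_zero fun i hi => ?_).symm
    rw [Finset.mem_range] at hi
    rw [show i + 1 - m = 0 by omega, Finset.sum_range_zero, mul_zero]

lemma trans_of_ne_zero (c : ℕ) (p k : ℕ → ℝ) (m : ℕ) {l : ℕ} (hl : l ≠ 0) :
    trans c p k m l =
      ∑ i ∈ Finset.range (c + 1), p i * if m ≤ i + l then k (i + l - m) else 0 := by
  rw [trans, if_neg hl]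
  split_ifs with h1 h2
  · refine Finset.sum_congr rfl fun i _ => ?_
    rw [if_pos (by omega), mul_comm]
  · simp_rw [mul_ite, mul_zero]
    rw [← Finset.sum_filter]
    refine Finset.sum_congr ?_ fun i _ => mul_comm _ _
    ext i
    simp only [Finset.mem_Icc, Finset.mem_filter, Finset.mem_range]
    omega
  · refine (Finset.sum_eq_zero fun i hi => ?_).symm
    rw [Finset.mem_range] at hi
    rw [if_neg (by omega), mul_zero]

lemma trans_eq_zero (c : ℕ) (p k : ℕ → ℝ) {m l : ℕ} (h : c + l < m) : trans c p k m l = 0 := by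
  unfold trans
  split_ifs <;> first | omega | rfl

/-! ### The embedded queue -/

lemma measurable_lindley {α : Type*} [MeasurableSpace α] {N C : ℕ → α → ℕ}
    (hN : ∀ j, Measurable (N j)) (hC : ∀ j, Measurable (C j)) (n : ℕ) :
    Measurable fun a => lindley (fun j => N j a) (fun j => C j a) n := by
  induction n with
  | zero => exact measurable_const
  | succ n ih =>
    simp only [lindley]
    exact (measurable_of_countable (fun q : ℕ × ℕ × ℕ => q.1 + q.2.1 - q.2.2)).comp
      (ih.prodMk ((hN n).prodMk (hC n)))

/-- A functional of the first `n` members of an independent sequence is independent of the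
`n`-th member. -/
lemma indepFun_past {Ω E β : Type*} [MeasurableSpace Ω] [MeasurableSpace E] [Inhabited E]
    [MeasurableSpace β] {P : Measure Ω} {Z : ℕ → Ω → E} (hind : iIndepFun Z P)
    (hZ : ∀ j, Measurable (Z j)) {n : ℕ} {f : (ℕ → E) → β} (hf : Measurable f)
    (hdep : ∀ z z' : ℕ → E, (∀ i < n, z i = z' i) → f z = f z') :
    IndepFun (fun ω => f fun i => Z i ω) (Z n) P := by
  classical
  have h1 := hind.indepFun_finset (Finset.range n) {n} (by simp) hZ
  let e : (Finset.range n → E) → ℕ → E := fun z i =>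
    if hi : i ∈ Finset.range n then z ⟨i, hi⟩ else default
  have he : Measurable e := by
    refine measurable_pi_lambda _ fun i => ?_
    by_cases hi : i ∈ Finset.range n
    · simp only [e, hi, dif_pos]
      exact measurable_pi_apply _
    · simp only [e, hi, dif_neg, not_false_eq_true]
      exact measurable_const
  have h2 := h1.comp (hf.comp he)
    (measurable_pi_apply (⟨n, Finset.mem_singleton_self n⟩ : ({n} : Finset ℕ)))
  convert! h2 using 1
  funext ω
  refine hdep _ _ fun i hi => ?_
  simp [e, hi]

lemma measureReal_inter_preimage_eq_mul {Ω α β : Type*} [MeasurableSpace Ω] [MeasurableSpace α]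
    [MeasurableSpace β] {P : Measure Ω} {f : Ω → α} {g : Ω → β} (h : IndepFun f g P) {s : Set α}
    {t : Set β} (hs : MeasurableSet s) (ht : MeasurableSet t) :
    P.real (f ⁻¹' s ∩ g ⁻¹' t) = P.real (f ⁻¹' s) * P.real (g ⁻¹' t) := by
  simp only [measureReal_def, h.measure_inter_preimage_eq_mul s t hs ht, ENNReal.toReal_mul]

/-- Independent and identically distributed arrivals and capacities with the given joint law. -/
structure IsQueue {Ω : Type*} [MeasurableSpace Ω] (P : Measure Ω) (k p : ℕ → ℝ) (c : ℕ)
    (N C : ℕ → Ω → ℕ) : Prop where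
  measurable_arr : ∀ j, Measurable (N j)
  measurable_cap : ∀ j, Measurable (C j)
  indep : iIndepFun (fun j ω => (N j ω, C j ω)) P
  identDistrib : ∀ j, IdentDistrib (fun ω => (N j ω, C j ω)) (fun ω => (N 0 ω, C 0 ω)) P P
  law : ∀ v i, P.real {ω | N 0 ω = v ∧ C 0 ω = i} = k v * p i
  cap_le : ∀ᵐ ω ∂P, ∀ j, C j ω ≤ c

namespace IsQueue

variable {Ω : Type*} [MeasurableSpace Ω] {P : Measure Ω} [IsProbabilityMeasure P] {k p : ℕ → ℝ}
  {c : ℕ} {N C : ℕ → Ω → ℕ}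

/-- Backlog after `n` servers. -/
abbrev backlog (N C : ℕ → Ω → ℕ) (n : ℕ) (ω : Ω) : ℕ :=
  lindley (fun j => N j ω) (fun j => C j ω) n

variable (h : IsQueue P k p c N C)

include h

lemma measurable_backlog (n : ℕ) : Measurable (backlog N C n) :=
  measurable_lindley h.measurable_arr h.measurable_cap n

lemma measurable_pair (j : ℕ) : Measurable fun ω => (N j ω, C j ω) :=
  (h.measurable_arr j).prodMk (h.measurable_cap j)

/-- The whole past is needed for the Markov property. Replacing the values after time `n` by `0`
makes it a function of the first `n` inputs only. -/
lemma indepFun_backlogs (n : ℕ) :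
    IndepFun (fun ω (m : ℕ) => if m ≤ n then backlog N C m ω else 0)
      (fun ω => (N n ω, C n ω)) P := by
  refine indepFun_past (E := ℕ × ℕ) (Z := fun j ω => (N j ω, C j ω)) h.indep h.measurable_pair
    (f := fun z m => if m ≤ n then lindley (fun j => (z j).1) (fun j => (z j).2) m else 0) ?_ ?_
  · refine measurable_pi_lambda _ fun m => ?_
    by_cases hm : m ≤ n
    · simp only [hm, if_true]
      exact measurable_lindley (fun j => by fun_prop) (fun j => by fun_prop) m
    · simp only [hm, if_false]
      exact measurable_const
  · intro z z' hz
    funext m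
    split_ifs with hm
    · clear h
      induction m with
      | zero => rfl
      | succ m ih =>
        rw [lindley, lindley, ih (by omega), hz m (by omega)]
    · rfl

lemma indepFun_backlog (n : ℕ) :
    IndepFun (backlog N C n) (fun ω => (N n ω, C n ω)) P := by
  have hn : Measurable (fun z : ℕ → ℕ => z n) := measurable_pi_apply n
  have := (h.indepFun_backlogs n).comp hn measurable_id
  simpa [Function.comp_def] using this

lemma measureReal_step (n m l : ℕ) :
    P.real {ω | m + N n ω - C n ω = l} = trans c p k m l := by
  have hid : P.real {ω | m + N n ω - C n ω = l} = P.real {ω | m + N 0 ω - C 0 ω = l} := by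
    have := (h.identDistrib n).measure_mem_eq (s := {q : ℕ × ℕ | m + q.1 - q.2 = l})
      (Set.to_countable _).measurableSet
    exact congrArg ENNReal.toReal this
  rw [hid]
  have h1 : P.real {ω | m + N 0 ω - C 0 ω = l} =
      ∑ i ∈ Finset.range (c + 1), P.real {ω | m + N 0 ω - i = l ∧ C 0 ω = i} := by
    have hae : {ω | m + N 0 ω - C 0 ω = l} =ᵐ[P]
        ⋃ i ∈ Finset.range (c + 1), {ω | m + N 0 ω - i = l ∧ C 0 ω = i} := by
      filter_upwards [h.cap_le] with ω hω
      refine propext ?_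
      change (m + N 0 ω - C 0 ω = l) ↔
        ω ∈ ⋃ i ∈ Finset.range (c + 1), {ω | m + N 0 ω - i = l ∧ C 0 ω = i}
      simp only [Set.mem_iUnion, Finset.mem_range, Set.mem_ofPred_eq, exists_prop]
      constructor
      · intro h2
        exact ⟨C 0 ω, by have := hω 0; omega, h2, rfl⟩
      · rintro ⟨i, -, h2, h3⟩
        rw [h3, h2]
    rw [measureReal_congr hae, measureReal_biUnion_finset]
    · intro i _ j _ hij
      refine Set.disjoint_left.2 fun ω h2 h3 => hij ?_
      exact h2.2.symm.trans h3.2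
    · intro i _
      exact h.measurable_pair 0 ((Set.to_countable {q : ℕ × ℕ | m + q.1 - i = l ∧ q.2 = i}).measurableSet)
  rw [h1]
  rcases eq_or_ne l 0 with rfl | hl
  · rw [trans_zero_right]
    refine Finset.sum_congr rfl fun i _ => ?_
    rw [mul_comm, Finset.sum_mul]
    simp_rw [← h.law]
    rw [← measureReal_biUnion_finset]
    · congr 1
      ext ω
      simp only [Set.mem_iUnion, Finset.mem_range, Set.mem_ofPred_eq, exists_prop]
      constructor
      · rintro ⟨h2, h3⟩
        exact ⟨N 0 ω, by omega, rfl, h3⟩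
      · rintro ⟨v, h2, h3, h4⟩
        exact ⟨by omega, h4⟩
    · intro v _ w _ hvw
      refine Set.disjoint_left.2 fun ω h2 h3 => hvw ?_
      exact h2.1.symm.trans h3.1
    · intro v _
      exact h.measurable_pair 0 ((Set.to_countable {q : ℕ × ℕ | q.1 = v ∧ q.2 = i}).measurableSet)
  · rw [trans_of_ne_zero _ _ _ _ hl]
    refine Finset.sum_congr rfl fun i _ => ?_
    split_ifs with h2
    · rw [mul_comm, ← h.law]
      congr 1
      ext ω
      simp only [Set.mem_ofPred_eq]
      omega
    · rw [mul_zero]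
      have : {ω | m + N 0 ω - i = l ∧ C 0 ω = i} = ∅ := by
        ext ω
        simp only [Set.mem_ofPred_eq, Set.mem_empty_iff_false, iff_false]
        omega
      rw [this, measureReal_empty]

lemma measureReal_path_succ (n : ℕ) (a : ℕ → ℕ) :
    P.real {ω | ∀ m ≤ n + 1, backlog N C m ω = a m} =
      P.real {ω | ∀ m ≤ n, backlog N C m ω = a m} * trans c p k (a n) (a (n + 1)) := by
  rw [← h.measureReal_step n (a n) (a (n + 1))]
  have hA : MeasurableSet {z : ℕ → ℕ | ∀ m ≤ n, z m = a m} := by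
    have : {z : ℕ → ℕ | ∀ m ≤ n, z m = a m} = ⋂ m ∈ Set.Iic n, {z : ℕ → ℕ | z m = a m} := by
      ext z
      simp
    rw [this]
    exact MeasurableSet.biInter (Set.to_countable _) fun m _ =>
      measurableSet_eq_fun (measurable_pi_apply m) measurable_const
  have h1 := measureReal_inter_preimage_eq_mul (h.indepFun_backlogs n) hA
    (Set.to_countable {q : ℕ × ℕ | a n + q.1 - q.2 = a (n + 1)}).measurableSet
  · have e1 : {ω | ∀ m ≤ n, backlog N C m ω = a m} =
        (fun ω (m : ℕ) => if m ≤ n then backlog N C m ω else 0) ⁻¹' {z | ∀ m ≤ n, z m = a m} := by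
      ext ω
      refine forall₂_congr fun m hm => ?_
      simp [hm]
    have e2 : {ω | ∀ m ≤ n + 1, backlog N C m ω = a m} =
        {ω | ∀ m ≤ n, backlog N C m ω = a m} ∩ (fun ω => (N n ω, C n ω)) ⁻¹'
          {q | a n + q.1 - q.2 = a (n + 1)} := by
      ext ω
      simp only [Set.mem_ofPred_eq, Set.mem_inter_iff, Set.mem_preimage]
      constructor
      · intro h2
        refine ⟨fun m hm => h2 m (by omega), ?_⟩
        have h3 := h2 (n + 1) le_rfl
        rwa [backlog, lindley, ← backlog, h2 n (by omega)] at h3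
      · rintro ⟨h2, h3⟩ m hm
        rcases hm.lt_or_eq with h4 | rfl
        · exact h2 m (by omega)
        · rw [backlog, lindley, ← backlog, h2 n le_rfl, h3]
    rw [e2, e1, h1]
    rfl

/-- The backlog drops by at most `c` in a step, so only states up to `c + l` lead to `l`. Finiteness
of this sum is what lets limits pass through the balance equations. -/
lemma measureReal_backlog_succ (n l : ℕ) :
    P.real {ω | backlog N C (n + 1) ω = l} =
      ∑ m ∈ Finset.range (c + l + 1), P.real {ω | backlog N C n ω = m} * trans c p k m l := by
  have hae : {ω | backlog N C (n + 1) ω = l} =ᵐ[P]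
      ⋃ m ∈ Finset.range (c + l + 1), (backlog N C n ⁻¹' {m}) ∩
        (fun ω => (N n ω, C n ω)) ⁻¹' {q | m + q.1 - q.2 = l} := by
    filter_upwards [h.cap_le] with ω hω
    refine propext ?_
    change (backlog N C (n + 1) ω = l) ↔
      ω ∈ ⋃ m ∈ Finset.range (c + l + 1), (backlog N C n ⁻¹' {m}) ∩
        (fun ω => (N n ω, C n ω)) ⁻¹' {q | m + q.1 - q.2 = l}
    simp only [Set.mem_iUnion, Finset.mem_range, Set.mem_ofPred_eq, exists_prop,
      Set.mem_inter_iff, Set.mem_preimage, Set.mem_singleton_iff]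
    have hs : backlog N C (n + 1) ω = backlog N C n ω + N n ω - C n ω := rfl
    rw [hs]
    constructor
    · intro h2
      exact ⟨_, by have := hω n; omega, rfl, h2⟩
    · rintro ⟨m, -, h2, h3⟩
      rw [h2, h3]
  have hmeas : ∀ m, MeasurableSet ({q : ℕ × ℕ | m + q.1 - q.2 = l}) :=
    fun m => (Set.to_countable _).measurableSet
  rw [measureReal_congr hae, measureReal_biUnion_finset]
  · refine Finset.sum_congr rfl fun m _ => ?_
    rw [measureReal_inter_preimage_eq_mul (h.indepFun_backlog n) (measurableSet_singleton m)
      (hmeas m), ← h.measureReal_step n m l]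
    rfl
  · intro m _ m' _ hmm
    refine Set.disjoint_left.2 fun ω h2 h3 => hmm ?_
    exact h2.1.symm.trans h3.1
  · intro m _
    exact (h.measurable_backlog n (measurableSet_singleton m)).inter
      (h.measurable_pair n (hmeas m))

/-! ### Stochastic monotonicity -/

/-- The input at time `n` is independent of the backlog and distributed like the input at time `0`.
Using this same copy for every `n` lets two consecutive backlogs be compared under a common input.
-/
lemma lintegral_backlog_succ (n : ℕ) (f : ℕ → ℝ≥0∞) :
    ∫⁻ ω, f (backlog N C (n + 1) ω) ∂P =
      ∫⁻ ω', ∫⁻ ω, f (backlog N C n ω + N 0 ω' - C 0 ω') ∂P ∂P := by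
  have hm := h.measurable_backlog n
  have hΦ : Measurable fun q : ℕ × ℕ × ℕ => f (q.1 + q.2.1 - q.2.2) := measurable_of_countable _
  have := Measure.isProbabilityMeasure_map (μ := P) hm.aemeasurable
  have := Measure.isProbabilityMeasure_map (μ := P) (h.measurable_pair 0).aemeasurable
  have e1 : ∫⁻ ω, f (backlog N C (n + 1) ω) ∂P =
      ∫⁻ q, f (q.1 + q.2.1 - q.2.2) ∂(P.map fun ω => (backlog N C n ω, (N n ω, C n ω))) := by
    rw [lintegral_map hΦ (hm.prodMk (h.measurable_pair n))]
    rfl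
  rw [e1, (h.indepFun_backlog n).map_prod_eq_prod_map_map hm.aemeasurable
    (h.measurable_pair n).aemeasurable, (h.identDistrib n).map_eq,
    lintegral_prod_symm _ hΦ.aemeasurable,
    lintegral_map (hΦ.lintegral_prod_left') (h.measurable_pair 0)]
  refine lintegral_congr fun ω' => ?_
  exact lintegral_map (f := fun x => f (x + N 0 ω' - C 0 ω')) (measurable_of_countable _) hm

/-- The chain starts at its minimal state and the recursion is monotone in the state, so the
comparison of times `0` and `1` propagates by induction over all monotone test functions. -/
lemma lintegral_backlog_le_succ (n : ℕ) : ∀ {f : ℕ → ℝ≥0∞}, Monotone f →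
    ∫⁻ ω, f (backlog N C n ω) ∂P ≤ ∫⁻ ω, f (backlog N C (n + 1) ω) ∂P := by
  induction n with
  | zero =>
    intro f hf
    exact lintegral_mono fun ω => hf (Nat.zero_le _)
  | succ n ih =>
    intro f hf
    rw [h.lintegral_backlog_succ n, h.lintegral_backlog_succ (n + 1)]
    refine lintegral_mono fun ω' => ih (f := fun x => f (x + N 0 ω' - C 0 ω')) ?_
    exact fun a b hab => hf (by omega)

lemma monotone_lintegral_backlog {f : ℕ → ℝ≥0∞} (hf : Monotone f) :
    Monotone fun n => ∫⁻ ω, f (backlog N C n ω) ∂P :=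
  monotone_nat_of_le_succ fun n => h.lintegral_backlog_le_succ n hf

lemma monotone_tail (a : ℕ) : Monotone fun n => P {ω | a ≤ backlog N C n ω} := by
  have h1 := h.monotone_lintegral_backlog (f := (Set.Ici a).indicator 1)
    (fun x y hxy => Set.indicator_apply_le' (fun hx => by
      rw [Set.indicator_of_mem (show y ∈ Set.Ici a from le_trans hx hxy)]; exact le_rfl)
      fun _ => zero_le)
  convert! h1 using 2 with n
  exact (lintegral_indicator_one
    (h.measurable_backlog n (Set.to_countable (Set.Ici a)).measurableSet)).symm

/-! ### Bounded mean backlog -/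

section Mean

variable (hN : MemLp (fun ω => (N 0 ω : ℝ)) 2 P) (hC : MemLp (fun ω => (C 0 ω : ℝ)) 2 P)

include hN hC

lemma memLp_arr (n : ℕ) : MemLp (fun ω => (N n ω : ℝ)) 2 P := by
  have h1 := (h.identDistrib n).comp (u := fun q : ℕ × ℕ => (q.1 : ℝ)) (by fun_prop)
  exact h1.symm.memLp_snd hN

lemma memLp_cap (n : ℕ) : MemLp (fun ω => (C n ω : ℝ)) 2 P := by
  have h1 := (h.identDistrib n).comp (u := fun q : ℕ × ℕ => (q.2 : ℝ)) (by fun_prop)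
  exact h1.symm.memLp_snd hC

lemma memLp_backlog (n : ℕ) : MemLp (fun ω => (backlog N C n ω : ℝ)) 2 P := by
  induction n with
  | zero => simp [backlog, lindley]
  | succ n ih =>
    refine (ih.add (h.memLp_arr hN hC n)).mono'
      ((measurable_of_countable fun x : ℕ => (x : ℝ)).comp
        (h.measurable_backlog (n + 1))).aestronglyMeasurable (ae_of_all _ fun ω => ?_)
    have : backlog N C (n + 1) ω ≤ backlog N C n ω + N n ω := Nat.sub_le _ _
    rw [Real.norm_of_nonneg (Nat.cast_nonneg _)]
    change ((backlog N C (n + 1) ω : ℕ) : ℝ) ≤ (backlog N C n ω : ℝ) + (N n ω : ℝ)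
    exact_mod_cast this

/-- Quadratic Lyapunov function: the positive part only decreases the square, and the cross term
factorizes because the increment is independent of the current backlog. -/
lemma integral_backlog_sq_succ_le (n : ℕ) :
    ∫ ω, (backlog N C (n + 1) ω : ℝ) ^ 2 ∂P ≤ ∫ ω, (backlog N C n ω : ℝ) ^ 2 ∂P +
      2 * (∫ ω, ((N 0 ω : ℝ) - C 0 ω) ∂P) * ∫ ω, (backlog N C n ω : ℝ) ∂P +
      ∫ ω, ((N 0 ω : ℝ) - C 0 ω) ^ 2 ∂P := by
  have hL := h.memLp_backlog hN hC n
  have hξ : MemLp (fun ω => (N n ω : ℝ) - C n ω) 2 P :=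
    (h.memLp_arr hN hC n).sub (h.memLp_cap hN hC n)
  have hid := (h.identDistrib n).comp (u := fun q : ℕ × ℕ => (q.1 : ℝ) - q.2) (by fun_prop)
  have e1 : ∫ ω, ((N n ω : ℝ) - C n ω) ∂P = ∫ ω, ((N 0 ω : ℝ) - C 0 ω) ∂P := hid.integral_eq
  have e2 : ∫ ω, ((N n ω : ℝ) - C n ω) ^ 2 ∂P = ∫ ω, ((N 0 ω : ℝ) - C 0 ω) ^ 2 ∂P :=
    (hid.comp (u := fun x : ℝ => x ^ 2) (by fun_prop)).integral_eq
  have hind := (h.indepFun_backlog n).comp (φ := fun x : ℕ => (x : ℝ))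
    (ψ := fun q : ℕ × ℕ => (q.1 : ℝ) - q.2) (by fun_prop) (by fun_prop)
  have e3 : ∫ ω, (backlog N C n ω : ℝ) * ((N n ω : ℝ) - C n ω) ∂P =
      (∫ ω, (backlog N C n ω : ℝ) ∂P) * ∫ ω, ((N n ω : ℝ) - C n ω) ∂P :=
    hind.integral_fun_mul_eq_mul_integral hL.aestronglyMeasurable hξ.aestronglyMeasurable
  have i1 : Integrable (fun ω => (backlog N C n ω : ℝ) * ((N n ω : ℝ) - C n ω)) P :=
    hL.integrable_mul hξ
  calc ∫ ω, (backlog N C (n + 1) ω : ℝ) ^ 2 ∂P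
      ≤ ∫ ω, ((backlog N C n ω : ℝ) ^ 2 + 2 * ((backlog N C n ω : ℝ) * ((N n ω : ℝ) - C n ω)) +
          ((N n ω : ℝ) - C n ω) ^ 2) ∂P := by
        refine integral_mono (h.memLp_backlog hN hC (n + 1)).integrable_sq
          ((hL.integrable_sq.add (i1.const_mul 2)).add hξ.integrable_sq) fun ω => ?_
        have hs : backlog N C (n + 1) ω = backlog N C n ω + N n ω - C n ω := rfl
        show (backlog N C (n + 1) ω : ℝ) ^ 2 ≤ _
        rcases le_total (C n ω) (backlog N C n ω + N n ω) with h1 | h1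
        · rw [hs, Nat.cast_sub h1]
          push_cast
          apply le_of_eq
          ring
        · rw [hs, Nat.sub_eq_zero_of_le h1]
          have := sq_nonneg ((backlog N C n ω : ℝ) + ((N n ω : ℝ) - C n ω))
          push_cast
          linarith
    _ = _ := by
        have e4 := integral_add (hL.integrable_sq.add (i1.const_mul 2)) hξ.integrable_sq
        simp only [Pi.add_apply] at e4
        rw [e4, integral_add hL.integrable_sq (i1.const_mul 2), integral_const_mul, e3, e1, e2]
        ring

lemma lintegral_backlog_eq (n : ℕ) :
    ∫⁻ ω, (backlog N C n ω : ℝ≥0∞) ∂P = ENNReal.ofReal (∫ ω, (backlog N C n ω : ℝ) ∂P) := by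
  rw [ofReal_integral_eq_lintegral_ofReal ((h.memLp_backlog hN hC n).integrable one_le_two)
    (ae_of_all _ fun ω => Nat.cast_nonneg _)]
  simp

/-- Summing the drift inequality bounds the averages of the mean backlogs. Since the means increase
in `n`, a bound on averages is a bound on each of them. -/
lemma exists_mean_bound (hdrift : ∫ ω, ((N 0 ω : ℝ) - C 0 ω) ∂P < 0) :
    ∃ B : ℝ≥0, ∀ n, ∫⁻ ω, (backlog N C n ω : ℝ≥0∞) ∂P ≤ B := by
  set δ := -∫ ω, ((N 0 ω : ℝ) - C 0 ω) ∂P with hδ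
  set σ := ∫ ω, ((N 0 ω : ℝ) - C 0 ω) ^ 2 ∂P with hσ
  have hδ0 : 0 < δ := by rw [hδ]; linarith
  set m := fun n => ∫ ω, (backlog N C n ω : ℝ) ∂P with hm
  have hm0 : ∀ n, 0 ≤ m n := fun n => integral_nonneg fun ω => Nat.cast_nonneg _
  have hsum : ∀ M : ℕ, ∑ j ∈ Finset.range M, 2 * δ * m j +
      ∫ ω, (backlog N C M ω : ℝ) ^ 2 ∂P ≤ M * σ := by
    intro M
    induction M with
    | zero => simp [backlog, lindley]
    | succ M ih =>
      have h1 := h.integral_backlog_sq_succ_le hN hC M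
      rw [Finset.sum_range_succ]
      push_cast
      have h2 : 2 * (∫ ω, ((N 0 ω : ℝ) - C 0 ω) ∂P) * ∫ ω, (backlog N C M ω : ℝ) ∂P =
        -(2 * δ * m M) := by rw [hδ, hm]; ring
      rw [h2] at h1
      linarith
  have hmono : Monotone m := by
    intro a b hab
    have h1 := h.monotone_lintegral_backlog (f := fun x => (x : ℝ≥0∞))
      (fun x y hxy => Nat.cast_le.2 hxy) hab
    simp only [h.lintegral_backlog_eq hN hC] at h1
    exact (ENNReal.ofReal_le_ofReal_iff (hm0 b)).1 h1
  refine ⟨(σ / δ).toNNReal, fun n => ?_⟩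
  rw [h.lintegral_backlog_eq hN hC]
  refine ENNReal.ofReal_le_ofReal ?_
  change m n ≤ σ / δ
  rcases Nat.eq_zero_or_pos n with rfl | hn
  · have hσ0 : 0 ≤ σ := integral_nonneg fun ω => sq_nonneg _
    have : m 0 = 0 := by simp [hm, backlog, lindley]
    rw [this]
    positivity
  -- Over `2 n` steps, the last `n` terms are each at least the `n`-th mean; this gives the bound `σ
  -- / δ`.
  · have h1 := hsum (n + n)
    have h2 : (n : ℝ) * (2 * δ * m n) ≤ ∑ j ∈ Finset.range (n + n), 2 * δ * m j := by
      rw [Finset.sum_range_add]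
      have h3 : 0 ≤ ∑ j ∈ Finset.range n, 2 * δ * m j :=
        Finset.sum_nonneg fun j _ => mul_nonneg (by positivity) (hm0 j)
      have h4 : ∑ _j ∈ Finset.range n, 2 * δ * m n ≤ ∑ j ∈ Finset.range n, 2 * δ * m (n + j) :=
        Finset.sum_le_sum fun j _ =>
          mul_le_mul_of_nonneg_left (hmono (Nat.le_add_right n j)) (by positivity)
      rw [Finset.sum_const, Finset.card_range, nsmul_eq_mul] at h4
      linarith
    have h5 : 0 ≤ ∫ ω, (backlog N C (n + n) ω : ℝ) ^ 2 ∂P := integral_nonneg fun ω => sq_nonneg _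
    push_cast at h1
    have hn' : (0 : ℝ) < n := by exact_mod_cast hn
    rw [le_div_iff₀ hδ0]
    have h6 : (n : ℝ) * (2 * δ * m n) ≤ (n : ℝ) * (2 * σ) := by linarith
    have := le_of_mul_le_mul_left h6 hn'
    linarith

end Mean

end IsQueue

end

section

/-! ### The limit law of the backlog -/

lemma monotone_eq_sum {f : ℕ → ℝ≥0∞} (hf : Monotone f) (n : ℕ) :
    f n = f 0 + ∑ a ∈ Finset.range n, (f (a + 1) - f a) := by
  induction n with
  | zero => simp
  | succ n ih =>
    rw [Finset.sum_range_succ, ← add_assoc, ← ih, add_tsub_cancel_of_le (hf (Nat.le_succ n))]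

/-- Layer-cake formula: the integral of a monotone function is a combination of tail probabilities
with nonnegative coefficients, so an inequality between tails transfers to it. -/
lemma lintegral_monotone_nat {α : Type*} [MeasurableSpace α] (m : Measure α) {g : α → ℕ}
    (hg : Measurable g) {f : ℕ → ℝ≥0∞} (hf : Monotone f) :
    ∫⁻ x, f (g x) ∂m = f 0 * m Set.univ + ∑' a, (f (a + 1) - f a) * m {x | a + 1 ≤ g x} := by
  have h1 : ∀ n, f n = f 0 + ∑' a, (f (a + 1) - f a) * (if a + 1 ≤ n then 1 else 0) := by
    intro n
    rw [tsum_eq_sum (s := Finset.range n), monotone_eq_sum hf n]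
    · congr 1
      refine Finset.sum_congr rfl fun a ha => ?_
      rw [if_pos (Nat.succ_le_of_lt (Finset.mem_range.1 ha)), mul_one]
    · intro a ha
      rw [if_neg (by simpa using ha), mul_zero]
  have hset : ∀ a, MeasurableSet {x | a + 1 ≤ g x} := fun a => measurableSet_le measurable_const hg
  simp_rw [fun x => h1 (g x)]
  rw [lintegral_add_left measurable_const, lintegral_const, lintegral_tsum]
  · congr 1
    refine tsum_congr fun a => ?_
    rw [lintegral_const_mul _ (Measurable.ite (hset a) measurable_const measurable_const)]
    congr 1
    rw [← lintegral_indicator_one (hset a)]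
    refine lintegral_congr fun x => ?_
    simp [Set.indicator_apply]
  · intro a
    exact ((Measurable.ite (hset a) measurable_const measurable_const).const_mul _).aemeasurable

namespace IsQueue

variable {Ω : Type*} [MeasurableSpace Ω] {P : Measure Ω} [IsProbabilityMeasure P] {k p : ℕ → ℝ}
  {c : ℕ} {N C : ℕ → Ω → ℕ}

/-- Limit law of the backlog: the limit exists, dominates the backlog stochastically and has
finite mean. -/
structure IsLimitLaw (P : Measure Ω) (N C : ℕ → Ω → ℕ) (π : ℕ → ℝ) : Prop where
  nonneg : ∀ l, 0 ≤ π l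
  hasSum_one : HasSum π 1
  tendsto : ∀ l, Tendsto (fun n => P.real {ω | backlog N C n ω = l}) atTop (𝓝 (π l))
  lintegral_le : ∀ f : ℕ → ℝ≥0∞, Monotone f → ∀ n,
    ∫⁻ ω, f (backlog N C n ω) ∂P ≤ ∑' l, ENNReal.ofReal (π l) * f l
  mean_lt_top : ∑' l, ENNReal.ofReal (π l) * (l : ℝ≥0∞) < ⊤

/-- The tails increase with `n` and hence converge. The bound on the means makes the limiting tails
summable, so they vanish at infinity and no mass is lost; their differences are the limit law. -/
theorem exists_isLimitLaw (h : IsQueue P k p c N C) {B : ℝ≥0}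
    (hB : ∀ n, ∫⁻ ω, (backlog N C n ω : ℝ≥0∞) ∂P ≤ B) : ∃ π, IsLimitLaw P N C π := by
  set T : ℕ → ℝ≥0∞ := fun a => ⨆ n, P {ω | a ≤ backlog N C n ω} with hT
  have hset : ∀ n a, MeasurableSet {ω | a ≤ backlog N C n ω} :=
    fun n a => measurableSet_le measurable_const (h.measurable_backlog n)
  have hlim : ∀ a, Tendsto (fun n => P {ω | a ≤ backlog N C n ω}) atTop (𝓝 (T a)) :=
    fun a => tendsto_atTop_iSup (h.monotone_tail a)
  have hT1 : ∀ a, T a ≤ 1 := fun a => iSup_le fun n => prob_le_one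
  have hT0 : T 0 = 1 := by simp [hT]
  have hTne : ∀ a, T a ≠ ⊤ := fun a => ((hT1 a).trans_lt ENNReal.one_lt_top).ne
  have hanti : Antitone T := fun a b hab => iSup_mono fun n =>
    measure_mono fun ω hω => le_trans hab hω
  have hcast : Monotone fun x : ℕ => (x : ℝ≥0∞) := fun x y hxy => Nat.cast_le.2 hxy
  have hsumB : ∑' a, T (a + 1) ≤ B := by
    refine ENNReal.tsum_le_of_sum_range_le fun A => ?_
    refine le_of_tendsto (tendsto_finsetSum _ fun a _ => hlim (a + 1))
      (Eventually.of_forall fun n => le_trans ?_ (hB n))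
    rw [lintegral_monotone_nat P (h.measurable_backlog n) hcast]
    refine le_trans ?_ le_add_self
    refine le_trans (ENNReal.sum_le_tsum (Finset.range A)) (ENNReal.tsum_le_tsum fun a => ?_)
    push_cast
    rw [ENNReal.add_sub_cancel_left (ENNReal.natCast_ne_top a), one_mul]
  have hTzero : Tendsto T atTop (𝓝 0) := by
    have := ENNReal.tendsto_atTop_zero_of_tsum_ne_top (hsumB.trans_lt ENNReal.coe_lt_top).ne
    exact (tendsto_add_atTop_iff_nat 1).1 this
  set U : ℕ → ℝ := fun a => (T a).toReal with hU
  have hUzero : Tendsto U atTop (𝓝 0) := by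
    have := (ENNReal.tendsto_toReal ENNReal.zero_ne_top).comp hTzero
    rwa [ENNReal.toReal_zero] at this
  have hUanti : ∀ a, U (a + 1) ≤ U a := fun a =>
    ENNReal.toReal_mono (hTne a) (hanti (Nat.le_succ a))
  have htail : ∀ a, HasSum (fun l => U (l + a) - U (l + a + 1)) (U a) := by
    intro a
    rw [hasSum_iff_tendsto_nat_of_nonneg (fun l => sub_nonneg.2 (hUanti _))]
    have h1 : ∀ n, ∑ l ∈ Finset.range n, (U (l + a) - U (l + a + 1)) = U a - U (n + a) := by
      intro n
      have := Finset.sum_range_sub' (fun l => U (l + a)) n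
      simp only [zero_add] at this
      rw [← this]
      refine Finset.sum_congr rfl fun l _ => ?_
      rw [show l + 1 + a = l + a + 1 by ring]
    simp_rw [h1]
    simpa using ((tendsto_add_atTop_iff_nat a).2 hUzero).const_sub (U a)
  set π : ℕ → ℝ := fun l => U l - U (l + 1) with hπ
  have hπ0 : ∀ l, 0 ≤ π l := fun l => sub_nonneg.2 (hUanti l)
  -- Realizing the limit law as a measure allows the layer-cake formula to be applied to it as well.
  set M : Measure ℕ := Measure.sum fun l => ENNReal.ofReal (π l) • Measure.dirac l with hM
  have hMint : ∀ f : ℕ → ℝ≥0∞, ∫⁻ x, f x ∂M = ∑' l, ENNReal.ofReal (π l) * f l := by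
    intro f
    rw [hM, lintegral_sum_measure]
    refine tsum_congr fun l => ?_
    rw [lintegral_smul_measure, lintegral_dirac, smul_eq_mul]
  have hMtail : ∀ a, M {x | a ≤ x} = T a := by
    intro a
    have h1 : M {x | a ≤ x} = ∑' l, ENNReal.ofReal (π l) * ({x | a ≤ x} : Set ℕ).indicator 1 l := by
      rw [← lintegral_indicator_one (Set.to_countable _).measurableSet, hMint]
    have h2 := ENNReal.summable.sum_add_tsum_nat_add'
      (f := fun l => ENNReal.ofReal (π l) * ({x | a ≤ x} : Set ℕ).indicator 1 l) (k := a)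
    rw [h1, ← h2, Finset.sum_eq_zero, zero_add]
    · have h3 : ∀ l, ENNReal.ofReal (π (l + a)) * ({x | a ≤ x} : Set ℕ).indicator 1 (l + a) =
          ENNReal.ofReal (π (l + a)) := by
        intro l
        rw [Set.indicator_of_mem (show l + a ∈ {x | a ≤ x} from Nat.le_add_left _ _)]
        simp
      simp_rw [h3]
      rw [← ENNReal.ofReal_tsum_of_nonneg (fun l => hπ0 _) (htail a).summable, (htail a).tsum_eq,
        hU, ENNReal.ofReal_toReal (hTne a)]
    · intro l hl
      rw [Set.indicator_of_notMem, mul_zero]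
      simpa using hl
  have hdom : ∀ f : ℕ → ℝ≥0∞, Monotone f → ∑' l, ENNReal.ofReal (π l) * f l =
      f 0 + ∑' a, (f (a + 1) - f a) * T (a + 1) := by
    intro f hf
    rw [← hMint, lintegral_monotone_nat M (g := fun x => x) measurable_id hf]
    simp_rw [hMtail]
    have : M Set.univ = 1 := by
      rw [← hT0, ← hMtail 0]
      congr 1
      ext
      simp
    rw [this, mul_one]
  refine ⟨π, hπ0, ?_, ?_, ?_, ?_⟩
  · have := htail 0
    simp only [add_zero, hU, hT0, ENNReal.toReal_one] at this
    exact this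
  · intro l
    have h1 : ∀ n, P.real {ω | backlog N C n ω = l} =
        (P {ω | l ≤ backlog N C n ω}).toReal - (P {ω | l + 1 ≤ backlog N C n ω}).toReal := by
      intro n
      have : {ω | backlog N C n ω = l} =
          {ω | l ≤ backlog N C n ω} \ {ω | l + 1 ≤ backlog N C n ω} := by
        ext ω
        simp only [Set.mem_ofPred_eq, Set.mem_sdiff]
        omega
      rw [this]
      refine measureReal_sdiff (fun ω hω => ?_) (hset n (l + 1))
      have : l + 1 ≤ backlog N C n ω := hω
      show l ≤ backlog N C n ω
      omega
    simp_rw [h1]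
    exact ((ENNReal.tendsto_toReal (hTne l)).comp (hlim l)).sub
      ((ENNReal.tendsto_toReal (hTne (l + 1))).comp (hlim (l + 1)))
  · intro f hf n
    rw [hdom f hf, lintegral_monotone_nat P (h.measurable_backlog n) hf, measure_univ, mul_one]
    gcongr with a
    exact le_iSup (fun n => P {ω | a + 1 ≤ backlog N C n ω}) n
  · rw [hdom _ hcast]
    refine lt_of_le_of_lt ?_ (hsumB.trans_lt ENNReal.coe_lt_top)
    simp only [Nat.cast_zero, zero_add]
    refine ENNReal.tsum_le_tsum fun a => ?_
    push_cast
    rw [ENNReal.add_sub_cancel_left (ENNReal.natCast_ne_top a), one_mul]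

lemma IsLimitLaw.isStationary {π : ℕ → ℝ} (hπ : IsLimitLaw P N C π) (h : IsQueue P k p c N C) :
    IsStationary (trans c p k) π where
  nonneg := hπ.nonneg
  hasSum_one := hπ.hasSum_one
  invariant := by
    intro l
    have h1 : Tendsto (fun n => P.real {ω | backlog N C (n + 1) ω = l}) atTop
        (𝓝 (∑ m ∈ Finset.range (c + l + 1), π m * trans c p k m l)) := by
      simp_rw [h.measureReal_backlog_succ]
      exact tendsto_finsetSum _ fun m _ => (hπ.tendsto m).mul_const _
    have h2 := tendsto_nhds_unique h1 ((tendsto_add_atTop_iff_nat 1).2 (hπ.tendsto l))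
    rw [← h2]
    refine hasSum_sum_of_ne_finset_zero fun m hm => ?_
    rw [trans_eq_zero c p k (by simp at hm; omega), mul_zero]

lemma IsLimitLaw.summable_mean {π : ℕ → ℝ} (hπ : IsLimitLaw P N C π) :
    Summable fun j : ℕ => (j : ℝ) * π j := by
  have h1 := ENNReal.summable_toReal hπ.mean_lt_top.ne
  refine h1.congr fun l => ?_
  rw [ENNReal.toReal_mul, ENNReal.toReal_ofReal (hπ.nonneg l), ENNReal.toReal_natCast, mul_comm]

end IsQueue

end

section

/-! ### The functional equation of the generating function -/

/-- Cauchy product of the unknowns and the arrival probabilities. -/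
def conv (k : ℕ → ℝ) (x : ℕ → ℂ) (n : ℕ) : ℂ := ∑ j ∈ Finset.range (n + 1), x j * (k (n - j) : ℂ)

lemma emptyTerm_eq (c : ℕ) (p k : ℕ → ℝ) (x : ℕ → ℂ) :
    emptyTerm c p k x =
      ∑ i ∈ Finset.range (c + 1), (p i : ℂ) * ∑ n ∈ Finset.range i, conv k x n := by
  unfold emptyTerm conv tailCap
  push_cast
  simp_rw [Finset.mul_sum, Finset.sum_sigma']
  refine Finset.sum_nbij' (fun a => ⟨a.2.2, a.2.1, a.1⟩) (fun a => ⟨a.2.2, a.2.1, a.1⟩)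
    ?_ ?_ ?_ ?_ ?_
  · rintro ⟨m, n, i⟩ h
    simp only [Finset.mem_sigma, Finset.mem_range, Finset.mem_Ico, Finset.mem_Icc] at h ⊢
    omega
  · rintro ⟨i, n, m⟩ h
    simp only [Finset.mem_sigma, Finset.mem_range, Finset.mem_Ico, Finset.mem_Icc] at h ⊢
    omega
  · rintro ⟨m, n, i⟩ _
    rfl
  · rintro ⟨m, n, i⟩ _
    rfl
  · rintro ⟨m, n, i⟩ _
    ring

/-- Regrouping by the capacity `i` and by the number `n` present just before service. For `n < i`
the true next state is `0` instead of `n - i`; after multiplication by `z ^ c` this correction is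
exactly `z ^ c - z ^ (c - i + n)`. -/
lemma num_eq (c : ℕ) (p k : ℕ → ℝ) (x : ℕ → ℂ) (z : ℂ) :
    num c p k x z = ∑ i ∈ Finset.range (c + 1), (p i : ℂ) *
      ∑ n ∈ Finset.range i, conv k x n * (z ^ c - z ^ (c - i + n)) := by
  have h2 : ∑ j ∈ Finset.range c, x j * ∑ m ∈ Finset.Icc 1 (c - j),
      z ^ (c - m) * ∑ i ∈ Finset.Icc (m + j) c, ((k (i - (m + j)) * p i : ℝ) : ℂ) =
      ∑ i ∈ Finset.range (c + 1), (p i : ℂ) *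
        ∑ n ∈ Finset.range i, conv k x n * z ^ (c - i + n) := by
    unfold conv
    push_cast
    simp_rw [Finset.sum_mul, Finset.mul_sum, Finset.sum_sigma']
    refine Finset.sum_nbij' (fun a => ⟨a.2.2, a.2.2 - a.2.1, a.1⟩)
      (fun a => ⟨a.2.2, a.1 - a.2.1, a.1⟩) ?_ ?_ ?_ ?_ ?_
    · rintro ⟨j, m, i⟩ h
      simp only [Finset.mem_sigma, Finset.mem_range, Finset.mem_Icc] at h ⊢
      omega
    · rintro ⟨i, n, j⟩ h
      simp only [Finset.mem_sigma, Finset.mem_range, Finset.mem_Icc] at h ⊢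
      omega
    · rintro ⟨j, m, i⟩ h
      simp only [Finset.mem_sigma, Finset.mem_range, Finset.mem_Icc] at h ⊢
      congr 2
      omega
    · rintro ⟨i, n, j⟩ h
      simp only [Finset.mem_sigma, Finset.mem_range] at h ⊢
      congr 2
      omega
    · rintro ⟨j, m, i⟩ h
      simp only [Finset.mem_sigma, Finset.mem_range, Finset.mem_Icc] at h ⊢
      rw [show i - (m + j) = i - m - j by omega, show c - i + (i - m) = c - m by omega]
      ring
  rw [num, h2, emptyTerm_eq, Finset.mul_sum, ← Finset.sum_sub_distrib]
  refine Finset.sum_congr rfl fun i _ => ?_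
  simp_rw [mul_sub, Finset.sum_sub_distrib, mul_sub, ← Finset.sum_mul]
  ring

lemma stationary_zero {c : ℕ} {p k π : ℕ → ℝ} (hπ : IsStationary (trans c p k) π) :
    (π 0 : ℂ) = ∑ i ∈ Finset.range (c + 1), (p i : ℂ) *
      ∑ n ∈ Finset.range (i + 1), conv k (fun j => (π j : ℂ)) n := by
  have h1 : π 0 = ∑ m ∈ Finset.range (c + 1), π m * trans c p k m 0 := by
    refine (hπ.invariant 0).unique (hasSum_sum_of_ne_finset_zero fun m hm => ?_)
    rw [trans_eq_zero c p k (by simp at hm; omega), mul_zero]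
  rw [h1]
  simp_rw [trans_zero_right]
  unfold conv
  push_cast
  simp_rw [Finset.mul_sum, Finset.sum_sigma']
  refine Finset.sum_nbij' (fun a => ⟨a.2.1, a.1 + a.2.2, a.1⟩)
    (fun a => ⟨a.2.2, a.1, a.2.1 - a.2.2⟩) ?_ ?_ ?_ ?_ ?_
  · rintro ⟨m, i, v⟩ h
    simp only [Finset.mem_sigma, Finset.mem_range] at h ⊢
    omega
  · rintro ⟨i, n, m⟩ h
    simp only [Finset.mem_sigma, Finset.mem_range] at h ⊢
    omega
  · rintro ⟨m, i, v⟩ h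
    simp
  · rintro ⟨i, n, m⟩ h
    simp only [Finset.mem_sigma, Finset.mem_range] at h ⊢
    congr 2
    omega
  · rintro ⟨m, i, v⟩ h
    simp only [Nat.add_sub_cancel_left]
    ring

lemma stationary_of_ne_zero {c : ℕ} {p k π : ℕ → ℝ} (hπ : IsStationary (trans c p k) π) {l : ℕ}
    (hl : l ≠ 0) :
    (π l : ℂ) = ∑ i ∈ Finset.range (c + 1), (p i : ℂ) * conv k (fun j => (π j : ℂ)) (i + l) := by
  have h1 : π l = ∑ m ∈ Finset.range (c + l + 1), π m * trans c p k m l := by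
    refine (hπ.invariant l).unique (hasSum_sum_of_ne_finset_zero fun m hm => ?_)
    rw [trans_eq_zero c p k (by simp at hm; omega), mul_zero]
  rw [h1]
  simp_rw [trans_of_ne_zero c p k _ hl, Finset.mul_sum]
  rw [Finset.sum_comm]
  push_cast
  refine Finset.sum_congr rfl fun i hi => ?_
  rw [conv, Finset.mul_sum]
  rw [Finset.mem_range] at hi
  rw [← Finset.sum_subset (Finset.range_subset_range.2 (show i + l + 1 ≤ c + l + 1 by omega))]
  · refine Finset.sum_congr rfl fun m hm => ?_
    rw [Finset.mem_range] at hm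
    rw [if_pos (by omega)]
    ring
  · intro m _ hm
    rw [Finset.mem_range] at hm
    rw [if_neg (by omega)]
    simp

lemma summable_norm_mul_pow {w : ℕ → ℝ} (hw : ∀ n, 0 ≤ w n) (hs : Summable w) {z : ℂ}
    (hz : ‖z‖ ≤ 1) : Summable fun n => ‖(w n : ℂ) * z ^ n‖ := by
  refine Summable.of_nonneg_of_le (fun n => norm_nonneg _) (fun n => ?_) hs
  rw [norm_mul, norm_pow, Complex.norm_real, Real.norm_of_nonneg (hw n)]
  exact mul_le_of_le_one_right (hw n) (pow_le_one₀ (norm_nonneg z) hz)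

lemma hasSum_conv {k π : ℕ → ℝ} (hk : ∀ n, 0 ≤ k n) (hks : Summable k) (hπ : ∀ n, 0 ≤ π n)
    (hπs : Summable π) {z : ℂ} (hz : ‖z‖ ≤ 1) :
    HasSum (fun n => conv k (fun j => (π j : ℂ)) n * z ^ n)
      (pgf π z * ∑' v, (k v : ℂ) * z ^ v) := by
  have h1 := summable_norm_mul_pow hπ hπs hz
  have h2 := summable_norm_mul_pow hk hks hz
  have h3 := tsum_mul_tsum_eq_tsum_sum_range_of_summable_norm h1 h2
  have h4 : ∀ n, ∑ j ∈ Finset.range (n + 1), (π j : ℂ) * z ^ j * ((k (n - j) : ℂ) * z ^ (n - j)) =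
      conv k (fun j => (π j : ℂ)) n * z ^ n := by
    intro n
    rw [conv, Finset.sum_mul]
    refine Finset.sum_congr rfl fun j hj => ?_
    rw [Finset.mem_range] at hj
    rw [show z ^ n = z ^ j * z ^ (n - j) by rw [← pow_add]; congr 1; omega]
    ring
  have h5 := (summable_norm_sum_mul_range_of_summable_norm h1 h2).of_norm
  simp_rw [h4] at h3 h5
  rw [pgf, h3]
  exact h5.hasSum

/-- The generating function of a stationary distribution is the quotient of `num` and `den`. -/
theorem den_mul_pgf {c : ℕ} {p k π : ℕ → ℝ} {lam : ℝ} {ν : Measure ℝ}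
    (hK : ∀ z : ℂ, ‖z‖ ≤ 1 → HasSum (fun v => (k v : ℂ) * z ^ v) (K lam ν z))
    (hk : ∀ n, 0 ≤ k n) (hks : Summable k)
    (hπ : IsStationary (trans c p k) π) {z : ℂ} (hz : ‖z‖ ≤ 1) :
    den c p lam ν z * pgf π z = num c p k (fun j => (π j : ℂ)) z := by
  set a := conv k (fun j => (π j : ℂ)) with ha
  have hconv := hasSum_conv hk hks hπ.nonneg hπ.hasSum_one.summable hz
  rw [(hK z hz).tsum_eq, ← ha] at hconv
  have hN : HasSum (fun l => (π l : ℂ) * z ^ l) (pgf π z) :=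
    (summable_norm_mul_pow hπ.nonneg hπ.hasSum_one.summable hz).of_norm.hasSum
  have hN' : HasSum (fun l => (π l : ℂ) * z ^ (c + l)) (z ^ c * pgf π z) := by
    refine (hN.mul_left (z ^ c)).congr_fun ?_
    intro l
    rw [pow_add]
    ring
  -- For capacity `i`, state `0` collects all `n ≤ i`, and the other states are the tail of the
  -- convolution series shifted down by `i`. The factor `z ^ c` keeps all exponents nonnegative, so
  -- `z = 0` needs no exception.
  have hshift : ∀ i ∈ Finset.range (c + 1), HasSum
      (fun l => (if l = 0 then ∑ n ∈ Finset.range (i + 1), a n else a (i + l)) * z ^ (c + l))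
      ((∑ n ∈ Finset.range (i + 1), a n) * z ^ c + z ^ (c - i) *
        (pgf π z * K lam ν z - ∑ n ∈ Finset.range (i + 1), a n * z ^ n)) := by
    intro i hi
    rw [Finset.mem_range] at hi
    have h1 := ((hasSum_nat_add_iff' (i + 1)).2 hconv).mul_left (z ^ (c - i))
    rw [← hasSum_nat_add_iff' 1]
    simp only [Finset.sum_range_one, if_true, add_zero, add_sub_cancel_left]
    refine h1.congr_fun fun l => ?_
    rw [if_neg (Nat.succ_ne_zero l), show i + (l + 1) = l + (i + 1) by ring,
      show c + (l + 1) = c - i + (l + (i + 1)) by omega, pow_add]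
    ring
  have hsum := hasSum_sum fun i hi => (hshift i hi).mul_left (p i : ℂ)
  have heq : z ^ c * pgf π z = ∑ i ∈ Finset.range (c + 1), (p i : ℂ) *
      ((∑ n ∈ Finset.range (i + 1), a n) * z ^ c + z ^ (c - i) *
        (pgf π z * K lam ν z - ∑ n ∈ Finset.range (i + 1), a n * z ^ n)) := by
    refine hN'.unique (hsum.congr_fun fun l => ?_)
    rcases eq_or_ne l 0 with rfl | hl
    · rw [stationary_zero hπ, Finset.sum_mul]
      refine Finset.sum_congr rfl fun i _ => ?_
      rw [if_pos rfl, mul_assoc]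
    · rw [stationary_of_ne_zero hπ hl, Finset.sum_mul]
      refine Finset.sum_congr rfl fun i _ => ?_
      rw [if_neg hl, mul_assoc]
  have hrefl : ∑ i ∈ Finset.range (c + 1), (p (c - i) : ℂ) * z ^ i =
      ∑ i ∈ Finset.range (c + 1), (p i : ℂ) * z ^ (c - i) := by
    rw [← Finset.sum_range_reflect]
    refine Finset.sum_congr rfl fun i hi => ?_
    rw [Finset.mem_range] at hi
    rw [show c - (c + 1 - 1 - i) = i by omega, show c + 1 - 1 - i = c - i by omega]
  rw [den, sub_mul, heq, hrefl, num_eq, ← ha, mul_comm (K lam ν z), mul_assoc, Finset.sum_mul,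
    ← Finset.sum_sub_distrib]
  refine Finset.sum_congr rfl fun i hi => ?_
  rw [Finset.mem_range] at hi
  -- The term `n = i` needs no correction and cancels, which is why `num` sums over `n < i` only.
  rw [Finset.sum_range_succ, Finset.sum_range_succ]
  simp_rw [mul_sub, Finset.sum_sub_distrib, ← Finset.sum_mul]
  have : ∀ n, a n * z ^ (c - i + n) = z ^ (c - i) * (a n * z ^ n) := fun n => by
    rw [pow_add]; ring
  simp_rw [this, ← Finset.mul_sum]
  have hc : z ^ c = z ^ (c - i) * z ^ i := by rw [← pow_add]; congr 1; omega
  rw [hc]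
  ring

end

section

/-! ### Power series with nonnegative summable coefficients -/

section PowerSeries

variable {w : ℕ → ℝ}

lemma norm_mul_pow_le (hw : ∀ n, 0 ≤ w n) {z : ℂ} (hz : ‖z‖ ≤ 1) (n : ℕ) :
    ‖(w n : ℂ) * z ^ n‖ ≤ w n := by
  rw [norm_mul, norm_pow, Complex.norm_real, Real.norm_of_nonneg (hw n)]
  exact mul_le_of_le_one_right (hw n) (pow_le_one₀ (norm_nonneg z) hz)

lemma continuousOn_pgf (hw : ∀ n, 0 ≤ w n) (hs : Summable w) :
    ContinuousOn (pgf w) (Metric.closedBall 0 1) :=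
  continuousOn_tsum (fun n => by fun_prop) hs
    fun n z hz => norm_mul_pow_le hw (mem_closedBall_zero_iff.1 hz) n

lemma differentiableOn_pgf (hw : ∀ n, 0 ≤ w n) (hs : Summable w) :
    DifferentiableOn ℂ (pgf w) (Metric.ball 0 1) :=
  Complex.differentiableOn_tsum_of_summable_norm hs (fun n => by fun_prop) Metric.isOpen_ball
    fun n z hz => norm_mul_pow_le hw (mem_ball_zero_iff.1 hz).le n

lemma pgf_one (hs : HasSum w 1) : pgf w 1 = 1 := by
  rw [pgf]
  simp only [one_pow, mul_one]
  exact_mod_cast (Complex.hasSum_ofReal.2 hs).tsum_eq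

lemma hasSum_deriv_pgf (hw : ∀ n, 0 ≤ w n) (hs : Summable w) {z : ℂ} (hz : ‖z‖ < 1) :
    HasSum (fun n : ℕ => (w n : ℂ) * (n * z ^ (n - 1))) (deriv (pgf w) z) := by
  have := Complex.hasSum_deriv_of_summable_norm hs (F := fun n z => (w n : ℂ) * z ^ n)
    (fun n => by fun_prop) Metric.isOpen_ball
    (fun n z hz => norm_mul_pow_le hw (mem_ball_zero_iff.1 hz).le n) (mem_ball_zero_iff.2 hz)
  refine this.congr_fun fun n => ?_
  rw [deriv_const_mul _ (by fun_prop), deriv_pow_field]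

lemma tendsto_deriv_pgf (hw : ∀ n, 0 ≤ w n) (hs : Summable w)
    (hm : Summable fun n : ℕ => (n : ℝ) * w n) :
    Tendsto (deriv (pgf w)) (𝓝[Metric.ball 0 1] 1) (𝓝 ((∑' n : ℕ, (n : ℝ) * w n : ℝ) : ℂ)) := by
  have h1 : Tendsto (fun z : ℂ => ∑' n : ℕ, (w n : ℂ) * (n * z ^ (n - 1)))
      (𝓝[Metric.ball 0 1] 1) (𝓝 (∑' n : ℕ, (((n : ℝ) * w n : ℝ) : ℂ))) := by
    refine tendsto_tsum_of_dominated_convergence hm (fun n => ?_) ?_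
    · have : ContinuousAt (fun z : ℂ => (w n : ℂ) * (n * z ^ (n - 1))) 1 := by fun_prop
      have h2 := this.tendsto.mono_left (nhdsWithin_le_nhds (s := Metric.ball (0 : ℂ) 1))
      convert h2 using 2
      push_cast
      ring
    · filter_upwards [self_mem_nhdsWithin] with z hz n
      rw [norm_mul, norm_mul, norm_pow, Complex.norm_real, Real.norm_of_nonneg (hw n),
        Complex.norm_natCast, mul_comm]
      refine mul_le_mul_of_nonneg_right ?_ (hw n)
      exact mul_le_of_le_one_right (Nat.cast_nonneg n)
        (pow_le_one₀ (norm_nonneg z) (mem_ball_zero_iff.1 hz).le)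
  rw [← Complex.ofReal_tsum] at h1
  refine h1.congr' ?_
  filter_upwards [self_mem_nhdsWithin] with z hz
  exact (hasSum_deriv_pgf hw hs (mem_ball_zero_iff.1 hz)).tsum_eq

lemma norm_pow_sub_one_le {z : ℂ} (hz : ‖z‖ ≤ 1) (n : ℕ) : ‖z ^ n - 1‖ ≤ n * ‖z - 1‖ := by
  induction n with
  | zero => simp
  | succ n ih =>
    have : z ^ (n + 1) - 1 = z * (z ^ n - 1) + (z - 1) := by ring
    rw [this]
    refine (norm_add_le _ _).trans ?_
    rw [norm_mul]
    have h1 : ‖z‖ * ‖z ^ n - 1‖ ≤ 1 * ‖z ^ n - 1‖ :=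
      mul_le_mul_of_nonneg_right hz (norm_nonneg _)
    push_cast
    linarith

/-- Only a first moment is available, so the series need not extend beyond the closed disc. Inside
it the slopes of `z ^ n` at `1` are bounded by `n`, and dominated convergence applies. -/
lemma hasDerivWithinAt_pgf (hw : ∀ n, 0 ≤ w n) (hs : Summable w)
    (hm : Summable fun n : ℕ => (n : ℝ) * w n) :
    HasDerivWithinAt (pgf w) ((∑' n : ℕ, (n : ℝ) * w n : ℝ) : ℂ) (Metric.closedBall 0 1) 1 := by
  rw [hasDerivWithinAt_iff_tendsto_slope]
  have h1 : Tendsto (fun z : ℂ => ∑' n : ℕ, (w n : ℂ) * slope (fun z => z ^ n) 1 z)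
      (𝓝[Metric.closedBall 0 1 \ {1}] 1) (𝓝 (∑' n : ℕ, (((n : ℝ) * w n : ℝ) : ℂ))) := by
    refine tendsto_tsum_of_dominated_convergence hm (fun n => ?_) ?_
    · have h2 := (hasDerivAt_pow n (1 : ℂ)).hasDerivWithinAt (s := Metric.closedBall (0 : ℂ) 1)
      rw [hasDerivWithinAt_iff_tendsto_slope] at h2
      convert h2.const_mul (w n : ℂ) using 2
      push_cast
      simp only [one_pow, mul_one]
      ring
    · filter_upwards [self_mem_nhdsWithin] with z hz n
      have hz1 : 0 < ‖z - 1‖ := norm_pos_iff.2 (sub_ne_zero.2 hz.2)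
      rw [norm_mul, Complex.norm_real, Real.norm_of_nonneg (hw n), mul_comm, slope_def_field,
        norm_div, one_pow]
      refine mul_le_mul_of_nonneg_right ?_ (hw n)
      rw [div_le_iff₀ hz1]
      exact norm_pow_sub_one_le (mem_closedBall_zero_iff.1 hz.1) n
  rw [← Complex.ofReal_tsum] at h1
  refine h1.congr' ?_
  filter_upwards [self_mem_nhdsWithin] with z hz
  have e1 := (summable_norm_mul_pow hw hs (mem_closedBall_zero_iff.1 hz.1)).of_norm
  have e2 := (summable_norm_mul_pow hw hs (z := 1) (by simp)).of_norm
  rw [slope_def_field, pgf, pgf, ← e1.tsum_sub e2, div_eq_mul_inv, ← tsum_mul_right]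
  refine tsum_congr fun n => ?_
  rw [slope_def_field]
  ring

/-- Strict triangle inequality between the first two terms: `w 0` and `w 1 * z` are positively
aligned only for `z = 1`. The rest of the series is bounded by its mass. -/
lemma norm_pgf_lt_one (hw : ∀ n, 0 ≤ w n) (hs : HasSum w 1) (h0 : 0 < w 0) (h1 : 0 < w 1) {z : ℂ}
    (hz : ‖z‖ = 1) (hz1 : z ≠ 1) : ‖pgf w z‖ < 1 := by
  have hsum := (summable_norm_mul_pow hw hs.summable hz.le)
  have hs2 := (hasSum_nat_add_iff' 2).2 hs
  have e1 := hsum.of_norm.sum_add_tsum_nat_add 2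
  have hnorm : ‖∑' n, (w (n + 2) : ℂ) * z ^ (n + 2)‖ ≤ 1 - (w 0 + w 1) := by
    have := tsum_of_norm_bounded (f := fun n => (w (n + 2) : ℂ) * z ^ (n + 2)) hs2
      fun n => norm_mul_pow_le hw hz.le (n + 2)
    simpa [Finset.sum_range_succ] using this
  have hre : z.re < 1 := by
    have h2 : z.re ≤ 1 := hz ▸ Complex.re_le_norm z
    refine lt_of_le_of_ne h2 fun h3 => hz1 ?_
    have h4 : ‖z‖ ^ 2 = z.re ^ 2 + z.im ^ 2 := by
      rw [Complex.sq_norm, Complex.normSq_apply]; ring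
    rw [hz, h3] at h4
    have h5 : z.im = 0 := by nlinarith
    exact Complex.ext h3 h5
  have hlt : ‖(w 0 : ℂ) + w 1 * z‖ < w 0 + w 1 := by
    refine lt_of_pow_lt_pow_left₀ 2 (by positivity) ?_
    have h4 : ‖z‖ ^ 2 = z.re ^ 2 + z.im ^ 2 := by
      rw [Complex.sq_norm, Complex.normSq_apply]; ring
    rw [hz] at h4
    rw [Complex.sq_norm, Complex.normSq_apply]
    simp only [Complex.add_re, Complex.ofReal_re, Complex.mul_re, Complex.ofReal_im, zero_mul,
      sub_zero, Complex.add_im, Complex.mul_im, zero_add, add_zero]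
    have h5 : 0 < w 0 * w 1 * (1 - z.re) := by
      have : 0 < 1 - z.re := by linarith
      positivity
    have h6 : w 1 ^ 2 * (z.re ^ 2 + z.im ^ 2) = w 1 ^ 2 := by rw [← h4]; ring
    linarith
  rw [pgf, ← e1]
  refine (norm_add_le _ _).trans_lt ?_
  have : ∑ n ∈ Finset.range 2, (w n : ℂ) * z ^ n = (w 0 : ℂ) + w 1 * z := by
    simp [Finset.sum_range_succ]
  rw [this]
  linarith

end PowerSeries

/-! ### Counting zeros by the logarithmic derivative -/

section ZeroCount

open Metric

variable {f : ℂ → ℂ} {r R : ℝ}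

lemma order_ne_top (hf : DifferentiableOn ℂ f (ball 0 R)) {z₀ z : ℂ} (hz₀ : z₀ ∈ ball 0 R)
    (hne : f z₀ ≠ 0) (hz : z ∈ ball 0 R) : analyticOrderAt f z ≠ ⊤ := by
  have ha := hf.analyticOnNhd isOpen_ball
  refine ha.analyticOrderAt_ne_top_of_isPreconnected (convex_ball 0 R).isPreconnected hz₀ hz ?_
  rw [(ha z₀ hz₀).analyticOrderAt_eq_zero.2 hne]
  exact ENat.zero_ne_top

/-- Argument principle for a disc, by induction on the total order of the zeros. Dividing by `z - a`
with `dslope` lowers the order at the zero `a` by one and removes the term `(z - a)⁻¹`, of integral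
`2πi`, from the logarithmic derivative. -/
lemma circleIntegral_logDeriv_aux (hr : 0 < r) (hrR : r < R) (Z : Finset ℂ)
    (hZ : ∀ z ∈ Z, z ∈ ball 0 r) (n : ℕ) : ∀ f : ℂ → ℂ, DifferentiableOn ℂ f (ball 0 R) →
    (∀ z ∈ closedBall 0 r, f z = 0 → z ∈ Z) → ∑ z ∈ Z, analyticOrderNatAt f z = n →
    (∮ z in C(0, r), deriv f z / f z) = n * (2 * Real.pi * Complex.I) := by
  have hsub : closedBall (0 : ℂ) r ⊆ ball 0 R := closedBall_subset_ball hrR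
  have hr0 : (r : ℂ) ∈ closedBall (0 : ℂ) r := by
    simp [abs_of_pos hr]
  have hr1 : (r : ℂ) ∉ Z := fun h => by
    have := hZ _ h
    simp [abs_of_pos hr] at this
  induction n with
  | zero =>
    intro f hf hfZ hsum
    have ha := hf.analyticOnNhd isOpen_ball
    have hne : ∀ z ∈ closedBall 0 r, f z ≠ 0 := by
      intro z hz h0
      have h1 := (Finset.sum_eq_zero_iff.1 hsum) z (hfZ z hz h0)
      have h2 := order_ne_top hf (hsub hr0) (fun h => hr1 (hfZ _ hr0 h)) (hsub hz)
      have h3 : analyticOrderAt f z = 0 := by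
        rw [← Nat.cast_analyticOrderNatAt h2, h1, Nat.cast_zero]
      exact ((ha z (hsub hz)).analyticOrderAt_eq_zero.1 h3) h0
    have hd : DifferentiableOn ℂ (fun z => deriv f z / f z) (closedBall 0 r) := by
      intro z hz
      have hz' := ha z (hsub hz)
      exact (hz'.deriv.differentiableAt.div hz'.differentiableAt
        (hne z hz)).differentiableWithinAt
    rw [Nat.cast_zero, zero_mul]
    exact Complex.circleIntegral_eq_zero_of_differentiable_on_off_countable hr.le
      Set.countable_empty hd.continuousOn fun z hz =>
        (hd.mono ball_subset_closedBall).differentiableAt (isOpen_ball.mem_nhds hz.1)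
  | succ n ih =>
    intro f hf hfZ hsum
    have ha := hf.analyticOnNhd isOpen_ball
    have hne : ∀ z ∈ closedBall 0 r, z ∉ Z → f z ≠ 0 := fun z hz hzZ h0 => hzZ (hfZ z hz h0)
    obtain ⟨a, haZ, ha0⟩ : ∃ a ∈ Z, analyticOrderNatAt f a ≠ 0 := by
      by_contra hcon
      push Not at hcon
      rw [Finset.sum_eq_zero hcon] at hsum
      omega
    have hfa : f a = 0 := apply_eq_zero_of_analyticOrderNatAt_ne_zero ha0
    have haR : a ∈ ball (0 : ℂ) R := ball_subset_ball hrR.le (hZ a haZ)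
    set g := dslope f a with hg
    have hgd : DifferentiableOn ℂ g (ball 0 R) :=
      (Complex.differentiableOn_dslope (isOpen_ball.mem_nhds haR)).2 hf
    have hga := hgd.analyticOnNhd isOpen_ball
    have hfg : f = (fun z => z - a) * g := by
      funext z
      have := sub_smul_dslope f a z
      rw [hfa, sub_zero, smul_eq_mul] at this
      exact this.symm
    have hgZ : ∀ z ∈ closedBall 0 r, g z = 0 → z ∈ Z := by
      intro z hz h0
      refine hfZ z hz ?_
      rw [hfg, Pi.mul_apply, h0, mul_zero]
    have hord : ∀ z ∈ Z, analyticOrderNatAt f z =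
        (if z = a then 1 else 0) + analyticOrderNatAt g z := by
      intro z hz
      have hzR : z ∈ ball (0 : ℂ) R := ball_subset_ball hrR.le (hZ z hz)
      have hgt := order_ne_top hgd (hsub hr0) (fun h => hr1 (hgZ _ hr0 h)) hzR
      have e1 : analyticOrderAt (fun z => z - a) z = if z = a then 1 else 0 := by
        split_ifs with h
        · rw [h]; exact analyticOrderAt_id_sub_const_self
        · exact analyticOrderAt_id_sub_const_of_ne h
      have e2 : analyticOrderAt (fun z => z - a) z ≠ ⊤ := by
        rw [e1]; split_ifs <;> simp
      conv_lhs => rw [hfg]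
      rw [analyticOrderNatAt_mul (by fun_prop) (hga z hzR) e2 hgt]
      congr 1
      rw [analyticOrderNatAt, e1]
      split_ifs <;> rfl
    have hsumg : ∑ z ∈ Z, analyticOrderNatAt g z = n := by
      rw [Finset.sum_congr rfl hord, Finset.sum_add_distrib, Finset.sum_ite_eq' Z a,
        if_pos haZ] at hsum
      omega
    have hint := ih g hgd hgZ hsumg
    have hsph : ∀ z ∈ sphere (0 : ℂ) r, z ∉ Z := fun z hz h => by
      have h1 := mem_ball_zero_iff.1 (hZ z h)
      rw [mem_sphere_zero_iff_norm.1 hz] at h1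
      exact lt_irrefl _ h1
    have hgne : ∀ z ∈ sphere (0 : ℂ) r, g z ≠ 0 := fun z hz h =>
      hsph z hz (hgZ z (sphere_subset_closedBall hz) h)
    have hzne : ∀ z ∈ sphere (0 : ℂ) r, z - a ≠ 0 := fun z hz h =>
      hsph z hz (sub_eq_zero.1 h ▸ haZ)
    have e1 : (∮ z in C(0, r), deriv f z / f z) =
        ∮ z in C(0, r), ((z - a)⁻¹ + deriv g z / g z) := by
      refine circleIntegral.integral_congr hr.le fun z hz => ?_
      have hzR := hsub (sphere_subset_closedBall hz)
      have hd : HasDerivAt f (1 * g z + (z - a) * deriv g z) z := by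
        rw [hfg]
        exact ((hasDerivAt_id z).sub_const a).mul (hga z hzR).differentiableAt.hasDerivAt
      show deriv f z / f z = (z - a)⁻¹ + deriv g z / g z
      rw [hd.deriv, hfg, Pi.mul_apply]
      have h1 := hgne z hz
      have h2 := hzne z hz
      field_simp
    have c1 : CircleIntegrable (fun z => (z - a)⁻¹) 0 r := by
      refine ContinuousOn.circleIntegrable hr.le ?_
      exact ContinuousOn.inv₀ (by fun_prop) hzne
    have c2 : CircleIntegrable (fun z => deriv g z / g z) 0 r := by
      refine ContinuousOn.circleIntegrable hr.le ?_
      refine ContinuousOn.div ?_ ?_ hgne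
      · exact fun z hz => (hga z (hsub (sphere_subset_closedBall hz))).deriv.continuousAt.continuousWithinAt
      · exact fun z hz => (hga z (hsub (sphere_subset_closedBall hz))).continuousAt.continuousWithinAt
    rw [e1, circleIntegral.integral_add c1 c2, hint,
      circleIntegral.integral_sub_inv_of_mem_ball (hZ a haZ)]
    push_cast
    ring

lemma finite_zeros (hrR : r < R) (hf : DifferentiableOn ℂ f (ball 0 R)) {z₀ : ℂ}
    (hz₀ : z₀ ∈ ball 0 R) (hne : f z₀ ≠ 0) : {z | z ∈ closedBall 0 r ∧ f z = 0}.Finite := by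
  by_contra hcon
  obtain ⟨x, hx, hacc⟩ := Set.Infinite.exists_accPt_of_subset_isCompact hcon
    (isCompact_closedBall (0 : ℂ) r) fun z hz => hz.1
  have hfreq : ∃ᶠ z in 𝓝[≠] x, f z = 0 := by
    refine (accPt_iff_frequently_nhdsNE.1 hacc).mono fun z hz => hz.2
  exact hne ((hf.analyticOnNhd isOpen_ball).eqOn_zero_of_preconnected_of_frequently_eq_zero
    (convex_ball 0 R).isPreconnected (closedBall_subset_ball hrR hx) hfreq hz₀)

end ZeroCount

end

section

/-! ### Zeros of the denominator -/

/-- `k` is a probability law with mean `ρ`, positive at `0` and `1`, whose generating function is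
`K`. -/
structure IsArrivalLaw (lam : ℝ) (ν : Measure ℝ) (k : ℕ → ℝ) (ρ : ℝ) : Prop where
  nonneg : ∀ v, 0 ≤ k v
  hasSum_one : HasSum k 1
  zero_pos : 0 < k 0
  one_pos : 0 < k 1
  hasSum_mean : HasSum (fun v : ℕ => (v : ℝ) * k v) ρ
  hasSum_K : ∀ z : ℂ, ‖z‖ ≤ 1 → HasSum (fun v => (k v : ℂ) * z ^ v) (K lam ν z)

namespace IsCapacityLaw

variable {c : ℕ} {p : ℕ → ℝ} (hp : IsCapacityLaw c p)

include hp

lemma pos : 1 ≤ c := by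
  by_contra h
  have h1 := hp.support c (by rw [Finset.mem_Icc]; tauto)
  exact absurd hp.top_pos (by rw [h1]; exact lt_irrefl _)

lemma zero : p 0 = 0 := hp.support 0 (by simp)

lemma sum_range : ∑ i ∈ Finset.range (c + 1), p i = 1 := by
  rw [Finset.sum_range_succ', hp.zero, add_zero, ← hp.sum_eq_one,
    Finset.sum_bij (fun i _ => i + 1)]
  · intro i hi
    simp only [Finset.mem_range, Finset.mem_Icc] at hi ⊢
    omega
  · intro i _ j _ h
    omega
  · intro i hi
    rw [Finset.mem_Icc] at hi
    exact ⟨i - 1, by rw [Finset.mem_range]; omega, by omega⟩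
  · intro i _
    rfl

lemma meanCap_eq : meanCap c p = ∑ i ∈ Finset.range (c + 1), (i : ℝ) * p i := by
  rw [Finset.sum_range_succ', meanCap]
  simp only [Nat.cast_zero, zero_mul, add_zero]
  symm
  refine Finset.sum_bij (fun i _ => i + 1) ?_ ?_ ?_ ?_
  · intro i hi
    simp only [Finset.mem_range, Finset.mem_Icc] at hi ⊢
    omega
  · intro i _ j _ h
    omega
  · intro i hi
    rw [Finset.mem_Icc] at hi
    exact ⟨i - 1, by rw [Finset.mem_range]; omega, by omega⟩
  · intro i _
    rfl

lemma sum_reflect : ∑ i ∈ Finset.range (c + 1), p (c - i) = 1 := by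
  rw [← hp.sum_range, ← Finset.sum_range_reflect]
  refine Finset.sum_congr rfl fun i hi => ?_
  rw [Finset.mem_range] at hi
  congr 1
  omega

lemma sum_reflect_mul : ∑ i ∈ Finset.range (c + 1), (i : ℝ) * p (c - i) = c - meanCap c p := by
  have h1 : ∑ i ∈ Finset.range (c + 1), (i : ℝ) * p (c - i) =
      ∑ i ∈ Finset.range (c + 1), ((c : ℝ) * p i - (i : ℝ) * p i) := by
    rw [← Finset.sum_range_reflect]
    refine Finset.sum_congr rfl fun i hi => ?_
    rw [Finset.mem_range] at hi
    rw [show c - (c + 1 - 1 - i) = i by omega, show c + 1 - 1 - i = c - i by omega,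
      Nat.cast_sub (by omega)]
    ring
  rw [h1, Finset.sum_sub_distrib, ← Finset.mul_sum, hp.sum_range, mul_one, hp.meanCap_eq]

lemma norm_sum_le {z : ℂ} (hz : ‖z‖ ≤ 1) :
    ‖∑ i ∈ Finset.range (c + 1), (p (c - i) : ℂ) * z ^ i‖ ≤ 1 := by
  refine (_root_.norm_sum_le _ _).trans ?_
  rw [← hp.sum_reflect]
  refine Finset.sum_le_sum fun i _ => ?_
  rw [norm_mul, norm_pow, Complex.norm_real, Real.norm_of_nonneg (hp.nonneg _)]
  exact mul_le_of_le_one_right (hp.nonneg _) (pow_le_one₀ (norm_nonneg z) hz)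

lemma sum_one : ∑ i ∈ Finset.range (c + 1), (p (c - i) : ℂ) * 1 ^ i = 1 := by
  simp only [one_pow, mul_one]
  exact_mod_cast hp.sum_reflect

end IsCapacityLaw

section Den

variable {c : ℕ} {p : ℕ → ℝ} {lam ρ : ℝ} {ν : Measure ℝ} {k : ℕ → ℝ}

lemma IsArrivalLaw.eqOn_K (hk : IsArrivalLaw lam ν k ρ) :
    Set.EqOn (K lam ν) (pgf k) (Metric.closedBall 0 1) := fun z hz =>
  (hk.hasSum_K z (mem_closedBall_zero_iff.1 hz)).tsum_eq.symm

lemma IsArrivalLaw.K_one (hk : IsArrivalLaw lam ν k ρ) : K lam ν 1 = 1 := by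
  rw [hk.eqOn_K (by simp), pgf_one hk.hasSum_one]

lemma differentiableOn_den (c : ℕ) (p : ℕ → ℝ) (hk : IsArrivalLaw lam ν k ρ) :
    DifferentiableOn ℂ (den c p lam ν) (Metric.ball 0 1) := by
  have h1 : DifferentiableOn ℂ (K lam ν) (Metric.ball 0 1) :=
    (differentiableOn_pgf hk.nonneg hk.hasSum_one.summable).congr
      (hk.eqOn_K.mono Metric.ball_subset_closedBall)
  unfold den
  exact DifferentiableOn.sub (by fun_prop) (h1.mul (by fun_prop))

lemma continuousOn_den (c : ℕ) (p : ℕ → ℝ) (hk : IsArrivalLaw lam ν k ρ) :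
    ContinuousOn (den c p lam ν) (Metric.closedBall 0 1) := by
  have h1 : ContinuousOn (K lam ν) (Metric.closedBall 0 1) :=
    (continuousOn_pgf hk.nonneg hk.hasSum_one.summable).congr hk.eqOn_K
  unfold den
  exact ContinuousOn.sub (by fun_prop) (h1.mul (by fun_prop))

lemma den_zero_ne (hp : IsCapacityLaw c p) (hk : IsArrivalLaw lam ν k ρ) :
    den c p lam ν 0 ≠ 0 := by
  have hc := hp.pos
  have h1 : K lam ν 0 = k 0 := by
    rw [hk.eqOn_K (by simp), pgf, tsum_eq_single 0]
    · simp
    · intro n hn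
      simp [hn]
  have h2 : ∑ i ∈ Finset.range (c + 1), (p (c - i) : ℂ) * 0 ^ i = p c := by
    rw [Finset.sum_eq_single 0]
    · simp
    · intro i _ hi
      simp [hi]
    · simp
  rw [den, h1, h2, zero_pow (by omega), zero_sub, neg_ne_zero]
  have h3 := hk.zero_pos.ne'
  have h4 := hp.top_pos.ne'
  exact_mod_cast mul_ne_zero h3 h4

lemma den_one (hp : IsCapacityLaw c p) (hk : IsArrivalLaw lam ν k ρ) : den c p lam ν 1 = 0 := by
  rw [den, hp.sum_one, hk.K_one]
  simp

lemma norm_K_mul_lt_one (hp : IsCapacityLaw c p) (hk : IsArrivalLaw lam ν k ρ) {z : ℂ}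
    (hz : ‖z‖ = 1) (hz1 : z ≠ 1) :
    ‖K lam ν z * ∑ i ∈ Finset.range (c + 1), (p (c - i) : ℂ) * z ^ i‖ < 1 := by
  have h1 : ‖K lam ν z‖ < 1 := by
    rw [hk.eqOn_K (mem_closedBall_zero_iff.2 hz.le)]
    exact norm_pgf_lt_one hk.nonneg hk.hasSum_one hk.zero_pos hk.one_pos hz hz1
  rw [norm_mul]
  have h2 := mul_le_of_le_one_right (norm_nonneg (K lam ν z)) (hp.norm_sum_le hz.le)
  exact h2.trans_lt h1

theorem den_eq_zero_iff (hp : IsCapacityLaw c p) (hk : IsArrivalLaw lam ν k ρ) {z : ℂ}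
    (hz : ‖z‖ = 1) : den c p lam ν z = 0 ↔ z = 1 := by
  refine ⟨fun h => ?_, fun h => h ▸ den_one hp hk⟩
  by_contra hz1
  have h1 := norm_K_mul_lt_one hp hk hz hz1
  rw [den, sub_eq_zero] at h
  rw [← h, norm_pow, hz, one_pow] at h1
  exact lt_irrefl _ h1

theorem hasDerivWithinAt_den (hp : IsCapacityLaw c p) (hk : IsArrivalLaw lam ν k ρ) :
    HasDerivWithinAt (den c p lam ν) ((meanCap c p - ρ : ℝ) : ℂ) (Metric.closedBall 0 1) 1 := by
  have h1 : HasDerivWithinAt (K lam ν) (ρ : ℂ) (Metric.closedBall 0 1) 1 := by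
    have := hasDerivWithinAt_pgf hk.nonneg hk.hasSum_one.summable hk.hasSum_mean.summable
    rw [hk.hasSum_mean.tsum_eq] at this
    exact this.congr hk.eqOn_K (hk.eqOn_K (by simp))
  have h2 : HasDerivAt (fun z : ℂ => ∑ i ∈ Finset.range (c + 1), (p (c - i) : ℂ) * z ^ i)
      (∑ i ∈ Finset.range (c + 1), (p (c - i) : ℂ) * (i * 1 ^ (i - 1))) 1 :=
    HasDerivAt.fun_sum fun i _ => (hasDerivAt_pow i (1 : ℂ)).const_mul _
  have h3 : ∑ i ∈ Finset.range (c + 1), (p (c - i) : ℂ) * (i * 1 ^ (i - 1)) =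
      ((c - meanCap c p : ℝ) : ℂ) := by
    rw [← hp.sum_reflect_mul]
    push_cast
    refine Finset.sum_congr rfl fun i _ => ?_
    simp only [one_pow, mul_one]
    ring
  have h4 := ((hasDerivAt_pow c (1 : ℂ)).hasDerivWithinAt (s := Metric.closedBall 0 1)).sub
    (h1.mul h2.hasDerivWithinAt)
  unfold den
  refine h4.congr_deriv ?_
  rw [h3, hp.sum_one, hk.K_one]
  push_cast
  simp only [one_pow, mul_one, one_mul]
  ring

/-- If `u / v` were a real number at most `0`, the real part of `u = (u / v) * v` could not be
positive. -/
lemma div_mem_slitPlane {u v : ℂ} (hu : 0 < u.re) (hv : 0 < v.re) : u / v ∈ Complex.slitPlane := by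
  rw [Complex.mem_slitPlane_iff]
  by_contra hcon
  push Not at hcon
  have hv0 : v ≠ 0 := fun h => by rw [h] at hv; simp at hv
  have h1 : u = (u / v) * v := by field_simp
  have h2 : u.re = (u / v).re * v.re := by
    conv_lhs => rw [h1]
    rw [Complex.mul_re, hcon.2]
    ring
  nlinarith [hcon.1]

/-- Close to the unit circle, the denominator divided by `(z - 1) z ^ (c - 1)` avoids the negative
real axis. -/
lemma exists_radius (hp : IsCapacityLaw c p) (hk : IsArrivalLaw lam ν k ρ)
    (hρ : ρ < meanCap c p) : ∃ r : ℝ, 0 < r ∧ r < 1 ∧ ∀ z : ℂ, r ≤ ‖z‖ → ‖z‖ < 1 →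
      den c p lam ν z / ((z - 1) * z ^ (c - 1)) ∈ Complex.slitPlane := by
  have hc := hp.pos
  set W : ℂ → ℂ := fun z => den c p lam ν z / ((z - 1) * z ^ (c - 1)) with hW
  have hloc : ∀ z ∈ Metric.sphere (0 : ℂ) 1,
      ∀ᶠ y in 𝓝 z, y ∈ Metric.ball (0 : ℂ) 1 → W y ∈ Complex.slitPlane := by
    intro z hz
    have hz' := mem_sphere_zero_iff_norm.1 hz
    have hz0 : z ≠ 0 := fun h => by rw [h] at hz'; simp at hz'
    rw [← eventually_nhdsWithin_iff]
    by_cases hz1 : z = 1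
    -- At the boundary zero, the quotient by `z - 1` tends to `meanCap c p - ρ`, a positive real
    -- number.
    · rw [hz1]
      have h1 := (hasDerivWithinAt_den hp hk).mono Metric.ball_subset_closedBall
      rw [hasDerivWithinAt_iff_tendsto_slope] at h1
      have hnot : (1 : ℂ) ∉ Metric.ball (0 : ℂ) 1 := by simp
      rw [Set.sdiff_singleton_eq_self hnot] at h1
      have h2 : Tendsto (fun z : ℂ => z ^ (c - 1)) (𝓝[Metric.ball 0 1] 1) (𝓝 1) := by
        have : ContinuousAt (fun z : ℂ => z ^ (c - 1)) 1 := by fun_prop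
        simpa using this.tendsto.mono_left nhdsWithin_le_nhds
      have h3 := h1.div h2 one_ne_zero
      rw [div_one] at h3
      refine (h3.congr fun y => ?_).eventually_mem (Complex.isOpen_slitPlane.mem_nhds ?_)
      · rw [Pi.div_apply, slope_def_field, den_one hp hk, sub_zero, hW, div_div]
      · exact Complex.ofReal_mem_slitPlane.2 (by linarith)
    · have h1 : ContinuousWithinAt W (Metric.ball 0 1) z := by
        refine ContinuousWithinAt.div ?_ (by fun_prop) ?_
        · exact ((continuousOn_den c p hk) z (Metric.sphere_subset_closedBall hz)).mono
            Metric.ball_subset_closedBall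
        · exact mul_ne_zero (sub_ne_zero.2 hz1) (pow_ne_zero _ hz0)
      refine h1.eventually_mem (Complex.isOpen_slitPlane.mem_nhds ?_)
      set G := K lam ν z * ∑ i ∈ Finset.range (c + 1), (p (c - i) : ℂ) * z ^ i with hG
      have hG1 : ‖G‖ < 1 := norm_K_mul_lt_one hp hk hz' hz1
      -- Dividing numerator and denominator by `z ^ c` exhibits two numbers with positive real part:
      -- on the circle `G / z ^ c` has modulus below `1`, and `z⁻¹` is a unit different from `1`.
      have e1 : W z = (1 - G / z ^ c) / (1 - z⁻¹) := by
        have hzc : z ^ c = z * z ^ (c - 1) := by rw [← pow_succ']; congr 1; omega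
        have h2 : z - 1 ≠ 0 := sub_ne_zero.2 hz1
        have h3 : z ^ (c - 1) ≠ 0 := pow_ne_zero _ hz0
        have h4 : 1 - z⁻¹ = (z - 1) / z := by field_simp
        rw [hW]
        simp only [den]
        rw [← hG, h4, hzc]
        field_simp
      rw [e1]
      refine div_mem_slitPlane ?_ ?_
      · have : ‖G / z ^ c‖ < 1 := by rw [norm_div, norm_pow, hz', one_pow, div_one]; exact hG1
        rw [Complex.sub_re, Complex.one_re]
        linarith [Complex.re_le_norm (G / z ^ c)]
      · rw [Complex.sub_re, Complex.one_re]
        have h2 : ‖z⁻¹‖ = 1 := by rw [norm_inv, hz', inv_one]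
        have h3 : z⁻¹.re ≤ 1 := h2 ▸ Complex.re_le_norm _
        have h4 : z⁻¹.re ≠ 1 := by
          intro h5
          have h6 : ‖z⁻¹‖ ^ 2 = z⁻¹.re ^ 2 + z⁻¹.im ^ 2 := by
            rw [Complex.sq_norm, Complex.normSq_apply]; ring
          rw [h2, h5] at h6
          have h7 : z⁻¹.im = 0 := by nlinarith
          have h8 : z⁻¹ = 1 := Complex.ext h5 h7
          exact hz1 (inv_eq_one.1 h8)
        have := lt_of_le_of_ne h3 h4
        linarith
  -- Compactness of the circle makes the local neighbourhoods uniform. The bound `1 / 2` in the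
  -- radius keeps `z` away from `0`, and `1 - δ / 2` puts `z` within `δ` of its radial projection.
  set V := interior {y | y ∈ Metric.ball (0 : ℂ) 1 → W y ∈ Complex.slitPlane} with hV
  have hsub : Metric.sphere (0 : ℂ) 1 ⊆ V := fun z hz => mem_interior_iff_mem_nhds.2 (hloc z hz)
  obtain ⟨δ, hδ, hthick⟩ := (isCompact_sphere (0 : ℂ) 1).exists_thickening_subset_open
    isOpen_interior hsub
  refine ⟨max (1 / 2) (1 - δ / 2), by positivity, max_lt (by norm_num) (by linarith), ?_⟩
  intro z hz hz1
  have hz2 : 1 / 2 ≤ ‖z‖ := (le_max_left _ _).trans hz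
  have hz3 : 1 - δ / 2 ≤ ‖z‖ := (le_max_right _ _).trans hz
  have hz0 : ‖z‖ ≠ 0 := by linarith
  have hmem : z ∈ Metric.thickening δ (Metric.sphere (0 : ℂ) 1) := by
    rw [Metric.mem_thickening_iff]
    refine ⟨z / ‖z‖, ?_, ?_⟩
    · rw [mem_sphere_zero_iff_norm, norm_div, Complex.norm_real, norm_norm, div_self hz0]
    · have e : z - z / ‖z‖ = z * ((1 - 1 / ‖z‖ : ℝ) : ℂ) := by
        push_cast
        ring
      rw [dist_eq_norm, e, norm_mul, Complex.norm_real, Real.norm_eq_abs, ← abs_of_nonneg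
        (norm_nonneg z), ← abs_mul, abs_of_nonneg (norm_nonneg z), mul_sub, mul_one_div,
        div_self hz0, mul_one, abs_of_nonpos (by linarith)]
      linarith
  exact interior_subset (hthick hmem) (mem_ball_zero_iff.2 hz1)

theorem finite_zeros_den (hp : IsCapacityLaw c p) (hk : IsArrivalLaw lam ν k ρ)
    (hρ : ρ < meanCap c p) : {z : ℂ | ‖z‖ < 1 ∧ den c p lam ν z = 0}.Finite := by
  obtain ⟨r, hr0, hr1, hr⟩ := exists_radius hp hk hρ
  refine (finite_zeros hr1 (differentiableOn_den c p hk) (z₀ := 0) (by simp)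
    (den_zero_ne hp hk)).subset fun z hz => ⟨?_, hz.2⟩
  by_contra hcon
  rw [mem_closedBall_zero_iff, not_le] at hcon
  have := hr z hcon.le hz.1
  rw [hz.2, zero_div] at this
  exact Complex.zero_notMem_slitPlane this

lemma finsum_order_eq_sum {f : ℂ → ℂ} (hfin : {z : ℂ | ‖z‖ < 1 ∧ f z = 0}.Finite) :
    ∑ᶠ z ∈ Metric.ball (0 : ℂ) 1, analyticOrderNatAt f z =
      ∑ z ∈ hfin.toFinset, analyticOrderNatAt f z := by
  refine finsum_mem_eq_sum_of_inter_support_eq _ ?_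
  ext z
  simp only [Set.mem_inter_iff, mem_ball_zero_iff, Function.mem_support, ne_eq,
    Set.Finite.coe_toFinset]
  constructor
  · rintro ⟨hz, h2⟩
    exact ⟨⟨hz, apply_eq_zero_of_analyticOrderNatAt_ne_zero h2⟩, h2⟩
  · rintro ⟨hz, h2⟩
    exact ⟨hz.1, h2⟩

/-- The denominator has `c - 1` zeros inside the unit circle. -/
theorem finsum_order_den (hp : IsCapacityLaw c p) (hk : IsArrivalLaw lam ν k ρ)
    (hρ : ρ < meanCap c p) :
    ∑ᶠ z ∈ Metric.ball (0 : ℂ) 1, analyticOrderNatAt (den c p lam ν) z = c - 1 := by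
  obtain ⟨r, hr0, hr1, hr⟩ := exists_radius hp hk hρ
  set f := den c p lam ν with hf
  have hd : DifferentiableOn ℂ f (Metric.ball 0 1) := differentiableOn_den c p hk
  have hfin := finite_zeros_den hp hk hρ
  have hZr : ∀ z ∈ hfin.toFinset, z ∈ Metric.ball (0 : ℂ) r := by
    intro z hz
    rw [Set.Finite.mem_toFinset] at hz
    by_contra hcon
    rw [mem_ball_zero_iff, not_lt] at hcon
    have := hr z hcon hz.1
    rw [show f z = 0 from hz.2, zero_div] at this
    exact Complex.zero_notMem_slitPlane this
  rw [finsum_order_eq_sum hfin]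
  have h2 := circleIntegral_logDeriv_aux hr0 hr1 hfin.toFinset hZr _ f hd (fun z hz h0 => by
    rw [Set.Finite.mem_toFinset]
    exact ⟨(mem_closedBall_zero_iff.1 hz).trans_lt hr1, h0⟩) rfl
  set W : ℂ → ℂ := fun z => f z / ((z - 1) * z ^ (c - 1)) with hW
  have hsph : ∀ z ∈ Metric.sphere (0 : ℂ) r, z ≠ 0 ∧ z - 1 ≠ 0 ∧ f z ≠ 0 ∧
      W z ∈ Complex.slitPlane ∧ DifferentiableAt ℂ f z := by
    intro z hz
    have hz' := mem_sphere_zero_iff_norm.1 hz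
    have h3 := hr z hz'.ge (hz' ▸ hr1)
    refine ⟨fun h => ?_, fun h => ?_, fun h => ?_, h3, ?_⟩
    · rw [h, norm_zero] at hz'
      exact hr0.ne hz'
    · rw [sub_eq_zero.1 h, norm_one] at hz'
      exact hr1.ne' hz'
    · rw [h, zero_div] at h3
      exact Complex.zero_notMem_slitPlane h3
    · exact hd.differentiableAt (Metric.isOpen_ball.mem_nhds (mem_ball_zero_iff.2 (hz' ▸ hr1)))
  -- `Complex.log (W z)` is a primitive along the circle, since `W` avoids the branch cut. So `f`
  -- and `(z - 1) z ^ (c - 1)` have the same number of zeros in the disc, and the zero at `1` lies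
  -- outside it.
  have h3 : (∮ z in C(0, r), (deriv f z / f z - (z - 1)⁻¹ - (c - 1 : ℕ) * (z - 0)⁻¹)) = 0 := by
    refine circleIntegral.integral_eq_zero_of_hasDerivWithinAt (f := fun z => Complex.log (W z))
      hr0.le fun z hz => HasDerivAt.hasDerivWithinAt ?_
    obtain ⟨z0, z1, fz, hs, hdz⟩ := hsph z hz
    have hzc : z ^ (c - 1) ≠ 0 := pow_ne_zero _ z0
    have h4 : HasDerivAt W _ z := hdz.hasDerivAt.div
      (((hasDerivAt_id z).sub_const 1).mul (hasDerivAt_pow (c - 1) z)) (mul_ne_zero z1 hzc)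
    refine (h4.clog hs).congr_deriv ?_
    have h5 : (c - 1 : ℕ) * z ^ (c - 1 - 1) = (c - 1 : ℕ) * (z ^ (c - 1) / z) := by
      rcases Nat.eq_zero_or_pos (c - 1) with h6 | h6
      · simp [h6]
      · congr 1
        rw [eq_div_iff z0, ← pow_succ]
        congr 1
        omega
    simp only [id, sub_zero, h5, hW]
    field_simp
    ring
  have hcont : ∀ a : ℂ, (∀ z ∈ Metric.sphere (0 : ℂ) r, z - a ≠ 0) →
      CircleIntegrable (fun z => (z - a)⁻¹) 0 r := fun a ha =>
    ContinuousOn.circleIntegrable hr0.le (ContinuousOn.inv₀ (by fun_prop) ha)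
  have c1 : CircleIntegrable (fun z => deriv f z / f z) 0 r := by
    refine ContinuousOn.circleIntegrable hr0.le (ContinuousOn.div ?_ ?_ fun z hz => (hsph z hz).2.2.1)
    · refine fun z hz => ContinuousAt.continuousWithinAt ?_
      exact ((hd.analyticOnNhd Metric.isOpen_ball) z (Metric.closedBall_subset_ball hr1
        (Metric.sphere_subset_closedBall hz))).deriv.continuousAt
    · exact fun z hz => (hsph z hz).2.2.2.2.continuousAt.continuousWithinAt
  have c2 := hcont 1 fun z hz => (hsph z hz).2.1
  have c3 := hcont 0 fun z hz => by rw [sub_zero]; exact (hsph z hz).1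
  have h4 : (∮ z in C(0, r), (z - 1 : ℂ)⁻¹) = 0 := by
    have hne : ∀ z ∈ Metric.closedBall (0 : ℂ) r, z - 1 ≠ 0 := by
      intro z hz h
      rw [sub_eq_zero.1 h, mem_closedBall_zero_iff, norm_one] at hz
      linarith
    exact Complex.circleIntegral_eq_zero_of_differentiable_on_off_countable hr0.le
      Set.countable_empty (ContinuousOn.inv₀ (by fun_prop) hne) fun z hz =>
        DifferentiableAt.inv (by fun_prop) (hne z (Metric.ball_subset_closedBall hz.1))
  have h5 : (∮ z in C(0, r), ((c - 1 : ℕ) : ℂ) * (z - 0)⁻¹) =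
      (c - 1 : ℕ) * (2 * Real.pi * Complex.I) := by
    rw [circleIntegral.integral_const_mul, circleIntegral.integral_sub_inv_of_mem_ball]
    simpa using hr0
  have c4 : CircleIntegrable (fun z : ℂ => ((c - 1 : ℕ) : ℂ) * (z - 0)⁻¹) 0 r :=
    IntervalIntegrable.const_mul c3 _
  have h6 := circleIntegral.integral_sub (c1.sub c2) c4
  simp only [Pi.sub_apply] at h6
  rw [h6, circleIntegral.integral_sub c1 c2, h4, h5, h2,
    sub_zero, sub_eq_zero] at h3
  exact_mod_cast mul_right_cancel₀ Complex.two_pi_I_ne_zero h3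

end Den

end

section

/-! ### The numerator as a polynomial -/

/-- `num` as a polynomial. -/
def numPoly (c : ℕ) (p k : ℕ → ℝ) (x : ℕ → ℂ) : Polynomial ℂ :=
  ∑ i ∈ Finset.range (c + 1), Polynomial.C (p i : ℂ) *
    ∑ n ∈ Finset.range i, Polynomial.C (conv k x n) *
      (Polynomial.X ^ c - Polynomial.X ^ (c - i + n))

section NumPoly

variable (c : ℕ) (p k : ℕ → ℝ)

lemma num_eq_eval (x : ℕ → ℂ) : num c p k x = fun z => (numPoly c p k x).eval z := by
  ext z
  simp [num_eq, numPoly, Polynomial.eval_finsetSum]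

lemma conv_congr {x y : ℕ → ℂ} {n : ℕ} (h : ∀ j ≤ n, x j = y j) : conv k x n = conv k y n :=
  Finset.sum_congr rfl fun j hj => by rw [h j (by rw [Finset.mem_range] at hj; omega)]

lemma conv_add (x y : ℕ → ℂ) (n : ℕ) : conv k (x + y) n = conv k x n + conv k y n := by
  simp [conv, add_mul, Finset.sum_add_distrib]

lemma conv_smul (a : ℂ) (x : ℕ → ℂ) (n : ℕ) : conv k (a • x) n = a * conv k x n := by
  simp [conv, Finset.mul_sum, mul_assoc]

lemma numPoly_congr {x y : ℕ → ℂ} (h : ∀ j < c, x j = y j) : numPoly c p k x = numPoly c p k y := by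
  refine Finset.sum_congr rfl fun i hi => ?_
  congr 1
  refine Finset.sum_congr rfl fun n hn => ?_
  rw [Finset.mem_range] at hi hn
  rw [conv_congr k fun j hj => h j (by omega)]

/-- `numPoly` as a linear map. -/
def numLin : (ℕ → ℂ) →ₗ[ℂ] Polynomial ℂ where
  toFun := numPoly c p k
  map_add' x y := by
    simp only [numPoly, conv_add, map_add, add_mul, Finset.sum_add_distrib, mul_add]
  map_smul' a x := by
    simp only [numPoly, conv_smul, map_mul, RingHom.id_apply, Polynomial.smul_eq_C_mul,
      Finset.mul_sum]
    refine Finset.sum_congr rfl fun i _ => Finset.sum_congr rfl fun n _ => ?_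
    ring

lemma numLin_apply (x : ℕ → ℂ) : numLin c p k x = numPoly c p k x := rfl

lemma natDegree_numPoly_le (x : ℕ → ℂ) : (numPoly c p k x).natDegree ≤ c := by
  refine Polynomial.natDegree_sum_le_of_forall_le _ _ fun i hi => ?_
  refine Polynomial.natDegree_C_mul_le _ _ |>.trans ?_
  refine Polynomial.natDegree_sum_le_of_forall_le _ _ fun n hn => ?_
  rw [Finset.mem_range] at hi hn
  refine Polynomial.natDegree_C_mul_le _ _ |>.trans ?_
  refine (Polynomial.natDegree_sub_le _ _).trans ?_
  simp only [Polynomial.natDegree_X_pow]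
  omega

lemma eval_one_numPoly (x : ℕ → ℂ) : (numPoly c p k x).eval 1 = 0 := by
  simp [numPoly, Polynomial.eval_finsetSum]

/-- Triangularity of the map from unknowns to numerators. Since `l < c`, the degree `l` arises from
`c - i + n = l`; a capacity `i < c` forces `n < l`, where the convolution still vanishes. Only `i =
c`, `n = l` remains, so a zero numerator forces the unknowns to vanish one after the other. -/
lemma coeff_numPoly {x : ℕ → ℂ} {l : ℕ} (hl : l < c) (hx : ∀ j < l, x j = 0) :
    (numPoly c p k x).coeff l = -(p c * (x l * k 0)) := by
  have hconv : ∀ n < l, conv k x n = 0 := fun n hn =>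
    Finset.sum_eq_zero fun j hj => by
      rw [hx j (by rw [Finset.mem_range] at hj; omega), zero_mul]
  have hl' : conv k x l = x l * k 0 := by
    rw [conv, Finset.sum_range_succ, Finset.sum_eq_zero, zero_add, Nat.sub_self]
    intro j hj
    rw [hx j (Finset.mem_range.1 hj), zero_mul]
  simp only [numPoly, Polynomial.finsetSum_coeff, Polynomial.coeff_C_mul, Polynomial.coeff_sub,
    Polynomial.coeff_X_pow, if_neg hl.ne, zero_sub]
  rw [Finset.sum_eq_single c]
  · rw [Finset.sum_eq_single l]
    · rw [if_pos (by omega), hl']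
      ring
    · intro n _ hn
      rw [if_neg (by omega)]
      ring
    · intro h
      exact absurd (Finset.mem_range.2 hl) h
  · intro i hi hic
    rw [Finset.mem_range] at hi
    rw [Finset.sum_eq_zero, mul_zero]
    intro n hn
    rw [Finset.mem_range] at hn
    split_ifs with h
    · rw [hconv n (by omega), zero_mul]
    · simp
  · simp

lemma eq_zero_of_numPoly_eq_zero (hpc : p c ≠ 0) (hk : k 0 ≠ 0) {x : ℕ → ℂ}
    (h : numPoly c p k x = 0) : ∀ j < c, x j = 0 := by
  intro j
  induction j using Nat.strong_induction_on with
  | _ j ih =>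
    intro hj
    have h1 := coeff_numPoly c p k hj fun i hi => ih i hi (hi.trans hj)
    rw [h, Polynomial.coeff_zero, eq_comm, neg_eq_zero] at h1
    have h2 : (p c : ℂ) ≠ 0 := by exact_mod_cast hpc
    have h3 : (k 0 : ℂ) ≠ 0 := by exact_mod_cast hk
    simpa [h2, h3] using h1

lemma iteratedDeriv_num (x : ℕ → ℂ) (n : ℕ) (z : ℂ) :
    iteratedDeriv n (num c p k x) z = (Polynomial.derivative^[n] (numLin c p k x)).eval z := by
  rw [num_eq_eval, numLin_apply]
  induction n generalizing z with
  | zero => simp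
  | succ n ih =>
    rw [iteratedDeriv_succ, funext ih, Polynomial.deriv, Function.iterate_succ_apply']

lemma deriv_num (x : ℕ → ℂ) (z : ℂ) :
    deriv (num c p k x) z = (Polynomial.derivative (numLin c p k x)).eval z := by
  rw [num_eq_eval, numLin_apply, Polynomial.deriv]

end NumPoly

lemma sum_rootMultiplicity_le {f : Polynomial ℂ} (s : Finset ℂ) :
    ∑ z ∈ s, f.rootMultiplicity z ≤ f.natDegree := by
  classical
  calc ∑ z ∈ s, f.rootMultiplicity z ≤ ∑ z ∈ s ∪ f.roots.toFinset, f.roots.count z := by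
        simp_rw [Polynomial.count_roots]
        exact Finset.sum_le_sum_of_subset Finset.subset_union_left
    _ = f.roots.card := Multiset.sum_count_eq_card fun a ha => by simp [Multiset.mem_toFinset.2 ha]
    _ ≤ f.natDegree := f.card_roots'

/-! ### Boundary equations: the zeros of the denominator and the normalization determine the
unknowns -/

section Char

variable {c : ℕ} {p : ℕ → ℝ} {lam ρ : ℝ} {ν : Measure ℝ} {k : ℕ → ℝ}

/-- The numerator with unknowns `x` vanishes at the zeros of the denominator inside the unit
circle, with multiplicity. -/
def VanishesAtZeros (c : ℕ) (p k : ℕ → ℝ) (lam : ℝ) (ν : Measure ℝ) (x : ℕ → ℂ) : Prop :=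
  ∀ z : ℂ, ‖z‖ < 1 → ∀ n < analyticOrderNatAt (den c p lam ν) z, iteratedDeriv n (num c p k x) z = 0

lemma VanishesAtZeros.sub {x y : ℕ → ℂ} (hx : VanishesAtZeros c p k lam ν x)
    (hy : VanishesAtZeros c p k lam ν y) : VanishesAtZeros c p k lam ν (x - y) := by
  intro z hz n hn
  have h1 := hx z hz n hn
  have h2 := hy z hz n hn
  rw [iteratedDeriv_num] at h1 h2 ⊢
  rw [map_sub, Polynomial.iterate_derivative_sub, Polynomial.eval_sub, h1, h2, sub_zero]

lemma deriv_num_sub (x y : ℕ → ℂ) (z : ℂ) :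
    deriv (num c p k (x - y)) z = deriv (num c p k x) z - deriv (num c p k y) z := by
  simp only [deriv_num, map_sub, Polynomial.eval_sub]

lemma VanishesAtZeros.congr {x y : ℕ → ℂ} (h : ∀ j < c, x j = y j)
    (hx : VanishesAtZeros c p k lam ν x) : VanishesAtZeros c p k lam ν y := by
  have : num c p k y = num c p k x := by
    rw [num_eq_eval, num_eq_eval, numPoly_congr c p k h]
  intro z hz n hn
  rw [this]
  exact hx z hz n hn

/-- The boundary equations have only the trivial homogeneous solution. -/
theorem VanishesAtZeros.eq_zero (hp : IsCapacityLaw c p) (hk : IsArrivalLaw lam ν k ρ)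
    (hρ : ρ < meanCap c p) {x : ℕ → ℂ} (hx : VanishesAtZeros c p k lam ν x)
    (h1 : deriv (num c p k x) 1 = 0) : ∀ j < c, x j = 0 := by
  classical
  refine eq_zero_of_numPoly_eq_zero c p k hp.top_pos.ne' hk.zero_pos.ne' ?_
  by_contra hne
  have hc := hp.pos
  have hfin := finite_zeros_den hp hk hρ
  have hsum := finsum_order_den hp hk hρ
  rw [finsum_order_eq_sum hfin] at hsum
  have hnot : (1 : ℂ) ∉ hfin.toFinset := by simp
  -- Counting roots: `c - 1` inside with multiplicity and at least two at `1` would exceed the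
  -- degree bound `c`.
  have h2 := sum_rootMultiplicity_le (f := numPoly c p k x) (insert 1 hfin.toFinset)
  rw [Finset.sum_insert hnot] at h2
  have h3 : 1 < (numPoly c p k x).rootMultiplicity 1 := by
    rw [Polynomial.one_lt_rootMultiplicity_iff_isRoot hne]
    rw [deriv_num] at h1
    exact ⟨eval_one_numPoly c p k x, h1⟩
  have h4 : ∑ z ∈ hfin.toFinset, analyticOrderNatAt (den c p lam ν) z ≤
      ∑ z ∈ hfin.toFinset, (numPoly c p k x).rootMultiplicity z := by
    refine Finset.sum_le_sum fun z hz => ?_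
    rw [Set.Finite.mem_toFinset] at hz
    rcases Nat.eq_zero_or_pos (analyticOrderNatAt (den c p lam ν) z) with h0 | h0
    · omega
    · have : analyticOrderNatAt (den c p lam ν) z - 1 < (numPoly c p k x).rootMultiplicity z := by
        rw [Polynomial.lt_rootMultiplicity_iff_isRoot_iterate_derivative hne]
        intro m hm
        have := hx z hz.1 m (by omega)
        rwa [iteratedDeriv_num] at this
      omega
  have h5 := natDegree_numPoly_le c p k x
  omega

instance neBot_nhdsWithin_ball_one : (𝓝[Metric.ball (0 : ℂ) 1] 1).NeBot := by
  rw [← mem_closure_iff_nhdsWithin_neBot, closure_ball (0 : ℂ) one_ne_zero]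
  simp

lemma tendsto_den_slope (hp : IsCapacityLaw c p) (hk : IsArrivalLaw lam ν k ρ) :
    Tendsto (fun z => den c p lam ν z / (z - 1)) (𝓝[Metric.ball 0 1] 1)
      (𝓝 ((meanCap c p - ρ : ℝ) : ℂ)) := by
  have h1 := (hasDerivWithinAt_den hp hk).mono Metric.ball_subset_closedBall
  rw [hasDerivWithinAt_iff_tendsto_slope] at h1
  have hnot : (1 : ℂ) ∉ Metric.ball (0 : ℂ) 1 := by simp
  rw [Set.sdiff_singleton_eq_self hnot] at h1
  refine h1.congr fun y => ?_
  rw [slope_def_field, den_one hp hk, sub_zero]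

lemma tendsto_num_slope (c : ℕ) (p k : ℕ → ℝ) (x : ℕ → ℂ) :
    Tendsto (fun z => num c p k x z / (z - 1)) (𝓝[Metric.ball 0 1] 1)
      (𝓝 (deriv (num c p k x) 1)) := by
  have h0 : num c p k x 1 = 0 := by rw [num_eq_eval]; exact eval_one_numPoly c p k x
  have h1 : HasDerivAt (num c p k x) (deriv (num c p k x) 1) 1 := by
    rw [hasDerivAt_deriv_iff, num_eq_eval]
    exact (numPoly c p k x).differentiableAt
  have h2 := h1.hasDerivWithinAt (s := Metric.ball 0 1)
  rw [hasDerivWithinAt_iff_tendsto_slope] at h2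
  have hnot : (1 : ℂ) ∉ Metric.ball (0 : ℂ) 1 := by simp
  rw [Set.sdiff_singleton_eq_self hnot] at h2
  refine h2.congr fun y => ?_
  rw [slope_def_field, h0, sub_zero]

lemma tendsto_num_div_den (hp : IsCapacityLaw c p) (hk : IsArrivalLaw lam ν k ρ)
    (hρ : ρ < meanCap c p) (x : ℕ → ℂ) :
    Tendsto (fun z => num c p k x z / den c p lam ν z) (𝓝[Metric.ball 0 1] 1)
      (𝓝 (deriv (num c p k x) 1 / ((meanCap c p - ρ : ℝ) : ℂ))) := by
  have hne : ((meanCap c p - ρ : ℝ) : ℂ) ≠ 0 := by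
    exact_mod_cast (sub_pos.2 hρ).ne'
  refine ((tendsto_num_slope c p k x).div (tendsto_den_slope hp hk) hne).congr' ?_
  filter_upwards [self_mem_nhdsWithin] with z hz
  have : z - 1 ≠ 0 := by
    intro h
    rw [sub_eq_zero.1 h, mem_ball_zero_iff, norm_one] at hz
    exact lt_irrefl _ hz
  simp only [Pi.div_apply]
  rw [div_div_div_cancel_right₀ this]

/-- Numerator and denominator both vanish at `1`, so the limit of the quotient is the quotient of
the derivatives. This makes the normalization a linear equation in the unknowns. -/
lemma tendsto_num_div_den_one_iff (hp : IsCapacityLaw c p) (hk : IsArrivalLaw lam ν k ρ)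
    (hρ : ρ < meanCap c p) (x : ℕ → ℂ) :
    Tendsto (fun z => num c p k x z / den c p lam ν z) (𝓝[Metric.ball 0 1] 1) (𝓝 1) ↔
      deriv (num c p k x) 1 = ((meanCap c p - ρ : ℝ) : ℂ) := by
  have hne : ((meanCap c p - ρ : ℝ) : ℂ) ≠ 0 := by
    exact_mod_cast (sub_pos.2 hρ).ne'
  have h := tendsto_num_div_den hp hk hρ x
  constructor
  · intro h1
    exact (div_eq_one_iff_eq hne).1 (tendsto_nhds_unique h h1)
  · intro h1
    rwa [h1, div_self hne] at h

lemma IsStationary.den_mul_pgf {π : ℕ → ℝ} (hπ : IsStationary (trans c p k) π)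
    (hk : IsArrivalLaw lam ν k ρ) {z : ℂ} (hz : ‖z‖ ≤ 1) :
    den c p lam ν z * pgf π z = num c p k (fun j => (π j : ℂ)) z :=
  HetPRGS.den_mul_pgf hk.hasSum_K hk.nonneg hk.hasSum_one.summable hπ hz

/-- A stationary law solves the boundary equations. -/
theorem IsStationary.vanishesAtZeros {π : ℕ → ℝ} (hπ : IsStationary (trans c p k) π)
    (hp : IsCapacityLaw c p) (hk : IsArrivalLaw lam ν k ρ) :
    VanishesAtZeros c p k lam ν fun j => (π j : ℂ) := by
  intro z hz n hn
  have hz' : z ∈ Metric.ball (0 : ℂ) 1 := mem_ball_zero_iff.2 hz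
  have hden : AnalyticAt ℂ (den c p lam ν) z :=
    (differentiableOn_den c p hk).analyticAt (Metric.isOpen_ball.mem_nhds hz')
  have hpgf : AnalyticAt ℂ (pgf π) z :=
    (differentiableOn_pgf hπ.nonneg hπ.hasSum_one.summable).analyticAt
      (Metric.isOpen_ball.mem_nhds hz')
  have heq : den c p lam ν * pgf π =ᶠ[𝓝 z] num c p k (fun j => (π j : ℂ)) := by
    filter_upwards [Metric.isOpen_ball.mem_nhds hz'] with y hy
    exact hπ.den_mul_pgf hk (mem_ball_zero_iff.1 hy).le
  have hnum : AnalyticAt ℂ (num c p k (fun j => (π j : ℂ))) z := (hden.mul hpgf).congr heq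
  have htop : analyticOrderAt (den c p lam ν) z ≠ ⊤ :=
    order_ne_top (differentiableOn_den c p hk) (z₀ := 0) (by simp) (den_zero_ne hp hk) hz'
  -- Near `z` the numerator is `den * pgf`, and orders add, so its order is at least that of `den`.
  refine (natCast_le_analyticOrderAt_iff_iteratedDeriv_eq_zero
    (n := analyticOrderNatAt (den c p lam ν) z) hnum).1 ?_ n hn
  rw [← analyticOrderAt_congr heq, analyticOrderAt_mul hden hpgf, Nat.cast_analyticOrderNatAt htop]
  exact le_self_add

theorem IsStationary.deriv_num_one {π : ℕ → ℝ} (hπ : IsStationary (trans c p k) π)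
    (hp : IsCapacityLaw c p) (hk : IsArrivalLaw lam ν k ρ) :
    deriv (num c p k fun j => (π j : ℂ)) 1 = ((meanCap c p - ρ : ℝ) : ℂ) := by
  have h1 : Tendsto (pgf π) (𝓝[Metric.ball 0 1] 1) (𝓝 1) := by
    have := (continuousOn_pgf hπ.nonneg hπ.hasSum_one.summable) 1 (by simp)
    rw [ContinuousWithinAt, pgf_one hπ.hasSum_one] at this
    exact this.mono_left (nhdsWithin_mono _ Metric.ball_subset_closedBall)
  have h2 := (tendsto_den_slope hp hk).mul h1
  rw [mul_one] at h2
  refine tendsto_nhds_unique (tendsto_num_slope c p k _) (h2.congr' ?_)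
  filter_upwards [self_mem_nhdsWithin] with z hz
  rw [← hπ.den_mul_pgf hk (mem_ball_zero_iff.1 hz).le]
  ring

theorem IsStationary.boundary_iff {π : ℕ → ℝ} (hπ : IsStationary (trans c p k) π)
    (hp : IsCapacityLaw c p) (hk : IsArrivalLaw lam ν k ρ) (hρ : ρ < meanCap c p) (x : ℕ → ℂ) :
    (VanishesAtZeros c p k lam ν x ∧
      Tendsto (fun z => num c p k x z / den c p lam ν z) (𝓝[Metric.ball 0 1] 1) (𝓝 1)) ↔
    ∀ j < c, x j = (π j : ℂ) := by
  have h1 := hπ.vanishesAtZeros hp hk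
  have h2 := hπ.deriv_num_one hp hk
  rw [tendsto_num_div_den_one_iff hp hk hρ]
  constructor
  · rintro ⟨h3, h4⟩ j hj
    have := (h3.sub h1).eq_zero hp hk hρ (by rw [deriv_num_sub, h2, h4, sub_self]) j hj
    exact sub_eq_zero.1 this
  · intro h
    refine ⟨h1.congr fun j hj => (h j hj).symm, ?_⟩
    rw [← h2, deriv_num, deriv_num, numLin_apply, numLin_apply, numPoly_congr c p k h]

/-- The boundary equations fix the first `c` values. Afterwards the balance equation at state `n -
c` contains `π n` with coefficient `p c * k 0 ≠ 0` and otherwise only smaller indices. -/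
theorem IsStationary.unique {π π' : ℕ → ℝ} (hπ : IsStationary (trans c p k) π)
    (hπ' : IsStationary (trans c p k) π') (hp : IsCapacityLaw c p) (hk : IsArrivalLaw lam ν k ρ)
    (hρ : ρ < meanCap c p) : π' = π := by
  have h1 : ∀ j < c, (π' j : ℂ) = π j :=
    (hπ.boundary_iff hp hk hρ _).1 ((hπ'.boundary_iff hp hk hρ _).2 fun j _ => rfl)
  have h2 : (p c : ℂ) ≠ 0 := by exact_mod_cast hp.top_pos.ne'
  have h3 : (k 0 : ℂ) ≠ 0 := by exact_mod_cast hk.zero_pos.ne'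
  have key : ∀ n, (π' n : ℂ) = π n := by
    intro n
    induction n using Nat.strong_induction_on with
    | _ n ih =>
      rcases lt_or_ge n c with hn | hn
      · exact h1 n hn
      · have hlt : ∀ m < n, conv k (fun j => (π' j : ℂ)) m = conv k (fun j => (π j : ℂ)) m :=
          fun m hm => conv_congr k fun j hj => ih j (by omega)
        have hn' : conv k (fun j => (π' j : ℂ)) n = conv k (fun j => (π j : ℂ)) n := by
          -- For `n = c` the relevant equation is the one at state `0`, which has a different form
          -- because it collects all emptying transitions.
          rcases Nat.eq_zero_or_pos (n - c) with h0 | h0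
          · have hnc : n = c := by omega
            have e1 := stationary_zero hπ
            have e2 := stationary_zero hπ'
            rw [ih 0 (by have := hp.pos; omega), e1, Finset.sum_range_succ, Finset.sum_range_succ,
              Finset.sum_range_succ _ c, Finset.sum_range_succ _ c] at e2
            subst hnc
            rw [Finset.sum_congr rfl fun i hi => by
                rw [Finset.sum_congr rfl fun m hm => (hlt m (by
                  rw [Finset.mem_range] at hi hm; omega)).symm],
              Finset.sum_congr rfl fun m hm => (hlt m (Finset.mem_range.1 hm)).symm] at e2
            have e3 := mul_left_cancel₀ h2 (add_left_cancel e2)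
            exact (add_left_cancel e3).symm
          · have e1 := stationary_of_ne_zero hπ h0.ne'
            have e2 := stationary_of_ne_zero hπ' h0.ne'
            rw [ih (n - c) (by have := hp.pos; omega), e1, Finset.sum_range_succ,
              Finset.sum_range_succ, Finset.sum_congr rfl fun i hi => by
                rw [← hlt (i + (n - c)) (by rw [Finset.mem_range] at hi; omega)]] at e2
            have e3 := mul_left_cancel₀ h2 (add_left_cancel e2)
            rw [show c + (n - c) = n by omega] at e3
            exact e3.symm
        rw [conv, conv, Finset.sum_range_succ, Finset.sum_range_succ,
          Finset.sum_congr rfl fun j hj => by rw [ih j (Finset.mem_range.1 hj)]] at hn'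
        have := add_left_cancel hn'
        rw [Nat.sub_self] at this
        exact mul_right_cancel₀ h3 this
  ext n
  exact_mod_cast key n

/-- If the zeros are simple, the boundary equations are linearly independent. -/
theorem linearIndependent_boundary (hp : IsCapacityLaw c p) (hk : IsArrivalLaw lam ν k ρ)
    (hρ : ρ < meanCap c p) (ξ : Fin (c - 1) → ℂ) (hinj : Function.Injective ξ)
    (hξ : Set.range ξ = {z : ℂ | ‖z‖ < 1 ∧ den c p lam ν z = 0}) :
    LinearIndependent ℂ (fun (q : Option (Fin (c - 1))) (j : Fin c) =>
      q.elim (deriv (num c p k (Pi.single (j : ℕ) 1)) 1)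
        (fun a => num c p k (Pi.single (j : ℕ) 1) (ξ a))) := by
  classical
  have hc := hp.pos
  set F : Option (Fin (c - 1)) → Fin c → ℂ := fun q j =>
      q.elim (deriv (num c p k (Pi.single (j : ℕ) 1)) 1)
        (fun a => num c p k (Pi.single (j : ℕ) 1) (ξ a)) with hF
  have hfin := finite_zeros_den hp hk hρ
  have hsum := finsum_order_den hp hk hρ
  rw [finsum_order_eq_sum hfin] at hsum
  have hcard : hfin.toFinset.card = c - 1 := by
    have h1 : hfin.toFinset = Finset.univ.image ξ := by
      ext z
      rw [Set.Finite.mem_toFinset, ← hξ]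
      simp
    rw [h1, Finset.card_image_of_injective _ hinj, Finset.card_univ, Fintype.card_fin]
  have hpos : ∀ z ∈ hfin.toFinset, 1 ≤ analyticOrderNatAt (den c p lam ν) z := by
    intro z hz
    rw [Set.Finite.mem_toFinset] at hz
    have hz' : z ∈ Metric.ball (0 : ℂ) 1 := mem_ball_zero_iff.2 hz.1
    have hden : AnalyticAt ℂ (den c p lam ν) z :=
      (differentiableOn_den c p hk).analyticAt (Metric.isOpen_ball.mem_nhds hz')
    have htop : analyticOrderAt (den c p lam ν) z ≠ ⊤ :=
      order_ne_top (differentiableOn_den c p hk) (z₀ := 0) (by simp) (den_zero_ne hp hk) hz'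
    have h0 : analyticOrderAt (den c p lam ν) z ≠ 0 := by
      rw [Ne, hden.analyticOrderAt_eq_zero, not_not]
      exact hz.2
    rw [← Nat.cast_analyticOrderNatAt htop] at h0
    exact Nat.one_le_iff_ne_zero.2 (by exact_mod_cast h0)
  -- There are `c - 1` points with orders at least `1` and total `c - 1`, so every zero is simple.
  have hone : ∀ z ∈ hfin.toFinset, 1 = analyticOrderNatAt (den c p lam ν) z := by
    rw [← Finset.sum_eq_sum_iff_of_le hpos, hsum]
    simp [hcard]
  have key : ∀ v : Fin c → ℂ, (∀ q, ∑ j, F q j * v j = 0) → v = 0 := by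
    intro v hv
    set y : ℕ → ℂ := ∑ j : Fin c, v j • Pi.single (j : ℕ) (1 : ℂ) with hy
    have hyj : ∀ j : Fin c, y j = v j := by
      intro j
      rw [hy, Finset.sum_apply, Finset.sum_eq_single j]
      · simp
      · intro b _ hb
        simp [Fin.val_inj, hb.symm]
      · simp
    have h1 : deriv (num c p k y) 1 = 0 := by
      rw [← hv none, deriv_num, hy, map_sum, Polynomial.derivative_sum, Polynomial.eval_finsetSum]
      refine Finset.sum_congr rfl fun j _ => ?_
      rw [map_smul, Polynomial.derivative_smul, Polynomial.eval_smul, ← deriv_num, smul_eq_mul,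
        mul_comm]
      rfl
    have h2 : ∀ a, num c p k y (ξ a) = 0 := by
      intro a
      rw [← hv (some a)]
      simp only [hF, Option.elim, num_eq_eval, ← numLin_apply]
      rw [hy, map_sum, Polynomial.eval_finsetSum]
      refine Finset.sum_congr rfl fun j _ => ?_
      rw [map_smul, Polynomial.eval_smul, smul_eq_mul, mul_comm]
    have h3 : VanishesAtZeros c p k lam ν y := by
      intro z hz n hn
      have h4 : den c p lam ν z = 0 := apply_eq_zero_of_analyticOrderNatAt_ne_zero (by omega)
      have h5 : z ∈ hfin.toFinset := by rw [Set.Finite.mem_toFinset]; exact ⟨hz, h4⟩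
      rw [← hone z h5] at hn
      obtain rfl : n = 0 := by omega
      obtain ⟨a, rfl⟩ : z ∈ Set.range ξ := by rw [hξ]; exact ⟨hz, h4⟩
      rw [iteratedDeriv_zero]
      exact h2 a
    ext j
    rw [← hyj j]
    exact h3.eq_zero hp hk hρ h1 j j.2
  obtain ⟨e⟩ : Nonempty (Fin c ≃ Option (Fin (c - 1))) := by
    refine ⟨Fintype.equivOfCardEq ?_⟩
    simp
    omega
  rw [← linearIndependent_equiv e]
  -- The system is square, so trivial kernel is equivalent to independence of its rows.
  have h6 : Function.Injective (Matrix.of (F ∘ e)).mulVec := by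
    intro v w hvw
    rw [← sub_eq_zero]
    refine key _ fun q => ?_
    have := congrFun hvw (e.symm q)
    simp only [Matrix.mulVec, dotProduct, Matrix.of_apply, Function.comp_apply,
      Equiv.apply_symm_apply] at this
    simp only [Pi.sub_apply, mul_sub, Finset.sum_sub_distrib, this, sub_self]
  exact Matrix.linearIndependent_rows_iff_isUnit.2 (Matrix.mulVec_injective_iff_isUnit.1 h6)

end Char

end

section

/-! ### Poisson weights -/

/-- Poisson weights. -/
def poissonWeight (y : ℝ) (v : ℕ) : ℝ := Real.exp (-y) * y ^ v / (v.factorial : ℝ)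

lemma poissonWeight_nonneg {y : ℝ} (hy : 0 ≤ y) (v : ℕ) : 0 ≤ poissonWeight y v := by
  unfold poissonWeight
  positivity

lemma hasSum_poissonWeight_mul_pow (y : ℝ) (z : ℂ) :
    HasSum (fun v => (poissonWeight y v : ℂ) * z ^ v) (Complex.exp (-(y * (1 - z)))) := by
  have h1 := NormedSpace.expSeries_div_hasSum_exp ((y : ℂ) * z)
  rw [← Complex.exp_eq_exp_ℂ] at h1
  have h2 := h1.mul_left (Complex.exp (-(y : ℂ)))
  rw [← Complex.exp_add] at h2
  convert! h2 using 1
  · ext v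
    simp only [poissonWeight]
    push_cast
    rw [mul_pow]
    ring
  · congr 1
    ring

lemma hasSum_poissonWeight (y : ℝ) : HasSum (poissonWeight y) 1 := by
  have h := hasSum_poissonWeight_mul_pow y 1
  simp only [one_pow, mul_one, sub_self, mul_zero, neg_zero, Complex.exp_zero] at h
  exact Complex.hasSum_ofReal.1 (by simpa using h)

lemma hasSum_mul_poissonWeight (y : ℝ) : HasSum (fun v : ℕ => (v : ℝ) * poissonWeight y v) y := by
  rw [← hasSum_nat_add_iff' 1]
  have h1 := (hasSum_poissonWeight y).mul_left y
  rw [mul_one] at h1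
  simp only [Finset.range_one, Finset.sum_singleton, Nat.cast_zero, zero_mul, sub_zero]
  refine h1.congr_fun fun v => ?_
  simp only [poissonWeight, Nat.factorial_succ]
  have : ((v.factorial : ℕ) : ℝ) ≠ 0 := by exact_mod_cast v.factorial_ne_zero
  push_cast
  field_simp
  ring

lemma hasSum_sq_mul_poissonWeight (y : ℝ) :
    HasSum (fun v : ℕ => (v : ℝ) ^ 2 * poissonWeight y v) (y + y ^ 2) := by
  rw [← hasSum_nat_add_iff' 1]
  have h1 := ((hasSum_mul_poissonWeight y).add (hasSum_poissonWeight y)).mul_left y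
  simp only [Finset.range_one, Finset.sum_singleton, Nat.cast_zero]
  rw [show y + y ^ 2 - 0 ^ 2 * poissonWeight y 0 = y * (y + 1) by ring]
  refine h1.congr_fun fun v => ?_
  simp only [poissonWeight, Nat.factorial_succ]
  have : ((v.factorial : ℕ) : ℝ) ≠ 0 := by exact_mod_cast v.factorial_ne_zero
  push_cast
  field_simp
  ring

lemma measurable_poissonWeight (v : ℕ) : Measurable fun y => poissonWeight y v := by
  unfold poissonWeight
  fun_prop

lemma lintegral_gapLaw_of_nonneg {lam x : ℝ} (h : 0 ≤ lam * x) (f : ℕ → ℝ≥0∞) :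
    ∫⁻ v, f v ∂gapLaw lam x = ∑' v, f v * ENNReal.ofReal (poissonWeight (lam * x) v) := by
  rw [lintegral_gapLaw, Real.coe_toNNReal _ h]
  rfl

lemma lintegral_gapLaw_ofReal {lam x : ℝ} (h : 0 ≤ lam * x) {f : ℕ → ℝ} (hf : ∀ v, 0 ≤ f v) {a : ℝ}
    (ha : HasSum (fun v => f v * poissonWeight (lam * x) v) a) :
    ∫⁻ v, ENNReal.ofReal (f v) ∂gapLaw lam x = ENNReal.ofReal a := by
  rw [lintegral_gapLaw_of_nonneg h, ← ha.tsum_eq, ENNReal.ofReal_tsum_of_nonneg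
    (fun v => mul_nonneg (hf v) (poissonWeight_nonneg h v)) ha.summable]
  exact tsum_congr fun v => (ENNReal.ofReal_mul (hf v)).symm

lemma kProb_eq (lam : ℝ) (ν : Measure ℝ) (v : ℕ) :
    kProb lam ν v = ∫ x, poissonWeight (lam * x) v ∂ν := rfl

/-! ### The law of the number of arrivals -/

section Law

variable {lam : ℝ} {ν : Measure ℝ} [IsProbabilityMeasure ν]

lemma ae_nonneg_of_measure_Iio (hν : ν (Set.Iio 0) = 0) : ∀ᵐ x ∂ν, 0 ≤ x := by
  rw [ae_iff]
  convert! hν using 2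
  ext x
  simp

variable (hlam : 0 < lam) (hν : ν (Set.Iio 0) = 0)

include hlam hν

lemma integrable_poissonWeight (v : ℕ) : Integrable (fun x => poissonWeight (lam * x) v) ν := by
  refine Integrable.of_bound (C := 1) ((measurable_poissonWeight v).comp
    (measurable_const_mul lam)).aestronglyMeasurable ?_
  filter_upwards [ae_nonneg_of_measure_Iio hν] with x hx
  have h0 := poissonWeight_nonneg (mul_nonneg hlam.le hx)
  rw [Real.norm_of_nonneg (h0 v)]
  exact le_hasSum (hasSum_poissonWeight _) v fun w _ => h0 w

lemma hasSum_kProb_mul_pow {z : ℂ} (hz : ‖z‖ ≤ 1) :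
    HasSum (fun v => (kProb lam ν v : ℂ) * z ^ v) (K lam ν z) := by
  have h := hasSum_integral_of_dominated_convergence (μ := ν)
    (F := fun v x => (poissonWeight (lam * x) v : ℂ) * z ^ v)
    (f := fun x : ℝ => Complex.exp (-((lam : ℂ) * (1 - z) * x)))
    (fun v x => poissonWeight (lam * x) v) ?_ ?_ ?_ ?_ ?_
  · convert! h using 2 with v
    rw [integral_mul_const, kProb_eq, integral_complex_ofReal]
  · intro v
    exact ((Complex.measurable_ofReal.comp ((measurable_poissonWeight v).comp
      (measurable_const_mul lam))).mul_const _).aestronglyMeasurable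
  · intro v
    filter_upwards [ae_nonneg_of_measure_Iio hν] with x hx
    have h0 := poissonWeight_nonneg (mul_nonneg hlam.le hx) v
    rw [norm_mul, norm_pow, Complex.norm_real, Real.norm_of_nonneg h0]
    exact mul_le_of_le_one_right h0 (pow_le_one₀ (norm_nonneg z) hz)
  · exact ae_of_all _ fun x => (hasSum_poissonWeight _).summable
  · simp_rw [(hasSum_poissonWeight _).tsum_eq]
    exact integrable_const 1
  · refine ae_of_all _ fun x => ?_
    have := hasSum_poissonWeight_mul_pow (lam * x) z
    push_cast at this ⊢
    convert! this using 2
    ring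

lemma hasSum_mul_kProb (hint : Integrable (fun x => x) ν) :
    HasSum (fun v : ℕ => (v : ℝ) * kProb lam ν v) (lam * ∫ x, x ∂ν) := by
  have h := hasSum_integral_of_dominated_convergence (μ := ν)
    (F := fun (v : ℕ) x => (v : ℝ) * poissonWeight (lam * x) v)
    (f := fun x : ℝ => lam * x)
    (fun v x => (v : ℝ) * poissonWeight (lam * x) v) ?_ ?_ ?_ ?_ ?_
  · simp_rw [integral_const_mul] at h
    rwa [integral_const_mul] at h
  · intro v
    exact (((measurable_poissonWeight v).comp
      (measurable_const_mul lam)).const_mul _).aestronglyMeasurable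
  · intro v
    filter_upwards [ae_nonneg_of_measure_Iio hν] with x hx
    have h0 := poissonWeight_nonneg (mul_nonneg hlam.le hx) v
    rw [Real.norm_of_nonneg (by positivity)]
  · exact ae_of_all _ fun x => (hasSum_mul_poissonWeight _).summable
  · simp_rw [(hasSum_mul_poissonWeight _).tsum_eq]
    exact hint.const_mul lam
  · exact ae_of_all _ fun x => hasSum_mul_poissonWeight _

lemma kProb_nonneg (v : ℕ) : 0 ≤ kProb lam ν v := by
  rw [kProb_eq]
  refine integral_nonneg_of_ae ?_
  filter_upwards [ae_nonneg_of_measure_Iio hν] with x hx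
  exact poissonWeight_nonneg (mul_nonneg hlam.le hx) v

/-- A positive mean means that the gap is not almost surely `0`, and on a positive gap every Poisson
weight is positive. Positivity of both `k 0` and `k 1` drives the strict inequality on the unit
circle. -/
lemma kProb_pos (hpos : 0 < ∫ x, x ∂ν) (v : ℕ) : 0 < kProb lam ν v := by
  refine lt_of_le_of_ne (kProb_nonneg hlam hν v) fun h0 => ?_
  rw [kProb_eq, eq_comm, integral_eq_zero_iff_of_nonneg_ae] at h0
  · have : ∀ᵐ x ∂ν, x = 0 := by
      filter_upwards [h0, ae_nonneg_of_measure_Iio hν] with x hx hx0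
      by_contra hne
      have hx1 : 0 < lam * x := mul_pos hlam (lt_of_le_of_ne hx0 (Ne.symm hne))
      have : 0 < poissonWeight (lam * x) v := by unfold poissonWeight; positivity
      exact this.ne' hx
    rw [integral_congr_ae this, integral_zero] at hpos
    exact lt_irrefl _ hpos
  · filter_upwards [ae_nonneg_of_measure_Iio hν] with x hx
    exact poissonWeight_nonneg (mul_nonneg hlam.le hx) v
  · exact integrable_poissonWeight hlam hν v

theorem isArrivalLaw_kProb (hint : Integrable (fun x => x) ν) (hpos : 0 < ∫ x, x ∂ν) :
    IsArrivalLaw lam ν (kProb lam ν) (lam * ∫ x, x ∂ν) where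
  nonneg := kProb_nonneg hlam hν
  hasSum_one := by
    have h := hasSum_kProb_mul_pow hlam hν (z := 1) (by simp)
    simp only [one_pow, mul_one, K, lst, sub_self, mul_zero, zero_mul, neg_zero, Complex.exp_zero,
      integral_const, probReal_univ, one_smul] at h
    exact Complex.hasSum_ofReal.1 (by simpa using h)
  zero_pos := kProb_pos hlam hν hpos 0
  one_pos := kProb_pos hlam hν hpos 1
  hasSum_mean := hasSum_mul_kProb hlam hν hint
  hasSum_K _ := hasSum_kProb_mul_pow hlam hν

end Law

/-! ### The network as a queue -/

/-- Locations and capacities for which the Move To Right policy is well behaved. -/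
structure IsRegularPath (r x : ℕ → ℝ) (C : ℕ → ℕ) : Prop where
  pos : 0 < r 0
  mono : Monotone r
  tendsto_req : Tendsto r atTop atTop
  dist_nonneg : ∀ j, 0 ≤ x j
  tendsto_grid : Tendsto (grid x) atTop atTop
  cap_pos : ∀ j, 1 ≤ C j

lemma IsRegularPath.allocated {r x : ℕ → ℝ} {C : ℕ → ℕ} (h : IsRegularPath r x C) :
    Allocated r (fun j => grid x (j + 1)) C :=
  Allocated.of_tendsto ((tendsto_add_atTop_iff_nat 1).2 h.tendsto_grid) h.cap_pos

section Network

variable {Ω : Type*} [MeasurableSpace Ω] {P : Measure Ω} [IsProbabilityMeasure P] {lam : ℝ}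
  {ν : Measure ℝ} [IsProbabilityMeasure ν] {p : ℕ → ℝ} {r X : ℕ → Ω → ℝ} {C : ℕ → Ω → ℕ} {c : ℕ}

namespace IsNetwork

variable (h : IsNetwork P lam ν p r X C) (hν : ν (Set.Iio 0) = 0)

include h hν

lemma ae_cap (hp : IsCapacityLaw c p) : ∀ᵐ ω ∂P, ∀ j, 1 ≤ C j ω ∧ C j ω ≤ c := by
  have h1 : ∀ᵐ ω ∂P, ∀ j i, i ∉ Finset.Icc 1 c → C j ω ≠ i := by
    simp_rw [ae_all_iff]
    intro j i hi
    have h2 : P.real {ω | C j ω = i} = 0 := (h.law_cap j i).trans (hp.support i hi)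
    rw [ae_iff]
    simp only [ne_eq, not_not]
    exact (measureReal_eq_zero_iff).1 h2
  filter_upwards [h1] with ω hω j
  by_contra hcon
  exact hω j (C j ω) (by rw [Finset.mem_Icc]; exact hcon) rfl

lemma integral_dist (f : ℝ → ℝ) (hf : Measurable f) (j : ℕ) :
    ∫ ω, f (X j ω) ∂P = ∫ x, f x ∂ν := by
  rw [← h.law_dist j, integral_map (h.measurable_dist j).aemeasurable hf.aestronglyMeasurable]

lemma integrable_dist (hint : Integrable (fun x => x) ν) (j : ℕ) : Integrable (X j) P := by
  rw [← h.law_dist j] at hint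
  exact hint.comp_measurable (h.measurable_dist j)

lemma identDistrib_dist (j : ℕ) : IdentDistrib (X j) (X 0) P P where
  aemeasurable_fst := (h.measurable_dist j).aemeasurable
  aemeasurable_snd := (h.measurable_dist 0).aemeasurable
  map_eq := by rw [h.law_dist, h.law_dist]

lemma ae_tendsto_grid (hint : Integrable (fun x => x) ν) (hpos : 0 < ∫ x, x ∂ν) :
    ∀ᵐ ω ∂P, Tendsto (grid fun k => X k ω) atTop atTop := by
  have hind : iIndepFun X P := h.indep_servers.comp (fun _ q => q.1) fun _ => measurable_fst
  have h1 := strong_law_ae_real X (h.integrable_dist hν hint 0)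
    (fun i j hij => hind.indepFun hij) (h.identDistrib_dist hν)
  filter_upwards [h1] with ω hω
  rw [show ∫ ω, X 0 ω ∂P = ∫ x, x ∂ν from h.integral_dist hν (fun x => x) measurable_id 0] at hω
  have h2 := hω.pos_mul_atTop hpos tendsto_natCast_atTop_atTop
  refine h2.congr' ?_
  filter_upwards [eventually_gt_atTop 0] with n hn
  have : (n : ℝ) ≠ 0 := by exact_mod_cast hn.ne'
  rw [div_mul_cancel₀ _ this]
  rfl

theorem ae_isRegularPath (hp : IsCapacityLaw c p) (hint : Integrable (fun x => x) ν)
    (hpos : 0 < ∫ x, x ∂ν) :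
    ∀ᵐ ω ∂P, IsRegularPath (fun i => r i ω) (fun k => X k ω) (fun j => C j ω) := by
  filter_upwards [h.poisson.pos, h.poisson.mono, h.poisson.locallyFinite, h.ae_dist_nonneg hν,
    h.ae_tendsto_grid hν hint hpos, h.ae_cap hν hp] with ω h1 h2 h3 h4 h5 h6
  exact ⟨h1, h2, h3, h4, h5, fun j => (h6 j).1⟩

/-- Nonnegative functions of one gap and its number of arrivals. -/
lemma lintegral_arrivals (hlam : 0 < lam) (j : ℕ) {g : ℝ → ℝ} (hg : Measurable g)
    (hg0 : ∀ x, 0 ≤ g x) {f : ℕ → ℝ} (hf : ∀ v, 0 ≤ f v) {a : ℝ → ℝ}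
    (ha : ∀ y, HasSum (fun v => f v * poissonWeight y v) (a y)) :
    ∫⁻ ω, ENNReal.ofReal (g (X j ω) * f (arrivals r X j ω)) ∂P =
      ∫⁻ x, ENNReal.ofReal (g x * a (lam * x)) ∂ν := by
  have hF : Measurable fun q : ℝ × ℕ × ℕ => ENNReal.ofReal (g q.1 * f q.2.1) :=
    ENNReal.measurable_ofReal.comp ((hg.comp measurable_fst).mul
      ((measurable_of_countable f).comp (measurable_fst.comp measurable_snd)))
  have h1 := h.lintegral_gapData hν j hF
  simp only [gapData] at h1
  have hG : Measurable fun x => ∫⁻ v, ENNReal.ofReal (g x * f v) ∂gapLaw lam x :=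
    measurable_lintegral_gapLaw lam measurable_id fun v =>
      ENNReal.measurable_ofReal.comp (hg.mul_const _)
  rw [h1, ← lintegral_map (f := fun x => ∫⁻ v, ENNReal.ofReal (g x * f v) ∂gapLaw lam x) hG
    (h.measurable_dist j), h.law_dist]
  refine lintegral_congr_ae ?_
  filter_upwards [ae_nonneg_of_measure_Iio hν] with x hx
  refine lintegral_gapLaw_ofReal (mul_nonneg hlam.le hx) (fun v => mul_nonneg (hg0 x) (hf v)) ?_
  simp_rw [mul_assoc]
  exact (ha _).mul_left _

lemma law_arrivals_cap (hlam : 0 < lam) (v i : ℕ) :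
    P.real {ω | arrivals r X 0 ω = v ∧ C 0 ω = i} = kProb lam ν v * p i := by
  have hF : Measurable fun q : ℝ × ℕ × ℕ => if q.2.1 = v ∧ q.2.2 = i then (1 : ℝ≥0∞) else 0 :=
    (measurable_of_countable fun q : ℕ × ℕ => if q.1 = v ∧ q.2 = i then (1 : ℝ≥0∞) else 0).comp
      measurable_snd
  have h1 := h.lintegral_gapData hν 0 hF
  have hms : MeasurableSet {ω | arrivals r X 0 ω = v ∧ C 0 ω = i} :=
    (measurableSet_eq_fun (h.measurable_arrivals 0) measurable_const).inter
      (measurableSet_eq_fun (h.measurable_cap 0) measurable_const)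
  have h2 : P {ω | arrivals r X 0 ω = v ∧ C 0 ω = i} =
      ∫⁻ ω, (if arrivals r X 0 ω = v ∧ C 0 ω = i then (1 : ℝ≥0∞) else 0) ∂P := by
    rw [← lintegral_indicator_one hms]
    refine lintegral_congr fun ω => ?_
    simp [Set.indicator_apply]
  have hw : Measurable fun x => ENNReal.ofReal (poissonWeight (lam * x) v) :=
    ENNReal.measurable_ofReal.comp ((measurable_poissonWeight v).comp (measurable_const_mul lam))
  have h3 : ∫⁻ ω, ∫⁻ w, (if w = v ∧ C 0 ω = i then (1 : ℝ≥0∞) else 0) ∂gapLaw lam (X 0 ω) ∂P =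
      ∫⁻ ω, ENNReal.ofReal (poissonWeight (lam * X 0 ω) v) *
        {ω | C 0 ω = i}.indicator 1 ω ∂P := by
    refine lintegral_congr_ae ?_
    filter_upwards [h.ae_dist_nonneg hν] with ω hω
    rw [lintegral_gapLaw_of_nonneg (mul_nonneg hlam.le (hω 0)), tsum_eq_single v]
    · by_cases hi : C 0 ω = i <;> simp [hi]
    · intro w hw
      simp [hw]
  have hmi : Measurable fun c : ℕ => ({i} : Set ℕ).indicator (1 : ℕ → ℝ≥0∞) c :=
    measurable_of_countable _
  have h4 := lintegral_mul_eq_lintegral_mul_lintegral_of_indepFun''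
    (hw.comp (h.measurable_dist 0)).aemeasurable (hmi.comp (h.measurable_cap 0)).aemeasurable
    ((h.indep_dist_cap 0).comp hw hmi)
  have h5 : ∫⁻ ω, ENNReal.ofReal (poissonWeight (lam * X 0 ω) v) ∂P =
      ENNReal.ofReal (kProb lam ν v) := by
    rw [← lintegral_map (f := fun x => ENNReal.ofReal (poissonWeight (lam * x) v)) hw
      (h.measurable_dist 0), h.law_dist, kProb_eq,
      ofReal_integral_eq_lintegral_ofReal (integrable_poissonWeight hlam hν v)]
    filter_upwards [ae_nonneg_of_measure_Iio hν] with x hx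
    exact poissonWeight_nonneg (mul_nonneg hlam.le hx) v
  have h6 : ∫⁻ ω, ({i} : Set ℕ).indicator (1 : ℕ → ℝ≥0∞) (C 0 ω) ∂P = P {ω | C 0 ω = i} := by
    rw [← lintegral_indicator_one (measurableSet_eq_fun (h.measurable_cap 0) measurable_const)]
    rfl
  have h7 : P {ω | arrivals r X 0 ω = v ∧ C 0 ω = i} =
      ENNReal.ofReal (kProb lam ν v) * P {ω | C 0 ω = i} := by
    rw [← h5, ← h6, h2]
    exact h1.trans (h3.trans h4)
  rw [measureReal_def, h7, ENNReal.toReal_mul, ENNReal.toReal_ofReal (kProb_nonneg hlam hν v),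
    ← measureReal_def, h.law_cap]

theorem isQueue (hlam : 0 < lam) (hp : IsCapacityLaw c p) :
    IsQueue P (kProb lam ν) p c (arrivals r X) C where
  measurable_arr := h.measurable_arrivals
  measurable_cap := h.measurable_cap
  indep := (h.iIndepFun_gapData hν).comp (fun _ q => q.2) fun _ => measurable_snd
  identDistrib j := (h.identDistrib_gapData hν j).comp (u := fun q => q.2) measurable_snd
  law := h.law_arrivals_cap hν hlam
  cap_le := by
    filter_upwards [h.ae_cap hν hp] with ω hω j
    exact (hω j).2

lemma memLp_arrivals (hlam : 0 < lam) (hsq : MemLp id 2 ν) (j : ℕ) :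
    MemLp (fun ω => (arrivals r X j ω : ℝ)) 2 P := by
  have hm : AEStronglyMeasurable (fun ω => (arrivals r X j ω : ℝ)) P :=
    ((measurable_of_countable fun n : ℕ => (n : ℝ)).comp
      (h.measurable_arrivals j)).aestronglyMeasurable
  rw [memLp_two_iff_integrable_sq hm]
  refine ⟨hm.pow 2, ?_⟩
  have h1 := h.lintegral_arrivals hν hlam j (g := fun _ => 1) measurable_const
    (fun _ => zero_le_one) (f := fun v => (v : ℝ) ^ 2) (fun v => by positivity)
    hasSum_sq_mul_poissonWeight
  simp only [one_mul] at h1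
  rw [hasFiniteIntegral_iff_norm]
  simp only [norm_pow, Real.norm_natCast]
  rw [h1]
  have h2 : Integrable (fun x => lam * x + (lam * x) ^ 2) ν :=
    ((hsq.integrable one_le_two).const_mul lam).add (hsq.const_mul lam).integrable_sq
  have h3 := h2.2
  rw [hasFiniteIntegral_iff_norm] at h3
  refine lt_of_le_of_lt (lintegral_mono fun x => ?_) h3
  exact ENNReal.ofReal_le_ofReal (Real.le_norm_self _)

lemma integral_arrivals (hlam : 0 < lam) (hsq : MemLp id 2 ν) (j : ℕ) :
    ∫ ω, (arrivals r X j ω : ℝ) ∂P = lam * ∫ x, x ∂ν := by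
  have h1 := h.lintegral_arrivals hν hlam j (g := fun _ => 1) measurable_const
    (fun _ => zero_le_one) (f := fun v => (v : ℝ)) (fun v => by positivity)
    hasSum_mul_poissonWeight
  simp only [one_mul] at h1
  have hint := (h.memLp_arrivals hν hlam hsq j).integrable one_le_two
  have h2 : Integrable (fun x => lam * x) ν := (hsq.integrable one_le_two).const_mul lam
  rw [← integral_const_mul, integral_eq_lintegral_of_nonneg_ae (ae_of_all _ fun ω => by positivity)
    hint.1, h1, integral_eq_lintegral_of_nonneg_ae _ h2.1]
  filter_upwards [ae_nonneg_of_measure_Iio hν] with x hx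
  exact mul_nonneg hlam.le hx

lemma memLp_cap (hp : IsCapacityLaw c p) (j : ℕ) : MemLp (fun ω => (C j ω : ℝ)) 2 P := by
  refine MemLp.of_bound ((measurable_of_countable fun n : ℕ => (n : ℝ)).comp
    (h.measurable_cap j)).aestronglyMeasurable (c : ℝ) ?_
  filter_upwards [h.ae_cap hν hp] with ω hω
  rw [Real.norm_natCast]
  exact_mod_cast (hω j).2

lemma integral_cap (hp : IsCapacityLaw c p) (j : ℕ) : ∫ ω, (C j ω : ℝ) ∂P = meanCap c p := by
  have h1 : ∀ᵐ ω ∂P, (C j ω : ℝ) =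
      ∑ i ∈ Finset.Icc 1 c, {ω | C j ω = i}.indicator (fun _ => (i : ℝ)) ω := by
    filter_upwards [h.ae_cap hν hp] with ω hω
    rw [Finset.sum_eq_single (C j ω)]
    · simp
    · intro i _ hi
      simp [hi.symm]
    · intro h2
      exact absurd (Finset.mem_Icc.2 (hω j)) h2
  have hm : ∀ i, MeasurableSet {ω | C j ω = i} := fun i =>
    measurableSet_eq_fun (h.measurable_cap j) measurable_const
  rw [integral_congr_ae h1, integral_finsetSum _ fun i _ => (integrable_const _).indicator (hm i)]
  refine Finset.sum_congr rfl fun i _ => ?_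
  rw [integral_indicator_const _ (hm i), h.law_cap, smul_eq_mul, mul_comm]

/-- The number of requests carried past a server is the backlog of the queue. -/
lemma crossing_eq_backlog {ω : Ω}
    (hω : IsRegularPath (fun i => r i ω) (fun k => X k ω) (fun j => C j ω)) (j : ℕ) :
    crossing (fun i => r i ω) (serverLoc fun k => X k ω) (fun j => C j ω) j =
      IsQueue.backlog (arrivals r X) C (j + 1) ω :=
  crossing_eq_lindley hω.pos hω.mono hω.tendsto_req (grid_zero _) (grid_mono hω.dist_nonneg)
    hω.allocated j

end IsNetwork

end Network

end

section

/-! ### Backlog accumulated by the first requests -/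

lemma tsum_eq_sum_range_add_tsum (f : ℕ → ℝ≥0∞) (m : ℕ) :
    ∑' j, f j = ∑ j ∈ Finset.range m, f j + ∑' e, f (m + e) := by
  have h := (ENNReal.summable (f := fun e => f (e + m))).sum_add_tsum_nat_add'
  simp_rw [add_comm _ m] at h
  exact h.symm

/-- Cost of draining: a backlog `B` that loses at least one request per server accumulates at most
`B ^ 2`. -/
lemma tsum_natCast_sub_le (B : ℕ) : ∑' e : ℕ, ((B - e : ℕ) : ℝ≥0∞) ≤ (B : ℝ≥0∞) ^ 2 := by
  rw [tsum_eq_sum (s := Finset.range B) fun e he => by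
    rw [Finset.mem_range, not_lt] at he
    rw [Nat.sub_eq_zero_of_le he, Nat.cast_zero]]
  calc ∑ e ∈ Finset.range B, ((B - e : ℕ) : ℝ≥0∞) ≤ ∑ _e ∈ Finset.range B, (B : ℝ≥0∞) :=
        Finset.sum_le_sum fun e _ => by exact_mod_cast Nat.sub_le B e
    _ = (B : ℝ≥0∞) ^ 2 := by rw [Finset.sum_const, Finset.card_range, nsmul_eq_mul, sq]

/-- The backlog of the first `n` requests, summed over the servers. -/
lemma tsum_lindley_truncArr_le {N C : ℕ → ℕ} (hC : ∀ j, 1 ≤ C j) {n : ℕ}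
    (hM : ∃ M, n ≤ ∑ i ∈ Finset.range M, N i) (m : ℕ) :
    ∑' j, (lindley (truncArr N n) C j : ℝ≥0∞) ≤
      ∑ j ∈ Finset.range m, (lindley N C j : ℝ≥0∞) + ((min (lindley N C m) n : ℕ) : ℝ≥0∞) ^ 2 +
        2 * (n : ℝ≥0∞) ^ 2 * ∑' d, if ∑ i ∈ Finset.range (m + d), N i < n then 1 else 0 := by
  classical
  have hmono : ∀ {a b : ℕ}, a ≤ b → ∑ i ∈ Finset.range a, N i ≤ ∑ i ∈ Finset.range b, N i :=
    fun hab => Finset.sum_le_sum_of_subset (Finset.range_subset_range.2 hab)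
  have hex : ∃ d, n ≤ ∑ i ∈ Finset.range (m + d), N i := by
    obtain ⟨M, hM⟩ := hM
    exact ⟨M, hM.trans (hmono (by omega))⟩
  set d := Nat.find hex with hd
  have hd1 : n ≤ ∑ i ∈ Finset.range (m + d), N i := Nat.find_spec hex
  have hd2 : ∀ e < d, ∑ i ∈ Finset.range (m + e), N i < n := fun e he =>
    not_le.1 (Nat.find_min hex he)
  have htail : ∑' e, (lindley (truncArr N n) C (m + d + e) : ℝ≥0∞) ≤
      ((min (lindley N C (m + d)) n : ℕ) : ℝ≥0∞) ^ 2 :=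
    (ENNReal.tsum_le_tsum fun e => by
      exact_mod_cast lindley_truncArr_depletion hC hd1 e).trans (tsum_natCast_sub_le _)
  rw [tsum_eq_sum_range_add_tsum _ m, add_assoc]
  refine add_le_add (Finset.sum_le_sum fun j _ => by
    exact_mod_cast lindley_truncArr_le N C n j) ?_
  -- `d = 0` is the typical case, in which all `n` requests have arrived within `m` gaps. Otherwise
  -- the crude bound `n` on the backlog suffices, because the waiting time `d` will have
  -- exponentially small mean.
  rcases Nat.eq_zero_or_pos d with h0 | h0
  · rw [h0] at htail
    refine le_trans ?_ le_self_add
    exact htail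
  · refine le_trans ?_ le_add_self
    rw [tsum_eq_sum_range_add_tsum _ d]
    have h1 : ∑ e ∈ Finset.range d, (lindley (truncArr N n) C (m + e) : ℝ≥0∞) ≤
        (d : ℝ≥0∞) * (n : ℝ≥0∞) := by
      refine (Finset.sum_le_card_nsmul _ _ (n : ℝ≥0∞) fun e _ => ?_).trans ?_
      · exact_mod_cast lindley_truncArr_le_right N C n _
      · rw [Finset.card_range, nsmul_eq_mul]
    have h2 : ∑' e, (lindley (truncArr N n) C (m + (d + e)) : ℝ≥0∞) ≤ (n : ℝ≥0∞) ^ 2 := by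
      simp_rw [← add_assoc]
      refine htail.trans ?_
      gcongr
      exact min_le_right _ _
    have h3 : (d : ℝ≥0∞) ≤
        ∑' e, if ∑ i ∈ Finset.range (m + e), N i < n then (1 : ℝ≥0∞) else 0 := by
      refine le_trans ?_ (ENNReal.sum_le_tsum (Finset.range d))
      rw [Finset.sum_congr rfl fun e he => if_pos (hd2 e (Finset.mem_range.1 he))]
      simp
    have h4 : d * n + n ^ 2 ≤ 2 * n ^ 2 * d := by
      rcases Nat.eq_zero_or_pos n with hn | hn
      · simp [hn]
      · nlinarith [Nat.mul_le_mul hn h0, Nat.mul_le_mul (Nat.mul_le_mul hn hn) h0,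
          Nat.mul_le_mul (Nat.mul_le_mul_left n hn) (le_refl d)]
    calc _ ≤ (d : ℝ≥0∞) * n + (n : ℝ≥0∞) ^ 2 := add_le_add h1 h2
      _ ≤ 2 * (n : ℝ≥0∞) ^ 2 * d := by exact_mod_cast h4
      _ ≤ _ := by gcongr

lemma le_tsum_lindley_truncArr (N C : ℕ → ℕ) (n m : ℕ) :
    ∑ j ∈ Finset.range m, (if ∑ i ∈ Finset.range j, N i ≤ n then (lindley N C j : ℝ≥0∞) else 0) ≤
      ∑' j, (lindley (truncArr N n) C j : ℝ≥0∞) := by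
  refine le_trans (Finset.sum_le_sum fun j _ => ?_) (ENNReal.sum_le_tsum (Finset.range m))
  split_ifs with hj
  · rw [lindley_truncArr_eq hj]
  · exact zero_le

/-- Pathwise half of Wald's identity: the gaps that begin before `n` arrivals contain at least `n`
of them. In expectation each such gap contributes the mean, since its beginning is decided by
earlier gaps. -/
lemma le_tsum_arrivals {N : ℕ → ℕ} {n : ℕ} (hM : ∃ M, n ≤ ∑ i ∈ Finset.range M, N i) :
    (n : ℝ≥0∞) ≤ ∑' j, (N j : ℝ≥0∞) * if ∑ i ∈ Finset.range j, N i < n then 1 else 0 := by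
  classical
  set d := Nat.find hM with hd
  have hd1 : n ≤ ∑ i ∈ Finset.range d, N i := Nat.find_spec hM
  have hd2 : ∀ e < d, ∑ i ∈ Finset.range e, N i < n := fun e he => not_le.1 (Nat.find_min hM he)
  refine le_trans ?_ (ENNReal.sum_le_tsum (Finset.range d))
  rw [Finset.sum_congr rfl fun e he => by rw [if_pos (hd2 e (Finset.mem_range.1 he)), mul_one]]
  exact_mod_cast hd1

/-! ### Renewal estimates -/

/-- Quadratic majorant for a Chernoff bound from below; it needs only two moments of the arrivals.
-/
lemma exp_neg_le {y : ℝ} (hy : 0 ≤ y) : Real.exp (-y) ≤ 1 - y + y ^ 2 := by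
  rw [Real.exp_neg, inv_le_iff_one_le_mul₀ (Real.exp_pos y)]
  have h1 := Real.add_one_le_exp y
  have h2 : 0 ≤ 1 - y + y ^ 2 := by nlinarith [sq_nonneg (y - 1)]
  calc (1 : ℝ) ≤ (1 - y + y ^ 2) * (y + 1) := by nlinarith [pow_nonneg hy 3]
    _ ≤ (1 - y + y ^ 2) * Real.exp y := by gcongr

namespace IsQueue

variable {Ω : Type*} [MeasurableSpace Ω] {P : Measure Ω} [IsProbabilityMeasure P] {k p : ℕ → ℝ}
  {c : ℕ} {N C : ℕ → Ω → ℕ}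

/-- Number of arrivals in the first `j` gaps. -/
abbrev arrSum (N : ℕ → Ω → ℕ) (j : ℕ) (ω : Ω) : ℕ := ∑ i ∈ Finset.range j, N i ω

/-- Expected number of gaps needed for `n` arrivals. -/
def renewal (P : Measure Ω) (N : ℕ → Ω → ℕ) (n : ℕ) : ℝ≥0∞ := ∑' j, P {ω | arrSum N j ω < n}

variable (h : IsQueue P k p c N C)

include h

lemma measurable_arrSum (j : ℕ) : Measurable (arrSum N j) :=
  Finset.measurable_fun_sum _ fun i _ => h.measurable_arr i

lemma iIndepFun_arr : iIndepFun N P := h.indep.comp (fun _ q => q.1) fun _ => measurable_fst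

lemma identDistrib_arr (j : ℕ) : IdentDistrib (N j) (N 0) P P :=
  (h.identDistrib j).comp (u := fun q : ℕ × ℕ => q.1) measurable_fst

section Renewal

variable (hN : MemLp (fun ω => (N 0 ω : ℝ)) 2 P)

include hN

/-- Exponential bound for the probability that few requests arrive. -/
lemma exists_arrSum_bound {b : ℝ} (hb : 0 < b) (hρ : 1 < b * ∫ ω, (N 0 ω : ℝ) ∂P) :
    ∃ q : ℝ, 0 ≤ q ∧ q < 1 ∧
      ∀ n j : ℕ, b * n ≤ j → P {ω | arrSum N j ω < n} ≤ ENNReal.ofReal (q ^ j) := by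
  set ρ := ∫ ω, (N 0 ω : ℝ) ∂P with hρdef
  set σ := ∫ ω, (N 0 ω : ℝ) ^ 2 ∂P with hσ
  have hσ0 : 0 ≤ σ := integral_nonneg fun ω => sq_nonneg _
  set a := 1 / b with ha
  have haρ : a < ρ := by rw [ha, div_lt_iff₀ hb]; linarith
  -- With `a < ρ`, this choice makes the exponent `s * (a - ρ + s * σ)` at most `-s * (ρ - a) / 2`.
  -- Adding `1` to `σ` avoids division by zero.
  set s := (ρ - a) / (2 * (σ + 1)) with hs
  have hs0 : 0 < s := div_pos (by linarith) (by linarith)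
  have hsσ : s * (σ + 1) = (ρ - a) / 2 := by rw [hs]; field_simp
  have hm : ∀ i, Measurable fun ω => (N i ω : ℝ) := fun i =>
    (measurable_of_countable fun n : ℕ => (n : ℝ)).comp (h.measurable_arr i)
  have hint : ∀ Y : Ω → ℝ, Measurable Y → (∀ ω, 0 ≤ Y ω) →
      Integrable (fun ω => Real.exp (-s * Y ω)) P := by
    intro Y hY hY0
    refine Integrable.of_bound (C := 1) (by fun_prop) (ae_of_all _ fun ω => ?_)
    rw [Real.norm_of_nonneg (Real.exp_pos _).le, Real.exp_le_one_iff]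
    nlinarith [mul_nonneg hs0.le (hY0 ω)]
  set κ := mgf (fun ω => (N 0 ω : ℝ)) P (-s) with hκ
  have hκ0 : 0 ≤ κ := mgf_nonneg
  have hκ1 : κ ≤ Real.exp (-(s * ρ) + s ^ 2 * σ) := by
    have h1 : κ ≤ ∫ ω, (1 - s * (N 0 ω : ℝ) + s ^ 2 * (N 0 ω : ℝ) ^ 2) ∂P := by
      refine integral_mono (hint _ (hm 0) fun ω => Nat.cast_nonneg _) ?_ fun ω => ?_
      · exact ((integrable_const 1).sub ((hN.integrable one_le_two).const_mul s)).add
          (hN.integrable_sq.const_mul _)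
      · have := exp_neg_le (mul_nonneg hs0.le (Nat.cast_nonneg (N 0 ω)))
        simp only [neg_mul]
        nlinarith
    have h2 : ∫ ω, (1 - s * (N 0 ω : ℝ) + s ^ 2 * (N 0 ω : ℝ) ^ 2) ∂P =
        1 - s * ρ + s ^ 2 * σ := by
      have i1 : Integrable (fun ω => s * (N 0 ω : ℝ)) P := (hN.integrable one_le_two).const_mul s
      have i2 : Integrable (fun ω => s ^ 2 * (N 0 ω : ℝ) ^ 2) P := hN.integrable_sq.const_mul _
      have e1 := integral_add ((integrable_const (1 : ℝ)).sub i1) i2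
      simp only [Pi.sub_apply] at e1
      rw [e1, integral_sub (integrable_const 1) i1, integral_const_mul, integral_const_mul]
      simp [hρdef, hσ]
    rw [h2] at h1
    refine h1.trans ?_
    linarith [Real.add_one_le_exp (-(s * ρ) + s ^ 2 * σ)]
  refine ⟨Real.exp (s * a) * κ, by positivity, ?_, fun n j hj => ?_⟩
  · calc Real.exp (s * a) * κ ≤ Real.exp (s * a) * Real.exp (-(s * ρ) + s ^ 2 * σ) := by gcongr
      _ = Real.exp (s * a + (-(s * ρ) + s ^ 2 * σ)) := (Real.exp_add _ _).symm
      _ < 1 := by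
        rw [Real.exp_lt_one_iff]
        nlinarith
  · have hsum : mgf (∑ i ∈ Finset.range j, fun ω => (N i ω : ℝ)) P (-s) = κ ^ j := by
      have hind : iIndepFun (fun i ω => (N i ω : ℝ)) P :=
        h.iIndepFun_arr.comp (fun _ (n : ℕ) => (n : ℝ)) fun _ => measurable_of_countable _
      rw [hind.mgf_sum hm]
      rw [Finset.prod_congr rfl fun i _ => ?_, Finset.prod_const, Finset.card_range]
      have h3 := (h.identDistrib_arr i).comp
        (u := fun n : ℕ => Real.exp (-s * (n : ℝ))) (measurable_of_countable _)
      exact h3.integral_eq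
    have h4 := measure_le_le_exp_mul_mgf (μ := P) (X := ∑ i ∈ Finset.range j, fun ω => (N i ω : ℝ))
      (t := -s) (a * j) (by linarith) (hint _ (by
        rw [Finset.sum_fn]; exact Finset.measurable_fun_sum _ fun i _ => hm i) fun ω => by
        rw [Finset.sum_apply]; exact Finset.sum_nonneg fun i _ => Nat.cast_nonneg _)
    rw [hsum] at h4
    have h5 : P {ω | arrSum N j ω < n} ≤
        P {ω | (∑ i ∈ Finset.range j, fun ω => (N i ω : ℝ)) ω ≤ a * j} := by
      refine measure_mono fun ω hω => ?_
      simp only [Set.mem_ofPred_eq, Finset.sum_apply] at hω ⊢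
      have h6 : ((arrSum N j ω : ℕ) : ℝ) ≤ n := by exact_mod_cast hω.le
      rw [arrSum, Nat.cast_sum] at h6
      refine h6.trans ?_
      rw [ha, one_div, ← div_eq_inv_mul, le_div_iff₀ hb]
      linarith
    refine h5.trans ?_
    rw [← ofReal_measureReal]
    refine ENNReal.ofReal_le_ofReal (h4.trans (le_of_eq ?_))
    rw [mul_pow, ← Real.exp_nat_mul]
    congr 2
    ring

lemma tsum_arrSum_tail_le {q : ℝ} (hq0 : 0 ≤ q) (hq1 : q < 1) {b : ℝ}
    (hq : ∀ n j : ℕ, b * n ≤ j → P {ω | arrSum N j ω < n} ≤ ENNReal.ofReal (q ^ j)) {n m : ℕ}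
    (hm : b * n ≤ m) :
    ∑' d, P {ω | arrSum N (m + d) ω < n} ≤ ENNReal.ofReal (q ^ m / (1 - q)) := by
  have h1 : HasSum (fun d => q ^ (m + d)) (q ^ m / (1 - q)) := by
    simp_rw [pow_add]
    exact (hasSum_geometric_of_lt_one hq0 hq1).mul_left _
  rw [← h1.tsum_eq, ENNReal.ofReal_tsum_of_nonneg (fun d => pow_nonneg hq0 _) h1.summable]
  refine ENNReal.tsum_le_tsum fun d => hq n _ (hm.trans ?_)
  push_cast
  linarith [Nat.cast_nonneg (α := ℝ) d]

lemma renewal_le {q : ℝ} (hq0 : 0 ≤ q) (hq1 : q < 1) {b : ℝ}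
    (hq : ∀ n j : ℕ, b * n ≤ j → P {ω | arrSum N j ω < n} ≤ ENNReal.ofReal (q ^ j)) {n m : ℕ}
    (hm : b * n ≤ m) :
    renewal P N n ≤ (∑ j ∈ Finset.range m, P {ω | arrSum N j ω < n}) +
      ENNReal.ofReal (q ^ m / (1 - q)) := by
  rw [renewal, tsum_eq_sum_range_add_tsum _ m]
  gcongr
  exact h.tsum_arrSum_tail_le hN hq0 hq1 hq hm

lemma le_renewal (hS : ∀ᵐ ω ∂P, ∀ n, ∃ M, n ≤ arrSum N M ω) (n : ℕ) :
    (n : ℝ≥0∞) ≤ ENNReal.ofReal (∫ ω, (N 0 ω : ℝ) ∂P) * renewal P N n := by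
  have hE : ∀ j, ∫⁻ ω, (N j ω : ℝ≥0∞) ∂P = ENNReal.ofReal (∫ ω, (N 0 ω : ℝ) ∂P) := by
    intro j
    rw [ofReal_integral_eq_lintegral_ofReal (hN.integrable one_le_two)
      (ae_of_all _ fun ω => Nat.cast_nonneg _)]
    have := ((h.identDistrib_arr j).comp (u := fun n : ℕ => (n : ℝ≥0∞))
      (measurable_of_countable _)).lintegral_eq
    simp only [Function.comp_def] at this
    rw [this]
    simp
  have hstep : ∀ j, ∫⁻ ω, (N j ω : ℝ≥0∞) * (if arrSum N j ω < n then 1 else 0) ∂P =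
      ENNReal.ofReal (∫ ω, (N 0 ω : ℝ) ∂P) * P {ω | arrSum N j ω < n} := by
    intro j
    have h1 : IndepFun (arrSum N j) (N j) P :=
      indepFun_past h.iIndepFun_arr h.measurable_arr
        (f := fun z : ℕ → ℕ => ∑ i ∈ Finset.range j, z i) (by fun_prop)
        fun z z' hz => Finset.sum_congr rfl fun i hi => hz i (Finset.mem_range.1 hi)
    have h2 := lintegral_mul_eq_lintegral_mul_lintegral_of_indepFun''
      ((measurable_of_countable fun n : ℕ => (n : ℝ≥0∞)).comp (h.measurable_arr j)).aemeasurable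
      ((measurable_of_countable fun s : ℕ => if s < n then (1 : ℝ≥0∞) else 0).comp
        (h.measurable_arrSum j)).aemeasurable
      (h1.symm.comp (measurable_of_countable fun n : ℕ => (n : ℝ≥0∞))
        (measurable_of_countable fun s : ℕ => if s < n then (1 : ℝ≥0∞) else 0))
    refine h2.trans ?_
    simp only [Function.comp_def]
    rw [hE j, ← lintegral_indicator_one (measurableSet_lt (h.measurable_arrSum j) measurable_const)]
    congr 1
    refine lintegral_congr fun ω => ?_
    simp [Set.indicator_apply]
  calc (n : ℝ≥0∞) = ∫⁻ _ω, (n : ℝ≥0∞) ∂P := by simp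
    _ ≤ ∫⁻ ω, ∑' j, (N j ω : ℝ≥0∞) * (if arrSum N j ω < n then 1 else 0) ∂P := by
        refine lintegral_mono_ae ?_
        filter_upwards [hS] with ω hω
        exact le_tsum_arrivals (N := fun j => N j ω) (hω n)
    _ = ∑' j, ∫⁻ ω, (N j ω : ℝ≥0∞) * (if arrSum N j ω < n then 1 else 0) ∂P := by
        refine lintegral_tsum fun j => Measurable.aemeasurable ?_
        exact ((measurable_of_countable fun n : ℕ => (n : ℝ≥0∞)).comp (h.measurable_arr j)).mul
          ((measurable_of_countable fun s : ℕ => if s < n then (1 : ℝ≥0∞) else 0).comp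
            (h.measurable_arrSum j))
    _ = _ := by simp_rw [hstep, ENNReal.tsum_mul_left]; rfl

end Renewal

end IsQueue

end

section

/-! ### Asymptotics of the accumulated backlog -/

namespace IsQueue

variable {Ω : Type*} [MeasurableSpace Ω] {P : Measure Ω} [IsProbabilityMeasure P] {k p π : ℕ → ℝ}
  {c : ℕ} {N C : ℕ → Ω → ℕ}

/-- Expected backlog of the first `n` arrivals, summed over the servers. -/
def accBacklog (P : Measure Ω) (N C : ℕ → Ω → ℕ) (n : ℕ) : ℝ≥0∞ :=
  ∑' j, ∫⁻ ω, (lindley (truncArr (fun i => N i ω) n) (fun i => C i ω) j : ℝ≥0∞) ∂P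

lemma IsLimitLaw.tsum_ofReal_mul (hπ : IsLimitLaw P N C π) {f : ℕ → ℝ} (hf : ∀ l, 0 ≤ f l)
    (hs : Summable fun l => f l * π l) :
    ∑' l, ENNReal.ofReal (π l) * ENNReal.ofReal (f l) = ENNReal.ofReal (∑' l, f l * π l) := by
  rw [ENNReal.ofReal_tsum_of_nonneg (fun l => mul_nonneg (hf l) (hπ.nonneg l)) hs]
  exact tsum_congr fun l => by rw [ENNReal.ofReal_mul (hf l), mul_comm]

lemma IsLimitLaw.summable_min_sq (hπ : IsLimitLaw P N C π) (n : ℕ) :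
    Summable fun l => ((min l n : ℕ) : ℝ) ^ 2 * π l := by
  refine Summable.of_nonneg_of_le (fun l => mul_nonneg (sq_nonneg _) (hπ.nonneg l)) (fun l => ?_)
    (hπ.hasSum_one.summable.mul_left ((n : ℝ) ^ 2))
  have : ((min l n : ℕ) : ℝ) ≤ n := by exact_mod_cast min_le_right l n
  exact mul_le_mul_of_nonneg_right (by gcongr) (hπ.nonneg l)

/-- Since `min l n ^ 2 ≤ l * n`, the quotient by `n` is dominated by `l * π l`. Thus the quadratic
draining cost is `o(n)` using only the first moment of the limit law. -/
lemma IsLimitLaw.tendsto_min_sq (hπ : IsLimitLaw P N C π) :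
    Tendsto (fun n : ℕ => (∑' l, ((min l n : ℕ) : ℝ) ^ 2 * π l) / n) atTop (𝓝 0) := by
  have h1 := tendsto_tsum_of_dominated_convergence (𝓕 := atTop)
    (f := fun (n : ℕ) (l : ℕ) => ((min l n : ℕ) : ℝ) ^ 2 * π l / n) (g := fun _ => 0)
    hπ.summable_mean ?_ ?_
  · simp only [tsum_zero] at h1
    refine h1.congr fun n => ?_
    rw [← tsum_div_const]
  · intro l
    have h2 : Tendsto (fun n : ℕ => (l : ℝ) ^ 2 * π l / n) atTop (𝓝 0) :=
      tendsto_const_div_atTop_nhds_zero_nat _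
    refine h2.congr' ?_
    filter_upwards [eventually_ge_atTop l] with n hn
    rw [min_eq_left hn]
  · refine Eventually.of_forall fun n l => ?_
    have h0 := hπ.nonneg l
    rw [Real.norm_of_nonneg (by positivity)]
    rcases Nat.eq_zero_or_pos n with hn | hn
    · simp [hn]
      positivity
    · have hn' : (0 : ℝ) < n := by exact_mod_cast hn
      rw [div_le_iff₀ hn']
      have h1 : ((min l n : ℕ) : ℝ) ≤ l := by exact_mod_cast min_le_left l n
      have h2 : ((min l n : ℕ) : ℝ) ≤ n := by exact_mod_cast min_le_right l n
      have h3 : ((min l n : ℕ) : ℝ) ^ 2 ≤ l * n := by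
        rw [sq]
        exact mul_le_mul h1 h2 (Nat.cast_nonneg _) (Nat.cast_nonneg _)
      calc ((min l n : ℕ) : ℝ) ^ 2 * π l ≤ (l * n) * π l := by gcongr
        _ = l * π l * n := by ring

variable (h : IsQueue P k p c N C) (hN : MemLp (fun ω => (N 0 ω : ℝ)) 2 P)
  (hρ : 0 < ∫ ω, (N 0 ω : ℝ) ∂P) (hS : ∀ᵐ ω ∂P, ∀ n, ∃ M, n ≤ arrSum N M ω)

include h hN

lemma exists_bound_of_inv_lt (hρ : 0 < ∫ ω, (N 0 ω : ℝ) ∂P) {b : ℝ}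
    (hb : 1 / (∫ ω, (N 0 ω : ℝ) ∂P) < b) :
    0 < b ∧ ∃ q : ℝ, 0 ≤ q ∧ q < 1 ∧
      ∀ n j : ℕ, b * n ≤ j → P {ω | arrSum N j ω < n} ≤ ENNReal.ofReal (q ^ j) := by
  have hb0 : 0 < b := (div_pos one_pos hρ).trans hb
  exact ⟨hb0, h.exists_arrSum_bound hN hb0 (by rwa [div_lt_iff₀ hρ] at hb)⟩

include hρ

lemma renewal_ne_top (n : ℕ) : renewal P N n ≠ ⊤ := by
  obtain ⟨hb, q, hq0, hq1, hq⟩ := h.exists_bound_of_inv_lt hN hρ (lt_add_one _)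
  refine ne_top_of_le_ne_top ?_ (h.renewal_le hN hq0 hq1 hq (Nat.le_ceil _))
  exact ENNReal.add_ne_top.2 ⟨ENNReal.sum_ne_top.2 fun j _ => measure_ne_top _ _,
    ENNReal.ofReal_ne_top⟩

include hS

lemma natCast_div_le_renewal (n : ℕ) :
    (n : ℝ) / (∫ ω, (N 0 ω : ℝ) ∂P) ≤ (renewal P N n).toReal := by
  have h1 := h.le_renewal hN hS n
  have h2 := ENNReal.toReal_mono
    (ENNReal.mul_ne_top ENNReal.ofReal_ne_top (h.renewal_ne_top hN hρ n)) h1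
  rw [ENNReal.toReal_natCast, ENNReal.toReal_mul, ENNReal.toReal_ofReal hρ.le] at h2
  rw [div_le_iff₀ hρ]
  linarith

/-- Elementary renewal theorem. -/
theorem tendsto_renewal : Tendsto (fun n : ℕ => (renewal P N n).toReal / n) atTop
    (𝓝 (1 / ∫ ω, (N 0 ω : ℝ) ∂P)) := by
  rw [tendsto_order]
  constructor
  · intro a ha
    filter_upwards [eventually_gt_atTop 0] with n hn
    have hn' : (0 : ℝ) < n := by exact_mod_cast hn
    refine ha.trans_le ?_
    rw [le_div_iff₀ hn', one_div, ← div_eq_inv_mul]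
    exact h.natCast_div_le_renewal hN hρ hS n
  · intro a ha
    obtain ⟨b, hb1, hb2⟩ := exists_between ha
    obtain ⟨hb, q, hq0, hq1, hq⟩ := h.exists_bound_of_inv_lt hN hρ hb1
    have h1 : Tendsto (fun n : ℕ => b + (1 + 1 / (1 - q)) / n) atTop (𝓝 (b + 0)) :=
      tendsto_const_nhds.add (tendsto_const_div_atTop_nhds_zero_nat _)
    rw [add_zero] at h1
    filter_upwards [h1.eventually_lt_const hb2, eventually_gt_atTop 0] with n hn hn0
    have hn' : (0 : ℝ) < n := by exact_mod_cast hn0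
    refine lt_of_le_of_lt ?_ hn
    have h2 := h.renewal_le hN hq0 hq1 hq (Nat.le_ceil (b * n))
    have h3 : (renewal P N n).toReal ≤ ⌈b * n⌉₊ + q ^ ⌈b * n⌉₊ / (1 - q) := by
      have h4 : renewal P N n ≤ ENNReal.ofReal (⌈b * n⌉₊ + q ^ ⌈b * n⌉₊ / (1 - q)) := by
        rw [ENNReal.ofReal_add (Nat.cast_nonneg _)
          (div_nonneg (pow_nonneg hq0 _) (sub_nonneg.2 hq1.le)), ENNReal.ofReal_natCast]
        refine h2.trans (add_le_add_left ?_ _)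
        refine (Finset.sum_le_card_nsmul _ _ 1 fun j _ => prob_le_one).trans ?_
        simp
      exact ENNReal.toReal_le_of_le_ofReal (add_nonneg (Nat.cast_nonneg _)
        (div_nonneg (pow_nonneg hq0 _) (sub_nonneg.2 hq1.le))) h4
    have h5 : (⌈b * n⌉₊ : ℝ) < b * n + 1 := Nat.ceil_lt_add_one (by positivity)
    have h6 : q ^ ⌈b * n⌉₊ / (1 - q) ≤ 1 / (1 - q) :=
      div_le_div_of_nonneg_right (pow_le_one₀ hq0 hq1.le) (sub_nonneg.2 hq1.le)
    rw [div_le_iff₀ hn', add_mul, div_mul_cancel₀ _ hn'.ne']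
    linarith

lemma measurable_truncArr (n j : ℕ) : Measurable fun ω => truncArr (fun i => N i ω) n j := by
  have := h.measurable_arrSum j
  exact (measurable_of_countable fun q : ℕ × ℕ => min q.1 (n - q.2)).comp
    ((h.measurable_arr j).prodMk this)

lemma measurable_lindley_truncArr (n j : ℕ) :
    Measurable fun ω => lindley (truncArr (fun i => N i ω) n) (fun i => C i ω) j :=
  measurable_lindley (N := fun j ω => truncArr (fun i => N i ω) n j)
    (h.measurable_truncArr hN hρ hS n) h.measurable_cap j

lemma accBacklog_eq (n : ℕ) : accBacklog P N C n =
    ∫⁻ ω, ∑' j, (lindley (truncArr (fun i => N i ω) n) (fun i => C i ω) j : ℝ≥0∞) ∂P :=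
  (lintegral_tsum fun j => ((measurable_of_countable fun n : ℕ => (n : ℝ≥0∞)).comp
    (h.measurable_lindley_truncArr hN hρ hS n j)).aemeasurable).symm

/-- The three terms are: the first `m` servers, each with at most the limiting mean by stochastic
domination; the drain of the backlog left at server `m`; and the unlikely case that fewer than `n`
requests arrived in `m` gaps. -/
lemma accBacklog_le (hC : ∀ᵐ ω ∂P, ∀ j, 1 ≤ C j ω) (hπ : IsLimitLaw P N C π) {q : ℝ} (hq0 : 0 ≤ q)
    (hq1 : q < 1) {b : ℝ}
    (hq : ∀ n j : ℕ, b * n ≤ j → P {ω | arrSum N j ω < n} ≤ ENNReal.ofReal (q ^ j)) {n m : ℕ}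
    (hm : b * n ≤ m) :
    accBacklog P N C n ≤ ENNReal.ofReal (m * (∑' l : ℕ, (l : ℝ) * π l) +
      (∑' l, ((min l n : ℕ) : ℝ) ^ 2 * π l) + 2 * (n : ℝ) ^ 2 * (q ^ m / (1 - q))) := by
  have hq2 : 0 ≤ q ^ m / (1 - q) := div_nonneg (pow_nonneg hq0 _) (sub_nonneg.2 hq1.le)
  have hH0 : 0 ≤ ∑' l : ℕ, (l : ℝ) * π l :=
    tsum_nonneg fun l => mul_nonneg (Nat.cast_nonneg l) (hπ.nonneg l)
  have hM0 : 0 ≤ ∑' l, ((min l n : ℕ) : ℝ) ^ 2 * π l :=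
    tsum_nonneg fun l => mul_nonneg (sq_nonneg _) (hπ.nonneg l)
  have mB : ∀ j, Measurable fun ω => (backlog N C j ω : ℝ≥0∞) := fun j =>
    (measurable_of_countable fun n : ℕ => (n : ℝ≥0∞)).comp (h.measurable_backlog j)
  have mM : Measurable fun ω => ((min (backlog N C m ω) n : ℕ) : ℝ≥0∞) ^ 2 :=
    (measurable_of_countable fun l : ℕ => ((min l n : ℕ) : ℝ≥0∞) ^ 2).comp (h.measurable_backlog m)
  have mS : ∀ d, Measurable fun ω => if arrSum N (m + d) ω < n then (1 : ℝ≥0∞) else 0 := fun d =>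
    (measurable_of_countable fun s : ℕ => if s < n then (1 : ℝ≥0∞) else 0).comp
      (h.measurable_arrSum (m + d))
  have h1 : ∫⁻ ω, ((∑ j ∈ Finset.range m, (backlog N C j ω : ℝ≥0∞)) +
      ((min (backlog N C m ω) n : ℕ) : ℝ≥0∞) ^ 2) ∂P ≤
      m * ENNReal.ofReal (∑' l : ℕ, (l : ℝ) * π l) +
        ENNReal.ofReal (∑' l, ((min l n : ℕ) : ℝ) ^ 2 * π l) := by
    rw [lintegral_add_right _ mM, lintegral_finsetSum _ fun j _ => mB j]
    refine add_le_add ?_ ?_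
    · refine (Finset.sum_le_card_nsmul _ _
        (ENNReal.ofReal (∑' l : ℕ, (l : ℝ) * π l)) fun j _ => ?_).trans ?_
      · rw [← hπ.tsum_ofReal_mul (fun l => Nat.cast_nonneg l) hπ.summable_mean]
        simp_rw [ENNReal.ofReal_natCast]
        exact hπ.lintegral_le (fun l => (l : ℝ≥0∞)) (fun a b hab => Nat.cast_le.2 hab) j
      · rw [Finset.card_range, nsmul_eq_mul]
    · rw [← hπ.tsum_ofReal_mul (fun l => sq_nonneg _) (hπ.summable_min_sq n)]
      simp_rw [ENNReal.ofReal_pow (Nat.cast_nonneg _), ENNReal.ofReal_natCast]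
      refine hπ.lintegral_le (fun l => ((min l n : ℕ) : ℝ≥0∞) ^ 2) (fun a b hab => ?_) m
      have : min a n ≤ min b n := min_le_min_right n hab
      simp only
      gcongr
  have h2 : ∫⁻ ω, ∑' d, (if arrSum N (m + d) ω < n then (1 : ℝ≥0∞) else 0) ∂P ≤
      ENNReal.ofReal (q ^ m / (1 - q)) := by
    rw [lintegral_tsum fun d => (mS d).aemeasurable]
    refine le_trans (le_of_eq ?_) (h.tsum_arrSum_tail_le hN hq0 hq1 hq hm)
    refine tsum_congr fun d => ?_
    rw [← lintegral_indicator_one (measurableSet_lt (h.measurable_arrSum _) measurable_const)]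
    refine lintegral_congr fun ω => ?_
    simp [Set.indicator_apply]
  calc accBacklog P N C n = ∫⁻ ω, ∑' j,
        (lindley (truncArr (fun i => N i ω) n) (fun i => C i ω) j : ℝ≥0∞) ∂P :=
        h.accBacklog_eq hN hρ hS n
    _ ≤ ∫⁻ ω, (((∑ j ∈ Finset.range m, (backlog N C j ω : ℝ≥0∞)) +
          ((min (backlog N C m ω) n : ℕ) : ℝ≥0∞) ^ 2) + 2 * (n : ℝ≥0∞) ^ 2 *
          ∑' d, if arrSum N (m + d) ω < n then 1 else 0) ∂P := by
        refine lintegral_mono_ae ?_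
        filter_upwards [hC, hS] with ω h3 h4
        exact tsum_lindley_truncArr_le h3 (h4 n) m
    _ = ∫⁻ ω, ((∑ j ∈ Finset.range m, (backlog N C j ω : ℝ≥0∞)) +
          ((min (backlog N C m ω) n : ℕ) : ℝ≥0∞) ^ 2) ∂P + 2 * (n : ℝ≥0∞) ^ 2 *
          ∫⁻ ω, ∑' d, (if arrSum N (m + d) ω < n then (1 : ℝ≥0∞) else 0) ∂P := by
        rw [lintegral_add_right _ ((Measurable.tsum mS).const_mul _),
          lintegral_const_mul _ (Measurable.tsum mS)]
    _ ≤ m * ENNReal.ofReal (∑' l : ℕ, (l : ℝ) * π l) +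
        ENNReal.ofReal (∑' l, ((min l n : ℕ) : ℝ) ^ 2 * π l) +
        2 * (n : ℝ≥0∞) ^ 2 * ENNReal.ofReal (q ^ m / (1 - q)) := by gcongr
    _ = _ := by
        rw [ENNReal.ofReal_add (by positivity) (by positivity), ENNReal.ofReal_add (by positivity)
          hM0, ENNReal.ofReal_mul (Nat.cast_nonneg _), ENNReal.ofReal_mul (by positivity),
          ENNReal.ofReal_mul zero_le_two, ENNReal.ofReal_pow (Nat.cast_nonneg _),
          ENNReal.ofReal_natCast, ENNReal.ofReal_natCast, ENNReal.ofReal_ofNat]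

lemma accBacklog_ne_top (hC : ∀ᵐ ω ∂P, ∀ j, 1 ≤ C j ω) (hπ : IsLimitLaw P N C π) (n : ℕ) :
    accBacklog P N C n ≠ ⊤ := by
  obtain ⟨hb, q, hq0, hq1, hq⟩ := h.exists_bound_of_inv_lt hN hρ (lt_add_one _)
  exact ne_top_of_le_ne_top ENNReal.ofReal_ne_top
    (h.accBacklog_le hN hρ hS hC hπ hq0 hq1 hq (Nat.le_ceil _))

/-- Cutting the backlog off at `A` makes the loss at servers reached after all `n` arrivals at most
`A` each, whatever the dependence between backlog and arrivals. The expected number of such servers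
among the first `m` is controlled by the Wald bound on the renewal function. -/
lemma le_accBacklog (hC : ∀ᵐ ω ∂P, ∀ j, 1 ≤ C j ω) (hπ : IsLimitLaw P N C π) {q : ℝ} (hq0 : 0 ≤ q)
    (hq1 : q < 1) {b : ℝ}
    (hq : ∀ n j : ℕ, b * n ≤ j → P {ω | arrSum N j ω < n} ≤ ENNReal.ofReal (q ^ j)) {n m : ℕ}
    (hm : b * n ≤ m) (A : ℕ) :
    ∑ j ∈ Finset.range m, ∑ l ∈ Finset.range (A + 1), (l : ℝ) * P.real {ω | backlog N C j ω = l} -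
      A * (m - n / (∫ ω, (N 0 ω : ℝ) ∂P) + q ^ m / (1 - q)) ≤ (accBacklog P N C n).toReal := by
  have hq2 : 0 ≤ q ^ m / (1 - q) := div_nonneg (pow_nonneg hq0 _) (sub_nonneg.2 hq1.le)
  have hms : ∀ j, MeasurableSet {ω | arrSum N j ω < n} := fun j =>
    measurableSet_lt (h.measurable_arrSum j) measurable_const
  have hml : ∀ j l, MeasurableSet {ω | backlog N C j ω = l} := fun j l =>
    measurableSet_eq_fun (h.measurable_backlog j) measurable_const
  have hfin := h.accBacklog_ne_top hN hρ hS hC hπ n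
  have mI : ∀ {s : Set Ω}, MeasurableSet s → Measurable (s.indicator (1 : Ω → ℝ≥0∞)) :=
    fun hs => measurable_one.indicator hs
  have hstep : ∀ j, ∑ l ∈ Finset.range (A + 1), (l : ℝ≥0∞) * P {ω | backlog N C j ω = l} ≤
      ∫⁻ ω, (if arrSum N j ω ≤ n then (backlog N C j ω : ℝ≥0∞) else 0) ∂P +
        A * P {ω | arrSum N j ω < n}ᶜ := by
    intro j
    have e1 : ∑ l ∈ Finset.range (A + 1), (l : ℝ≥0∞) * P {ω | backlog N C j ω = l} =
        ∫⁻ ω, ∑ l ∈ Finset.range (A + 1),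
          (l : ℝ≥0∞) * {ω | backlog N C j ω = l}.indicator 1 ω ∂P := by
      rw [lintegral_finsetSum _ fun l _ =>
        (mI (hml j l)).const_mul (l : ℝ≥0∞)]
      refine Finset.sum_congr rfl fun l _ => ?_
      rw [lintegral_const_mul _ (mI (hml j l)),
        lintegral_indicator_one (hml j l)]
    have e2 : A * P {ω | arrSum N j ω < n}ᶜ =
        ∫⁻ ω, A * {ω | arrSum N j ω < n}ᶜ.indicator 1 ω ∂P := by
      rw [lintegral_const_mul _ (mI (hms j).compl),
        lintegral_indicator_one (hms j).compl]
    rw [e1, e2, ← lintegral_add_right _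
      ((mI (hms j).compl).const_mul (A : ℝ≥0∞))]
    refine lintegral_mono fun ω => ?_
    have e3 : ∑ l ∈ Finset.range (A + 1), (l : ℝ≥0∞) *
        {ω | backlog N C j ω = l}.indicator (1 : Ω → ℝ≥0∞) ω =
        if backlog N C j ω ≤ A then (backlog N C j ω : ℝ≥0∞) else 0 := by
      split_ifs with hA
      · rw [Finset.sum_eq_single (backlog N C j ω)]
        · simp
        · intro l _ hl
          simp [hl.symm]
        · intro hcon
          exact absurd (Finset.mem_range.2 (by omega)) hcon
      · refine Finset.sum_eq_zero fun l hl => ?_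
        rw [Finset.mem_range] at hl
        rw [Set.indicator_of_notMem, mul_zero]
        intro hcon
        rw [Set.mem_ofPred_eq] at hcon
        omega
    simp only
    rw [e3]
    by_cases hs : arrSum N j ω ≤ n
    · rw [if_pos hs]
      refine le_trans ?_ le_self_add
      split_ifs
      · exact le_rfl
      · exact zero_le
    · have hmem : ω ∈ {ω | arrSum N j ω < n}ᶜ := by
        rw [Set.mem_compl_iff, Set.mem_ofPred_eq]
        omega
      rw [if_neg hs, zero_add, Set.indicator_of_mem hmem, Pi.one_apply, mul_one]
      split_ifs with hA
      · exact_mod_cast hA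
      · exact zero_le
  have hsum : ∑ j ∈ Finset.range m, ∑ l ∈ Finset.range (A + 1),
      (l : ℝ≥0∞) * P {ω | backlog N C j ω = l} ≤
      accBacklog P N C n + ∑ j ∈ Finset.range m, A * P {ω | arrSum N j ω < n}ᶜ := by
    refine (Finset.sum_le_sum fun j _ => hstep j).trans ?_
    rw [Finset.sum_add_distrib]
    refine add_le_add_left ?_ _
    rw [h.accBacklog_eq hN hρ hS, ← lintegral_finsetSum]
    · exact lintegral_mono fun ω => le_tsum_lindley_truncArr _ _ n m
    · intro j _
      exact (measurable_of_countable fun q : ℕ × ℕ => if q.1 ≤ n then (q.2 : ℝ≥0∞) else 0).comp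
        ((h.measurable_arrSum j).prodMk (h.measurable_backlog j))
  have hfin2 : ∑ j ∈ Finset.range m, A * P {ω | arrSum N j ω < n}ᶜ ≠ ⊤ :=
    ENNReal.sum_ne_top.2 fun j _ => ENNReal.mul_ne_top (ENNReal.natCast_ne_top A)
      (measure_ne_top _ _)
  have hreal := ENNReal.toReal_mono (ENNReal.add_ne_top.2 ⟨hfin, hfin2⟩) hsum
  rw [ENNReal.toReal_add hfin hfin2, ENNReal.toReal_sum fun j _ => ENNReal.mul_ne_top
    (ENNReal.natCast_ne_top A) (measure_ne_top _ _), ENNReal.toReal_sum fun j _ =>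
    ENNReal.sum_ne_top.2 fun l _ => ENNReal.mul_ne_top (ENNReal.natCast_ne_top l)
      (measure_ne_top _ _)] at hreal
  have e4 : ∀ j, (∑ l ∈ Finset.range (A + 1), (l : ℝ≥0∞) * P {ω | backlog N C j ω = l}).toReal =
      ∑ l ∈ Finset.range (A + 1), (l : ℝ) * P.real {ω | backlog N C j ω = l} := by
    intro j
    rw [ENNReal.toReal_sum fun l _ => ENNReal.mul_ne_top (ENNReal.natCast_ne_top l)
      (measure_ne_top _ _)]
    simp only [ENNReal.toReal_mul, ENNReal.toReal_natCast, measureReal_def]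
  have e5 : ∀ j, ((A : ℝ≥0∞) * P {ω | arrSum N j ω < n}ᶜ).toReal =
      A * (1 - P.real {ω | arrSum N j ω < n}) := by
    intro j
    rw [ENNReal.toReal_mul, ENNReal.toReal_natCast, ← measureReal_def,
      probReal_compl_eq_one_sub (hms j)]
  simp_rw [e4, e5] at hreal
  rw [← Finset.mul_sum, Finset.sum_sub_distrib, Finset.sum_const, Finset.card_range, nsmul_eq_mul,
    mul_one] at hreal
  have hren : (n : ℝ) / (∫ ω, (N 0 ω : ℝ) ∂P) ≤
      ∑ j ∈ Finset.range m, P.real {ω | arrSum N j ω < n} + q ^ m / (1 - q) := by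
    refine (h.natCast_div_le_renewal hN hρ hS n).trans ?_
    have h6 := ENNReal.toReal_mono (ENNReal.add_ne_top.2
      ⟨ENNReal.sum_ne_top.2 fun j _ => measure_ne_top _ _, ENNReal.ofReal_ne_top⟩)
      (h.renewal_le hN hq0 hq1 hq hm)
    rwa [ENNReal.toReal_add (ENNReal.sum_ne_top.2 fun j _ => measure_ne_top _ _)
      ENNReal.ofReal_ne_top, ENNReal.toReal_ofReal hq2,
      ENNReal.toReal_sum fun j _ => measure_ne_top _ _] at h6
  have hA : (0 : ℝ) ≤ A := Nat.cast_nonneg A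
  nlinarith [mul_le_mul_of_nonneg_left hren hA]

/-- The backlog accumulated by the first `n` arrivals grows at rate mean backlog divided by mean
number of arrivals. -/
theorem tendsto_accBacklog (hC : ∀ᵐ ω ∂P, ∀ j, 1 ≤ C j ω) (hπ : IsLimitLaw P N C π) :
    Tendsto (fun n : ℕ => (accBacklog P N C n).toReal / n) atTop
      (𝓝 ((∑' l : ℕ, (l : ℝ) * π l) / ∫ ω, (N 0 ω : ℝ) ∂P)) := by
  set ρ := ∫ ω, (N 0 ω : ℝ) ∂P with hρdef
  set H := ∑' l : ℕ, (l : ℝ) * π l with hH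
  have hceil : ∀ b : ℝ, 0 < b → Tendsto (fun n : ℕ => ((⌈b * n⌉₊ : ℕ) : ℝ) / n) atTop (𝓝 b) :=
    fun b hb => (tendsto_nat_ceil_mul_div_atTop hb.le).comp tendsto_natCast_atTop_atTop
  have hceil' : ∀ b : ℝ, 0 < b → Tendsto (fun n : ℕ => ⌈b * (n : ℝ)⌉₊) atTop atTop := fun b hb =>
    tendsto_nat_ceil_atTop.comp (tendsto_natCast_atTop_atTop.const_mul_atTop hb)
  rw [tendsto_order]
  constructor
  · intro a ha
    have hA : ∃ A : ℕ, a < (∑ l ∈ Finset.range (A + 1), (l : ℝ) * π l) / ρ := by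
      have h1 : Tendsto (fun A : ℕ => (∑ l ∈ Finset.range (A + 1), (l : ℝ) * π l) / ρ) atTop
          (𝓝 (H / ρ)) :=
        ((tendsto_add_atTop_iff_nat 1).2 hπ.summable_mean.hasSum.tendsto_sum_nat).div_const ρ
      exact (h1.eventually_const_lt ha).exists
    obtain ⟨A, hA⟩ := hA
    set G := ∑ l ∈ Finset.range (A + 1), (l : ℝ) * π l with hG
    -- The cutoff `A` is fixed first; only then is `b` taken close enough to `1 / ρ` for the penalty
    -- `A * (b - 1 / ρ)` to be harmless.
    have hb : ∃ b : ℝ, 1 / ρ < b ∧ a < b * G - A * (b - 1 / ρ) := by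
      have h1 : Tendsto (fun b : ℝ => b * G - A * (b - 1 / ρ)) (𝓝[>] (1 / ρ))
          (𝓝 (1 / ρ * G - A * (1 / ρ - 1 / ρ))) :=
        (Continuous.tendsto (by fun_prop) _).mono_left nhdsWithin_le_nhds
      rw [sub_self, mul_zero, sub_zero, one_div_mul_eq_div] at h1
      obtain ⟨b, hb1, hb2⟩ := ((h1.eventually_const_lt hA).and self_mem_nhdsWithin).exists
      exact ⟨b, hb2, hb1⟩
    obtain ⟨b, hb1, hb2⟩ := hb
    obtain ⟨hb, q, hq0, hq1, hq⟩ := h.exists_bound_of_inv_lt hN hρ hb1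
    have hg : Tendsto (fun j => ∑ l ∈ Finset.range (A + 1), (l : ℝ) *
        P.real {ω | backlog N C j ω = l}) atTop (𝓝 G) :=
      tendsto_finsetSum _ fun l _ => (hπ.tendsto l).const_mul _
    set g := fun j => ∑ l ∈ Finset.range (A + 1), (l : ℝ) * P.real {ω | backlog N C j ω = l}
    have hlim : Tendsto (fun n : ℕ => ((⌈b * n⌉₊ : ℕ) : ℝ)⁻¹ * (∑ j ∈ Finset.range ⌈b * (n : ℝ)⌉₊,
        g j) * (((⌈b * n⌉₊ : ℕ) : ℝ) / n) - A * (((⌈b * n⌉₊ : ℕ) : ℝ) / n - 1 / ρ +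
        (1 / (1 - q)) / n)) atTop (𝓝 (G * b - A * (b - 1 / ρ + 0))) :=
      ((hg.cesaro.comp (hceil' b hb)).mul (hceil b hb)).sub
        ((((hceil b hb).sub_const _).add (tendsto_const_div_atTop_nhds_zero_nat _)).const_mul _)
    rw [add_zero, mul_comm G] at hlim
    filter_upwards [hlim.eventually_const_lt hb2, eventually_gt_atTop 0] with n hn hn0
    have hn' : (0 : ℝ) < n := by exact_mod_cast hn0
    refine hn.trans_le ?_
    have h1 := h.le_accBacklog hN hρ hS hC hπ hq0 hq1 hq (Nat.le_ceil (b * n)) A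
    have h6 : q ^ ⌈b * n⌉₊ / (1 - q) ≤ 1 / (1 - q) :=
      div_le_div_of_nonneg_right (pow_le_one₀ hq0 hq1.le) (sub_nonneg.2 hq1.le)
    have hm0 : ((⌈b * n⌉₊ : ℕ) : ℝ) ≠ 0 := by
      have : 0 < ⌈b * (n : ℝ)⌉₊ := Nat.ceil_pos.2 (by positivity)
      exact_mod_cast this.ne'
    rw [le_div_iff₀ hn']
    have e1 : (((⌈b * n⌉₊ : ℕ) : ℝ)⁻¹ * (∑ j ∈ Finset.range ⌈b * (n : ℝ)⌉₊, g j) *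
        (((⌈b * n⌉₊ : ℕ) : ℝ) / n) - A * (((⌈b * n⌉₊ : ℕ) : ℝ) / n - 1 / ρ + (1 / (1 - q)) / n)) *
        n = (∑ j ∈ Finset.range ⌈b * (n : ℝ)⌉₊, g j) -
          A * (((⌈b * n⌉₊ : ℕ) : ℝ) - n / ρ + 1 / (1 - q)) := by
      have hq3 : 1 - q ≠ 0 := (sub_pos.2 hq1).ne'
      field_simp
    rw [e1]
    refine le_trans ?_ h1
    have hA0 : (0 : ℝ) ≤ A := Nat.cast_nonneg A
    have := mul_le_mul_of_nonneg_left h6 hA0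
    simp only [g]
    linarith
  · intro a ha
    have hb : ∃ b : ℝ, 1 / ρ < b ∧ b * H < a := by
      have h1 : Tendsto (fun b : ℝ => b * H) (𝓝[>] (1 / ρ)) (𝓝 (1 / ρ * H)) :=
        (Continuous.tendsto (by fun_prop) _).mono_left nhdsWithin_le_nhds
      rw [one_div_mul_eq_div] at h1
      obtain ⟨b, hb1, hb2⟩ := ((h1.eventually_lt_const ha).and self_mem_nhdsWithin).exists
      exact ⟨b, hb2, hb1⟩
    obtain ⟨b, hb1, hb2⟩ := hb
    obtain ⟨hb, q, hq0, hq1, hq⟩ := h.exists_bound_of_inv_lt hN hρ hb1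
    have hlim : Tendsto (fun n : ℕ => ((⌈b * n⌉₊ : ℕ) : ℝ) / n * H +
        (∑' l, ((min l n : ℕ) : ℝ) ^ 2 * π l) / n + 2 / (b * (1 - q)) *
        (((⌈b * n⌉₊ : ℕ) : ℝ) * q ^ ⌈b * (n : ℝ)⌉₊)) atTop
        (𝓝 (b * H + 0 + 2 / (b * (1 - q)) * 0)) :=
      (((hceil b hb).mul_const H).add hπ.tendsto_min_sq).add
        (((tendsto_self_mul_const_pow_of_lt_one hq0 hq1).comp (hceil' b hb)).const_mul _)
    rw [add_zero, mul_zero, add_zero] at hlim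
    filter_upwards [hlim.eventually_lt_const hb2, eventually_gt_atTop 0] with n hn hn0
    have hn' : (0 : ℝ) < n := by exact_mod_cast hn0
    refine lt_of_le_of_lt ?_ hn
    have hq3 : 0 < 1 - q := sub_pos.2 hq1
    have hH0 : 0 ≤ H := tsum_nonneg fun l => mul_nonneg (Nat.cast_nonneg l) (hπ.nonneg l)
    have hM0 : 0 ≤ ∑' l, ((min l n : ℕ) : ℝ) ^ 2 * π l :=
      tsum_nonneg fun l => mul_nonneg (sq_nonneg _) (hπ.nonneg l)
    have h1 := ENNReal.toReal_le_of_le_ofReal (by positivity)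
      (h.accBacklog_le hN hρ hS hC hπ hq0 hq1 hq (Nat.le_ceil (b * n)))
    rw [div_le_iff₀ hn']
    refine h1.trans ?_
    have h2 : b * n ≤ ⌈b * (n : ℝ)⌉₊ := Nat.le_ceil _
    -- One factor `n` is traded for the number `⌈b * n⌉₊` of servers, so that the error becomes `n`
    -- times a null sequence of the form `m * q ^ m`.
    have h3 : (n : ℝ) ≤ ((⌈b * n⌉₊ : ℕ) : ℝ) / b := by rw [le_div_iff₀ hb]; linarith
    have h4 : 2 * (n : ℝ) ^ 2 * (q ^ ⌈b * (n : ℝ)⌉₊ / (1 - q)) ≤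
        2 / (b * (1 - q)) * (((⌈b * n⌉₊ : ℕ) : ℝ) * q ^ ⌈b * (n : ℝ)⌉₊) * n := by
      have h5 : 0 ≤ q ^ ⌈b * (n : ℝ)⌉₊ / (1 - q) := div_nonneg (pow_nonneg hq0 _) hq3.le
      calc 2 * (n : ℝ) ^ 2 * (q ^ ⌈b * (n : ℝ)⌉₊ / (1 - q)) =
            2 * n * (q ^ ⌈b * (n : ℝ)⌉₊ / (1 - q)) * n := by ring
        _ ≤ 2 * n * (q ^ ⌈b * (n : ℝ)⌉₊ / (1 - q)) * (((⌈b * n⌉₊ : ℕ) : ℝ) / b) := by gcongr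
        _ = _ := by
          field_simp
    have e1 : (((⌈b * n⌉₊ : ℕ) : ℝ) / n * H + (∑' l, ((min l n : ℕ) : ℝ) ^ 2 * π l) / n +
        2 / (b * (1 - q)) * (((⌈b * n⌉₊ : ℕ) : ℝ) * q ^ ⌈b * (n : ℝ)⌉₊)) * n =
        ((⌈b * n⌉₊ : ℕ) : ℝ) * H + (∑' l, ((min l n : ℕ) : ℝ) ^ 2 * π l) +
        2 / (b * (1 - q)) * (((⌈b * n⌉₊ : ℕ) : ℝ) * q ^ ⌈b * (n : ℝ)⌉₊) * n := by
      rw [add_mul, add_mul, div_mul_cancel₀ _ hn'.ne', div_mul_eq_mul_div,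
        div_mul_cancel₀ _ hn'.ne']
    rw [e1]
    linarith

end IsQueue

end

section

/-! ### Distances to the next server -/

/-- Fubini: `b - r i` is the length of the set of `x` in the gap beyond `r i`. Hence the mean
distance needs only mean counts of the Poisson process, not the conditional distribution of its
points. -/
lemma gapDist_eq_lintegral {r : ℕ → ℝ} (htop : Tendsto r atTop atTop) (a b : ℝ) :
    gapDist r a b = ∫⁻ x in Set.Ioc a b, (count r a x : ℝ≥0∞) := by
  simp_rw [← tsum_indicator_eq_count htop]
  have hmeas : ∀ i, Measurable fun x => if a < r i ∧ r i ≤ x then (1 : ℝ≥0∞) else 0 := fun i =>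
    Measurable.ite (measurableSet_gap measurable_const measurable_const measurable_id)
      measurable_const measurable_const
  rw [lintegral_tsum fun i => (hmeas i).aemeasurable]
  refine tsum_congr fun i => ?_
  have h1 : ∀ x, (if a < r i ∧ r i ≤ x then (1 : ℝ≥0∞) else 0) =
      {x | a < r i ∧ r i ≤ x}.indicator 1 x := fun x => by simp [Set.indicator_apply]
  simp_rw [h1]
  have hm : MeasurableSet {x | a < r i ∧ r i ≤ x} :=
    measurableSet_gap measurable_const measurable_const measurable_id
  rw [lintegral_indicator_one hm, Measure.restrict_apply hm]
  split_ifs with hi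
  · have : {x | a < r i ∧ r i ≤ x} ∩ Set.Ioc a b = Set.Icc (r i) b := by
      ext x
      simp only [Set.mem_inter_iff, Set.mem_ofPred_eq, Set.mem_Ioc, Set.mem_Icc]
      constructor
      · rintro ⟨⟨-, h2⟩, -, h3⟩
        exact ⟨h2, h3⟩
      · rintro ⟨h2, h3⟩
        exact ⟨⟨hi.1, h2⟩, hi.1.trans_le h2, h3⟩
    rw [this, Real.volume_Icc]
  · have : {x | a < r i ∧ r i ≤ x} ∩ Set.Ioc a b = ∅ := by
      ext x
      simp only [Set.mem_inter_iff, Set.mem_ofPred_eq, Set.mem_Ioc, Set.mem_empty_iff_false,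
        iff_false]
      rintro ⟨⟨h2, h3⟩, -, h4⟩
      exact hi ⟨h2, h3.trans h4⟩
    rw [this, measure_empty]

lemma gapDist_le {r : ℕ → ℝ} (htop : Tendsto r atTop atTop) (a b : ℝ) :
    gapDist r a b ≤ ENNReal.ofReal (b - a) * count r a b := by
  rw [← tsum_indicator_eq_count htop, ← ENNReal.tsum_mul_left]
  refine ENNReal.tsum_le_tsum fun i => ?_
  split_ifs with hi
  · rw [mul_one]
    exact ENNReal.ofReal_le_ofReal (by linarith [hi.1])
  · exact zero_le

lemma lintegral_Ioc_linear {lam a b : ℝ} (hlam : 0 < lam) (hab : a ≤ b) :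
    ∫⁻ x in Set.Ioc a b, ENNReal.ofReal (lam * (x - a)) = ENNReal.ofReal (lam * (b - a) ^ 2 / 2) := by
  rw [← ofReal_integral_eq_lintegral_ofReal]
  · congr 1
    rw [← intervalIntegral.integral_of_le hab]
    rw [intervalIntegral.integral_const_mul,
      intervalIntegral.integral_comp_sub_right (fun x => x) a, integral_id]
    ring
  · exact (Continuous.integrableOn_Ioc (by fun_prop))
  · refine (ae_restrict_iff' measurableSet_Ioc).2 (ae_of_all _ fun x hx => ?_)
    exact mul_nonneg hlam.le (sub_nonneg.2 hx.1.le)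

namespace IsNetwork

variable {Ω : Type*} [MeasurableSpace Ω] {P : Measure Ω} [IsProbabilityMeasure P] {lam : ℝ}
  {ν : Measure ℝ} [IsProbabilityMeasure ν] {p : ℕ → ℝ} {r X : ℕ → Ω → ℝ} {C : ℕ → Ω → ℕ} {c : ℕ}

variable (h : IsNetwork P lam ν p r X C) (hlam : 0 < lam)

include h hlam

lemma lintegral_count_mul {a x : ℝ} (ha : 0 ≤ a) (hx : a ≤ x) (g : ℕ → ℝ≥0∞) :
    ∫⁻ ω, (count (fun i => r i ω) a x : ℝ≥0∞) * g (count (fun i => r i ω) 0 a) ∂P =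
      ENNReal.ofReal (lam * (x - a)) * ∫⁻ ω, g (count (fun i => r i ω) 0 a) ∂P := by
  -- The grid `0, a, x, x, ...` turns the independence of grid counts into independence of the past
  -- `(0, a]` and the interval `(a, x]`.
  set t : ℕ → ℝ := fun n => if n = 0 then 0 else if n = 1 then a else x with ht
  have ht0 : t 0 = 0 := rfl
  have ht1 : t 1 = a := rfl
  have ht2 : t 2 = x := rfl
  have hmono : Monotone t := by
    refine monotone_nat_of_le_succ fun n => ?_
    match n with
    | 0 => rw [ht0, ht1]; exact ha
    | 1 => rw [ht1, ht2]; exact hx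
    | n + 2 => exact le_of_eq (by simp [ht])
  have hind := (h.poisson.indep t ht0.ge hmono).indepFun (show (1 : ℕ) ≠ 0 by norm_num)
  simp only [ht0, ht1, zero_add, Nat.reduceAdd, ht2] at hind
  have hm : ∀ a b : ℝ, Measurable fun ω => count (fun i => r i ω) a b := fun a b =>
    measurable_count h.measurable_requests measurable_const measurable_const
  have hf : Measurable fun n : ℕ => (n : ℝ≥0∞) := measurable_of_countable _
  have h1 := lintegral_mul_eq_lintegral_mul_lintegral_of_indepFun'' (hf.comp (hm a x)).aemeasurable
    ((measurable_of_countable g).comp (hm 0 a)).aemeasurable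
    (hind.comp hf (measurable_of_countable g))
  refine h1.trans ?_
  simp only [Function.comp_def]
  congr 1
  rw [h.lintegral_count ha hx (fun n => (n : ℝ≥0∞))]
  have h2 := lintegral_gapLaw_ofReal (mul_nonneg hlam.le (sub_nonneg.2 hx))
    (f := fun v : ℕ => (v : ℝ)) (fun v => Nat.cast_nonneg v) (hasSum_mul_poissonWeight _)
  simpa only [ENNReal.ofReal_natCast] using h2

lemma lintegral_gapDist_mul {a b : ℝ} (ha : 0 ≤ a) (hab : a ≤ b) (g : ℕ → ℝ≥0∞) :
    ∫⁻ ω, gapDist (fun i => r i ω) a b * g (count (fun i => r i ω) 0 a) ∂P =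
      ENNReal.ofReal (lam * (b - a) ^ 2 / 2) * ∫⁻ ω, g (count (fun i => r i ω) 0 a) ∂P := by
  have hm : Measurable fun q : Ω × ℝ => (count (fun i => r i q.1) a q.2 : ℝ≥0∞) *
      g (count (fun i => r i q.1) 0 a) := by
    refine Measurable.mul ?_ ?_
    · exact (measurable_of_countable fun n : ℕ => (n : ℝ≥0∞)).comp (measurable_count
        (h.measurable_requests.comp measurable_fst) measurable_const measurable_snd)
    · exact (measurable_of_countable g).comp (measurable_count
        (h.measurable_requests.comp measurable_fst) measurable_const measurable_const)
  have h1 : ∫⁻ ω, gapDist (fun i => r i ω) a b * g (count (fun i => r i ω) 0 a) ∂P =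
      ∫⁻ ω, (∫⁻ x in Set.Ioc a b, (count (fun i => r i ω) a x : ℝ≥0∞) *
        g (count (fun i => r i ω) 0 a)) ∂P := by
    refine lintegral_congr_ae ?_
    filter_upwards [h.poisson.locallyFinite] with ω hω
    rw [gapDist_eq_lintegral hω, lintegral_mul_const]
    exact (measurable_of_countable fun n : ℕ => (n : ℝ≥0∞)).comp
      (measurable_count measurable_const measurable_const measurable_id)
  rw [h1, lintegral_lintegral_swap hm.aemeasurable, setLIntegral_congr_fun measurableSet_Ioc
    (fun x hx => h.lintegral_count_mul hlam ha hx.1.le g), lintegral_mul_const,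
    lintegral_Ioc_linear hlam hab]
  fun_prop

variable (hν : ν (Set.Iio 0) = 0)

include hν

lemma indepFun_grid_dist (j : ℕ) : IndepFun (fun ω => grid (fun k => X k ω) j) (X j) P := by
  have hind : iIndepFun X P := h.indep_servers.comp (fun _ q => q.1) fun _ => measurable_fst
  exact indepFun_past hind h.measurable_dist (f := fun z => grid z j)
    (Finset.measurable_fun_sum _ fun k _ => measurable_pi_apply k) fun z z' hz =>
      Finset.sum_congr rfl fun i hi => hz i (Finset.mem_range.1 hi)

/-- Expected distance to server `j` of the requests in its gap, jointly with the earlier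
requests. -/
lemma lintegral_gapDist_grid (hsq : MemLp id 2 ν) (j : ℕ) (g : ℕ → ℝ≥0∞) :
    ∫⁻ ω, gapDist (fun i => r i ω) (grid (fun k => X k ω) j) (grid (fun k => X k ω) (j + 1)) *
      g (count (fun i => r i ω) 0 (grid (fun k => X k ω) j)) ∂P =
      ENNReal.ofReal (lam / 2 * ∫ x, x ^ 2 ∂ν) *
        ∫⁻ ω, g (count (fun i => r i ω) 0 (grid (fun k => X k ω) j)) ∂P := by
  have hg : ∀ n, Measurable fun q : (ℕ → ℝ) × (ℕ → ℝ × ℕ) => grid (fun k => (q.2 k).1) n := by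
    intro n
    unfold grid
    fun_prop
  have hψ : Measurable fun y => ∫⁻ v, g v ∂gapLaw lam y :=
    measurable_lintegral_gapLaw lam measurable_id fun v => measurable_const
  have hΦ1 : Measurable fun q : (ℕ → ℝ) × (ℕ → ℝ × ℕ) =>
      g (count q.1 0 (grid (fun k => (q.2 k).1) j)) :=
    (measurable_of_countable g).comp (measurable_count measurable_fst measurable_const (hg j))
  have hΦ2 : Measurable fun q : (ℕ → ℝ) × (ℕ → ℝ × ℕ) =>
      gapDist q.1 (grid (fun k => (q.2 k).1) j) (grid (fun k => (q.2 k).1) (j + 1)) *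
      g (count q.1 0 (grid (fun k => (q.2 k).1) j)) :=
    (measurable_gapDist measurable_fst (hg j) (hg (j + 1))).mul hΦ1
  have h1 := h.lintegral_requests_servers hΦ1
  have h2 := h.lintegral_requests_servers hΦ2
  simp only at h1 h2
  have h0 : ∀ᵐ ω ∂P, 0 ≤ grid (fun k => X k ω) j ∧ 0 ≤ X j ω := by
    filter_upwards [h.ae_dist_nonneg hν] with ω hω
    exact ⟨Finset.sum_nonneg fun k _ => hω k, hω j⟩
  have h3 : ∫⁻ ω, ∫⁻ ω', g (count (fun i => r i ω') 0 (grid (fun k => X k ω) j)) ∂P ∂P =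
      ∫⁻ ω, ∫⁻ v, g v ∂gapLaw lam (grid (fun k => X k ω) j) ∂P := by
    refine lintegral_congr_ae ?_
    filter_upwards [h0] with ω hω
    rw [h.lintegral_count le_rfl hω.1 g, sub_zero]
  have h4 : ∫⁻ ω, ∫⁻ ω', gapDist (fun i => r i ω') (grid (fun k => X k ω) j)
      (grid (fun k => X k ω) (j + 1)) *
      g (count (fun i => r i ω') 0 (grid (fun k => X k ω) j)) ∂P ∂P =
      ∫⁻ ω, ENNReal.ofReal (lam * X j ω ^ 2 / 2) *
        ∫⁻ v, g v ∂gapLaw lam (grid (fun k => X k ω) j) ∂P := by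
    refine lintegral_congr_ae ?_
    filter_upwards [h0] with ω hω
    rw [h.lintegral_gapDist_mul hlam hω.1 (by rw [grid_succ]; linarith [hω.2]) g,
      h.lintegral_count le_rfl hω.1 g, sub_zero, grid_succ, add_sub_cancel_left]
  have hq : Measurable fun x : ℝ => ENNReal.ofReal (lam * x ^ 2 / 2) := by fun_prop
  have h5 := lintegral_mul_eq_lintegral_mul_lintegral_of_indepFun''
    (hq.comp (h.measurable_dist j)).aemeasurable (hψ.comp (h.measurable_grid j)).aemeasurable
    ((h.indepFun_grid_dist hlam hν j).symm.comp hq hψ)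
  simp only [Function.comp_def] at h5
  have h6 : ∫⁻ ω, ENNReal.ofReal (lam * X j ω ^ 2 / 2) ∂P =
      ENNReal.ofReal (lam / 2 * ∫ x, x ^ 2 ∂ν) := by
    rw [← lintegral_map (f := fun x => ENNReal.ofReal (lam * x ^ 2 / 2)) hq (h.measurable_dist j),
      h.law_dist, ← integral_const_mul, ← ofReal_integral_eq_lintegral_ofReal]
    · congr 1
      refine integral_congr_ae (ae_of_all _ fun x => ?_)
      simp only
      ring
    · exact (hsq.integrable_sq.const_mul lam).div_const 2
    · exact ae_of_all _ fun x => by positivity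
  refine h2.trans (h4.trans (h5.trans ?_))
  rw [h6, ← h3]
  exact congrArg _ h1.symm

lemma arrSum_eq_count {ω : Ω}
    (hω : IsRegularPath (fun i => r i ω) (fun k => X k ω) (fun j => C j ω)) (j : ℕ) :
    IsQueue.arrSum (arrivals r X) j ω =
      count (fun i => r i ω) 0 (grid (fun k => X k ω) j) :=
  sum_count hω.pos hω.mono hω.tendsto_req (grid_zero _) (grid_mono hω.dist_nonneg) j

lemma exists_le_arrSum {ω : Ω}
    (hω : IsRegularPath (fun i => r i ω) (fun k => X k ω) (fun j => C j ω)) (n : ℕ) :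
    ∃ M, n ≤ IsQueue.arrSum (arrivals r X) M ω := by
  obtain ⟨M, hM⟩ := (hω.tendsto_grid.eventually_ge_atTop (r n ω)).exists
  refine ⟨M, ?_⟩
  rw [h.arrSum_eq_count hlam hν hω]
  exact ((lt_count_iff hω.pos hω.mono hω.tendsto_req n _).2 hM).le

/-- Expected total distance of the first `n` requests to the next server. -/
def _root_.HetPRGS.meanResidual (P : Measure Ω) (r X : ℕ → Ω → ℝ) (n : ℕ) : ℝ≥0∞ :=
  ∫⁻ ω, ∑ i ∈ Finset.range n, residual (fun i => r i ω) (grid fun k => X k ω) i ∂P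

/-- Contribution of the gaps with many arrivals. -/
def _root_.HetPRGS.largeGap (P : Measure Ω) (r X : ℕ → Ω → ℝ) (L : ℕ) : ℝ≥0∞ :=
  ∫⁻ ω, ENNReal.ofReal (X 0 ω) * (if L < arrivals r X 0 ω then (arrivals r X 0 ω : ℝ≥0∞) else 0) ∂P

lemma measurable_gapDist_grid (j : ℕ) : Measurable fun ω =>
    gapDist (fun i => r i ω) (grid (fun k => X k ω) j) (grid (fun k => X k ω) (j + 1)) :=
  measurable_gapDist h.measurable_requests (h.measurable_grid j) (h.measurable_grid (j + 1))

lemma measurable_count_grid (j : ℕ) : Measurable fun ω =>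
    count (fun i => r i ω) 0 (grid (fun k => X k ω) j) :=
  measurable_count h.measurable_requests measurable_const (h.measurable_grid j)

lemma lintegral_indicator_count (hp : IsCapacityLaw c p) (hint : Integrable (fun x => x) ν)
    (hpos : 0 < ∫ x, x ∂ν) (j n : ℕ) :
    ∫⁻ ω, (if count (fun i => r i ω) 0 (grid (fun k => X k ω) j) < n then (1 : ℝ≥0∞) else 0) ∂P =
      P {ω | IsQueue.arrSum (arrivals r X) j ω < n} := by
  rw [← lintegral_indicator_one (measurableSet_lt
    ((h.isQueue hν hlam hp).measurable_arrSum j) measurable_const)]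
  refine lintegral_congr_ae ?_
  filter_upwards [h.ae_isRegularPath hν hp hint hpos] with ω hω
  rw [← h.arrSum_eq_count hlam hν hω]
  simp [Set.indicator_apply]

lemma meanResidual_le (hp : IsCapacityLaw c p) (hsq : MemLp id 2 ν) (hpos : 0 < ∫ x, x ∂ν) (n : ℕ) :
    meanResidual P r X n ≤ ENNReal.ofReal (lam / 2 * ∫ x, x ^ 2 ∂ν) *
      IsQueue.renewal P (arrivals r X) n := by
  have hint : Integrable (fun x => x) ν := hsq.integrable one_le_two
  have h1 : meanResidual P r X n ≤ ∫⁻ ω, ∑' j, gapDist (fun i => r i ω) (grid (fun k => X k ω) j)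
      (grid (fun k => X k ω) (j + 1)) *
      (if count (fun i => r i ω) 0 (grid (fun k => X k ω) j) < n then 1 else 0) ∂P := by
    refine lintegral_mono_ae ?_
    filter_upwards [h.ae_isRegularPath hν hp hint hpos] with ω hω
    simp_rw [mul_ite, mul_one, mul_zero]
    exact sum_residual_le hω.pos hω.mono hω.tendsto_req _ n
  have mI : Measurable fun s : ℕ => if s < n then (1 : ℝ≥0∞) else 0 := measurable_of_countable _
  have mG : ∀ j, Measurable fun ω => gapDist (fun i => r i ω) (grid (fun k => X k ω) j)
      (grid (fun k => X k ω) (j + 1)) *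
      (if count (fun i => r i ω) 0 (grid (fun k => X k ω) j) < n then (1 : ℝ≥0∞) else 0) := fun j =>
    (h.measurable_gapDist_grid hlam hν j).mul (mI.comp (h.measurable_count_grid hlam hν j))
  refine h1.trans (le_of_eq ?_)
  rw [lintegral_tsum fun j => (mG j).aemeasurable, IsQueue.renewal, ← ENNReal.tsum_mul_left]
  refine tsum_congr fun j => ?_
  rw [h.lintegral_gapDist_grid hlam hν hsq j fun s => if s < n then 1 else 0,
    h.lintegral_indicator_count hlam hν hp hint hpos]

lemma lintegral_largeGap (j n L : ℕ) :
    ∫⁻ ω, ENNReal.ofReal (X j ω) * (if L < arrivals r X j ω then (arrivals r X j ω : ℝ≥0∞) else 0) *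
      (if IsQueue.arrSum (arrivals r X) j ω < n then 1 else 0) ∂P =
      largeGap P r X L * P {ω | IsQueue.arrSum (arrivals r X) j ω < n} := by
  have hF : Measurable fun q : ℝ × ℕ × ℕ => ENNReal.ofReal q.1 *
      (if L < q.2.1 then (q.2.1 : ℝ≥0∞) else 0) :=
    (ENNReal.measurable_ofReal.comp measurable_fst).mul
      ((measurable_of_countable fun n : ℕ => if L < n then (n : ℝ≥0∞) else 0).comp
        (measurable_fst.comp measurable_snd))
  have hS : Measurable fun z : ℕ → ℝ × ℕ × ℕ => ∑ i ∈ Finset.range j, (z i).2.1 :=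
    Finset.measurable_fun_sum _ fun i _ =>
      measurable_fst.comp (measurable_snd.comp (measurable_pi_apply i))
  have hI : Measurable fun s : ℕ => if s < n then (1 : ℝ≥0∞) else 0 := measurable_of_countable _
  have hind := indepFun_past (h.iIndepFun_gapData hν) h.measurable_gapData (n := j) hS
    fun z z' hz => Finset.sum_congr rfl fun i hi => by rw [hz i (Finset.mem_range.1 hi)]
  have h1 := lintegral_mul_eq_lintegral_mul_lintegral_of_indepFun''
    (hF.comp (h.measurable_gapData j)).aemeasurable
    (hI.comp (hS.comp (measurable_pi_lambda _ h.measurable_gapData))).aemeasurable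
    (hind.symm.comp hF hI)
  refine h1.trans ?_
  congr 1
  · exact ((h.identDistrib_gapData hν j).comp hF).lintegral_eq
  · rw [← lintegral_indicator_one (measurableSet_lt (Finset.measurable_fun_sum _ fun i _ =>
      h.measurable_arrivals i) measurable_const)]
    refine lintegral_congr fun ω => ?_
    simp [Set.indicator_apply, gapData]

/-- A gap that begins before `n` arrivals and holds at most `L` requests is completed by the first
`n + L` requests. The remaining gaps are charged to `largeGap`, bounding their distance by length
times number of requests. -/
lemma le_meanResidual (hp : IsCapacityLaw c p) (hsq : MemLp id 2 ν) (hpos : 0 < ∫ x, x ∂ν)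
    (n L : ℕ) :
    ENNReal.ofReal (lam / 2 * ∫ x, x ^ 2 ∂ν) * IsQueue.renewal P (arrivals r X) n ≤
      meanResidual P r X (n + L) + largeGap P r X L * IsQueue.renewal P (arrivals r X) n := by
  have hint : Integrable (fun x => x) ν := hsq.integrable one_le_two
  have mI : Measurable fun s : ℕ => if s < n then (1 : ℝ≥0∞) else 0 := measurable_of_countable _
  have hq := h.isQueue hν hlam hp
  have mG : ∀ j, Measurable fun ω => gapDist (fun i => r i ω) (grid (fun k => X k ω) j)
      (grid (fun k => X k ω) (j + 1)) *
      (if count (fun i => r i ω) 0 (grid (fun k => X k ω) j) < n then (1 : ℝ≥0∞) else 0) := fun j =>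
    (h.measurable_gapDist_grid hlam hν j).mul (mI.comp (h.measurable_count_grid hlam hν j))
  have mL : ∀ j, Measurable fun ω => ENNReal.ofReal (X j ω) *
      (if L < arrivals r X j ω then (arrivals r X j ω : ℝ≥0∞) else 0) *
      (if IsQueue.arrSum (arrivals r X) j ω < n then 1 else 0) := fun j =>
    ((ENNReal.measurable_ofReal.comp (h.measurable_dist j)).mul
      ((measurable_of_countable fun n : ℕ => if L < n then (n : ℝ≥0∞) else 0).comp
        (h.measurable_arrivals j))).mul (mI.comp (hq.measurable_arrSum j))
  have e1 : ENNReal.ofReal (lam / 2 * ∫ x, x ^ 2 ∂ν) * IsQueue.renewal P (arrivals r X) n =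
      ∫⁻ ω, ∑' j, gapDist (fun i => r i ω) (grid (fun k => X k ω) j)
      (grid (fun k => X k ω) (j + 1)) *
      (if count (fun i => r i ω) 0 (grid (fun k => X k ω) j) < n then (1 : ℝ≥0∞) else 0) ∂P := by
    rw [lintegral_tsum fun j => (mG j).aemeasurable, IsQueue.renewal, ← ENNReal.tsum_mul_left]
    refine tsum_congr fun j => ?_
    rw [h.lintegral_gapDist_grid hlam hν hsq j fun s => if s < n then 1 else 0,
      h.lintegral_indicator_count hlam hν hp hint hpos]
  have e2 : largeGap P r X L * IsQueue.renewal P (arrivals r X) n =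
      ∫⁻ ω, ∑' j, ENNReal.ofReal (X j ω) *
      (if L < arrivals r X j ω then (arrivals r X j ω : ℝ≥0∞) else 0) *
      (if IsQueue.arrSum (arrivals r X) j ω < n then 1 else 0) ∂P := by
    rw [lintegral_tsum fun j => (mL j).aemeasurable, IsQueue.renewal, ← ENNReal.tsum_mul_left]
    exact tsum_congr fun j => (h.lintegral_largeGap hlam hν j n L).symm
  rw [e1, e2, meanResidual, ← lintegral_add_right _ (Measurable.tsum mL)]
  refine lintegral_mono_ae ?_
  filter_upwards [h.ae_isRegularPath hν hp hint hpos] with ω hω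
  have h1 := le_sum_residual hω.pos hω.mono hω.tendsto_req (grid fun k => X k ω) (n + L)
  refine le_trans ?_ (add_le_add_left h1 _)
  rw [← ENNReal.tsum_add]
  refine ENNReal.tsum_le_tsum fun j => ?_
  rw [← h.arrSum_eq_count hlam hν hω, ← h.arrSum_eq_count hlam hν hω]
  by_cases h2 : IsQueue.arrSum (arrivals r X) j ω < n
  · rw [if_pos h2, mul_one, mul_one]
    by_cases h3 : L < arrivals r X j ω
    · refine le_trans ?_ le_add_self
      rw [if_pos h3]
      have h4 := gapDist_le hω.tendsto_req (grid (fun k => X k ω) j) (grid (fun k => X k ω) (j + 1))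
      rwa [grid_succ, add_sub_cancel_left, ← grid_succ] at h4
    · refine le_trans ?_ le_self_add
      rw [if_pos]
      rw [IsQueue.arrSum, Finset.sum_range_succ]
      rw [IsQueue.arrSum] at h2
      omega
  · rw [if_neg h2, mul_zero]
    exact zero_le

/-- The product of gap length and arrivals has mean `lam E[X²]`, which is finite, so dominated
convergence applies. -/
lemma tendsto_largeGap (hsq : MemLp id 2 ν) :
    Tendsto (largeGap P r X) atTop (𝓝 0) := by
  have h1 := h.lintegral_arrivals hν hlam 0 (g := fun x => max x 0) (by fun_prop)
    (fun x => le_max_right _ _) (f := fun v => (v : ℝ)) (fun v => Nat.cast_nonneg v)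
    hasSum_mul_poissonWeight
  have hfin : ∫⁻ ω, ENNReal.ofReal (X 0 ω) * (arrivals r X 0 ω : ℝ≥0∞) ∂P ≠ ⊤ := by
    have e1 : ∫⁻ ω, ENNReal.ofReal (X 0 ω) * (arrivals r X 0 ω : ℝ≥0∞) ∂P =
        ∫⁻ ω, ENNReal.ofReal (max (X 0 ω) 0 * (arrivals r X 0 ω : ℝ)) ∂P := by
      refine lintegral_congr fun ω => ?_
      rw [ENNReal.ofReal_mul (le_max_right _ _), ENNReal.ofReal_natCast]
      congr 1
      rcases le_total (X 0 ω) 0 with h2 | h2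
      · rw [max_eq_right h2, ENNReal.ofReal_of_nonpos h2, ENNReal.ofReal_zero]
      · rw [max_eq_left h2]
    rw [e1, h1]
    have h2 : Integrable (fun x => lam * x ^ 2) ν := hsq.integrable_sq.const_mul lam
    have h3 := h2.2
    rw [hasFiniteIntegral_iff_norm] at h3
    refine (lt_of_le_of_lt (lintegral_mono_ae ?_) h3).ne
    filter_upwards [ae_nonneg_of_measure_Iio hν] with x hx
    refine ENNReal.ofReal_le_ofReal ?_
    rw [max_eq_left hx, Real.norm_of_nonneg (by positivity)]
    exact le_of_eq (by ring)
  have hm : ∀ L : ℕ, Measurable fun ω => ENNReal.ofReal (X 0 ω) *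
      (if L < arrivals r X 0 ω then (arrivals r X 0 ω : ℝ≥0∞) else 0) := fun L =>
    (ENNReal.measurable_ofReal.comp (h.measurable_dist 0)).mul
      ((measurable_of_countable fun n : ℕ => if L < n then (n : ℝ≥0∞) else 0).comp
        (h.measurable_arrivals 0))
  have h2 := tendsto_lintegral_of_dominated_convergence (μ := P) (F := fun (L : ℕ) ω =>
    ENNReal.ofReal (X 0 ω) * (if L < arrivals r X 0 ω then (arrivals r X 0 ω : ℝ≥0∞) else 0))
    (f := fun _ => 0) (fun ω => ENNReal.ofReal (X 0 ω) * (arrivals r X 0 ω : ℝ≥0∞)) hm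
    (fun L => ae_of_all _ fun ω => by
      simp only
      split_ifs
      · exact le_rfl
      · simp) hfin (ae_of_all _ fun ω => by
      refine tendsto_const_nhds.congr' ?_
      filter_upwards [eventually_ge_atTop (arrivals r X 0 ω)] with L hL
      rw [if_neg (not_lt.2 hL), mul_zero])
  simp only [lintegral_zero] at h2
  exact h2

lemma meanResidual_ne_top (hp : IsCapacityLaw c p) (hsq : MemLp id 2 ν) (hpos : 0 < ∫ x, x ∂ν)
    (n : ℕ) : meanResidual P r X n ≠ ⊤ := by
  refine ne_top_of_le_ne_top (ENNReal.mul_ne_top ENNReal.ofReal_ne_top ?_)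
    (h.meanResidual_le hlam hν hp hsq hpos n)
  refine (h.isQueue hν hlam hp).renewal_ne_top (h.memLp_arrivals hν hlam hsq 0) ?_ n
  rw [h.integral_arrivals hν hlam hsq]
  exact mul_pos hlam hpos

/-- The distances to the next server grow linearly. -/
theorem tendsto_meanResidual (hp : IsCapacityLaw c p) (hsq : MemLp id 2 ν) (hpos : 0 < ∫ x, x ∂ν) :
    Tendsto (fun n : ℕ => (meanResidual P r X n).toReal / n) atTop
      (𝓝 ((lam / 2 * ∫ x, x ^ 2 ∂ν) / (lam * ∫ x, x ∂ν))) := by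
  have hint : Integrable (fun x => x) ν := hsq.integrable one_le_two
  have hq := h.isQueue hν hlam hp
  have hN := h.memLp_arrivals hν hlam hsq 0
  have hS : ∀ᵐ ω ∂P, ∀ n, ∃ M, n ≤ IsQueue.arrSum (arrivals r X) M ω := by
    filter_upwards [h.ae_isRegularPath hν hp hint hpos] with ω hω
    exact h.exists_le_arrSum hlam hν hω
  have hEN := h.integral_arrivals hν hlam hsq 0
  have hρ : 0 < ∫ ω, (arrivals r X 0 ω : ℝ) ∂P := by rw [hEN]; exact mul_pos hlam hpos
  have hT := hq.tendsto_renewal hN hρ hS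
  have hTfin := hq.renewal_ne_top hN hρ
  rw [hEN] at hT
  set ρ := lam * ∫ x, x ∂ν with hρdef
  set γ := lam / 2 * ∫ x, x ^ 2 ∂ν with hγ
  have hγ0 : 0 ≤ γ := mul_nonneg (by positivity) (integral_nonneg fun x => sq_nonneg x)
  have hRfin := h.meanResidual_ne_top hlam hν hp hsq hpos
  have hup : ∀ n, (meanResidual P r X n).toReal ≤
      γ * (IsQueue.renewal P (arrivals r X) n).toReal := by
    intro n
    have := ENNReal.toReal_mono (ENNReal.mul_ne_top ENNReal.ofReal_ne_top (hTfin n))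
      (h.meanResidual_le hlam hν hp hsq hpos n)
    rwa [ENNReal.toReal_mul, ENNReal.toReal_ofReal hγ0] at this
  rw [tendsto_order]
  constructor
  · intro a ha
    have hε : Tendsto (fun L => (largeGap P r X L).toReal) atTop (𝓝 0) := by
      have := (ENNReal.tendsto_toReal ENNReal.zero_ne_top).comp (h.tendsto_largeGap hlam hν hsq)
      simpa [Function.comp_def] using this
    have hε2 : Tendsto (fun L => (γ - (largeGap P r X L).toReal) * (1 / ρ)) atTop
        (𝓝 ((γ - 0) * (1 / ρ))) := (tendsto_const_nhds.sub hε).mul_const _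
    rw [sub_zero, mul_one_div] at hε2
    obtain ⟨L, hL, hLfin⟩ := ((hε2.eventually_const_lt ha).and
      ((h.tendsto_largeGap hlam hν hsq).eventually_lt_const ENNReal.zero_lt_top)).exists
    have hlow : ∀ n, (γ - (largeGap P r X L).toReal) *
        (IsQueue.renewal P (arrivals r X) n).toReal ≤ (meanResidual P r X (n + L)).toReal := by
      intro n
      have h1 := ENNReal.toReal_mono (ENNReal.add_ne_top.2 ⟨hRfin (n + L),
        ENNReal.mul_ne_top hLfin.ne (hTfin n)⟩) (h.le_meanResidual hlam hν hp hsq hpos n L)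
      rw [ENNReal.toReal_add (hRfin _) (ENNReal.mul_ne_top hLfin.ne (hTfin n)),
        ENNReal.toReal_mul, ENNReal.toReal_mul, ENNReal.toReal_ofReal hγ0] at h1
      rw [sub_mul]
      linarith
    -- `L` is fixed, so the shift from `n` to `n + L` disappears in the limit.
    have hlim : Tendsto (fun n : ℕ => (γ - (largeGap P r X L).toReal) *
        ((IsQueue.renewal P (arrivals r X) n).toReal / n * ((n : ℝ) / ((n : ℝ) + L)))) atTop
        (𝓝 ((γ - (largeGap P r X L).toReal) * (1 / ρ * 1))) :=
      (hT.mul (tendsto_natCast_div_add_atTop (L : ℝ))).const_mul _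
    rw [mul_one] at hlim
    have hev : ∀ᶠ n : ℕ in atTop, a < (meanResidual P r X (n + L)).toReal / ((n + L : ℕ) : ℝ) := by
      filter_upwards [hlim.eventually_const_lt hL, eventually_gt_atTop 0] with n hn hn0
      have hn' : (0 : ℝ) < n := by exact_mod_cast hn0
      have hL0 : (0 : ℝ) ≤ L := Nat.cast_nonneg L
      refine hn.trans_le ?_
      rw [div_mul_div_cancel₀ hn'.ne', ← mul_div_assoc]
      push_cast
      exact div_le_div_of_nonneg_right (hlow n) (by positivity)
    obtain ⟨M, hM⟩ := eventually_atTop.1 hev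
    filter_upwards [eventually_ge_atTop (M + L)] with n hn
    have := hM (n - L) (by omega)
    rwa [Nat.sub_add_cancel (by omega)] at this
  · intro a ha
    have h1 := hT.const_mul γ
    rw [mul_one_div] at h1
    filter_upwards [h1.eventually_lt_const ha] with n hn
    refine lt_of_le_of_lt ?_ hn
    rw [← mul_div_assoc]
    exact div_le_div_of_nonneg_right (hup n) (Nat.cast_nonneg n)

end IsNetwork

end

section

/-! ### Request distances -/

lemma measurable_sInf_nat {α : Type*} [MeasurableSpace α] {A : α → ℕ → Prop}
    (hA : ∀ j, MeasurableSet {a | A a j}) : Measurable fun a => sInf {j | A a j} := by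
  have hall : MeasurableSet {a | ∀ j, ¬A a j} := by
    have : {a | ∀ j, ¬A a j} = ⋂ j, {a | A a j}ᶜ := by ext; simp
    rw [this]
    exact MeasurableSet.iInter fun j => (hA j).compl
  refine measurable_to_countable' fun j => ?_
  have hmin : MeasurableSet {a | A a j ∧ ∀ i < j, ¬A a i} := by
    have : {a | A a j ∧ ∀ i < j, ¬A a i} = {a | A a j} ∩ ⋂ i ∈ Set.Iio j, {a | A a i}ᶜ := by
      ext
      simp
    rw [this]
    exact (hA j).inter (MeasurableSet.biInter (Set.to_countable _) fun i _ => (hA i).compl)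
  -- `sInf ∅ = 0`, so the points where no index qualifies belong to the level `j = 0`.
  have heq : (fun a => sInf {j | A a j}) ⁻¹' {j} =
      {a | A a j ∧ ∀ i < j, ¬A a i} ∪ ({a | ∀ j, ¬A a j} ∩ {_a | j = 0}) := by
    ext a
    simp only [Set.mem_preimage, Set.mem_singleton_iff, Set.mem_union, Set.mem_inter_iff,
      Set.mem_ofPred_eq]
    rcases Set.eq_empty_or_nonempty {j | A a j} with he | hne
    · have h1 : ∀ i, ¬A a i := fun i hi => by
        have : i ∈ {j | A a j} := hi
        rw [he] at this
        exact this
      rw [he, Nat.sInf_empty]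
      constructor
      · intro h2
        exact Or.inr ⟨h1, h2.symm⟩
      · rintro (h2 | h2)
        · exact absurd h2.1 (h1 j)
        · exact h2.2.symm
    · have h1 : A a (sInf {j | A a j}) := Nat.sInf_mem hne
      constructor
      · rintro rfl
        exact Or.inl ⟨h1, fun i hi => Nat.notMem_of_lt_sInf hi⟩
      · rintro (h2 | h2)
        · refine le_antisymm (Nat.sInf_le h2.1) (not_lt.1 fun h3 => h2.2 _ h3 h1)
        · exact absurd h1 (h2.1 _)
  rw [heq]
  exact hmin.union (hall.inter (MeasurableSet.const _))

lemma measurable_mtr {α : Type*} [MeasurableSpace α] {r s : α → ℕ → ℝ} {C : α → ℕ → ℕ}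
    (hr : ∀ i, Measurable fun a => r a i) (hs : ∀ j, Measurable fun a => s a j)
    (hC : ∀ j, Measurable fun a => C a j) (i : ℕ) :
    Measurable fun a => mtr (r a) (s a) (C a) i := by
  induction i using Nat.strong_induction_on with
  | _ i ih =>
    have h1 : (fun a => mtr (r a) (s a) (C a) i) = fun a => sInf {j | r a i ≤ s a j ∧
        (Finset.univ.filter fun k : Fin i => mtr (r a) (s a) (C a) k = j).card < C a j} := by
      ext a
      rw [mtr]
    rw [h1]
    refine measurable_sInf_nat fun j => ?_
    refine (measurableSet_le (hr i) (hs j)).inter (measurableSet_lt ?_ (hC j))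
    simp_rw [Finset.card_filter]
    refine Finset.measurable_fun_sum _ fun k _ => ?_
    exact (measurable_of_countable fun m : ℕ => if m = j then 1 else 0).comp (ih k k.2)

lemma lindley_truncArr_congr {N N' C C' : ℕ → ℕ} {n j : ℕ}
    (h : ∀ i < j, N i = N' i ∧ C i = C' i) :
    lindley (truncArr N n) C j = lindley (truncArr N' n) C' j := by
  induction j with
  | zero => rfl
  | succ j ih =>
    have h1 : truncArr N n j = truncArr N' n j := by
      rw [truncArr, truncArr, (h j (Nat.lt_succ_self j)).1, Finset.sum_congr rfl fun i hi =>
        (h i (by rw [Finset.mem_range] at hi; omega)).1]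
    rw [lindley, lindley, ih fun i hi => h i (by omega), h1, (h j (Nat.lt_succ_self j)).2]

namespace IsNetwork

variable {Ω : Type*} [MeasurableSpace Ω] {P : Measure Ω} [IsProbabilityMeasure P] {lam : ℝ}
  {ν : Measure ℝ} [IsProbabilityMeasure ν] {p π : ℕ → ℝ} {r X : ℕ → Ω → ℝ} {C : ℕ → Ω → ℕ} {c : ℕ}

/-- Distance of request `i` in the network. -/
abbrev dist (r X : ℕ → Ω → ℝ) (C : ℕ → Ω → ℕ) (i : ℕ) (ω : Ω) : ℝ :=
  reqDist (fun n => r n ω) (serverLoc fun k => X k ω) (fun n => C n ω) i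

variable (h : IsNetwork P lam ν p r X C)

include h

lemma measurable_reqDist (i : ℕ) : Measurable (dist r X C i) := by
  have hs : ∀ j, Measurable fun ω => serverLoc (fun k => X k ω) j := fun j =>
    h.measurable_grid (j + 1)
  have hm := measurable_mtr (r := fun ω n => r n ω) (s := fun ω => serverLoc fun k => X k ω)
    (C := fun ω n => C n ω) h.poisson.measurable hs h.measurable_cap i
  have hpair : Measurable fun q : ℕ × Ω => serverLoc (fun k => X k q.2) q.1 :=
    measurable_from_prod_countable_right fun j => hs j
  exact (hpair.comp (hm.prodMk measurable_id)).sub (h.poisson.measurable i)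

lemma ae_reqDist_nonneg (hν : ν (Set.Iio 0) = 0) (hp : IsCapacityLaw c p)
    (hint : Integrable (fun x => x) ν) (hpos : 0 < ∫ x, x ∂ν) (i : ℕ) : 0 ≤ᵐ[P] dist r X C i := by
  filter_upwards [h.ae_isRegularPath hν hp hint hpos] with ω hω
  exact sub_nonneg.2 (mtr_mem hω.allocated i).1

variable (hlam : 0 < lam) (hν : ν (Set.Iio 0) = 0)

include hlam hν

/-- The backlog before gap `j` depends on the gap data of smaller indices only, so it is independent
of `X j`, although the arrivals in gap `j` are not. -/
lemma lintegral_dist_mul_lindley (hint : Integrable (fun x => x) ν) (n j : ℕ) :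
    ∫⁻ ω, ENNReal.ofReal (X j ω) *
      (lindley (truncArr (fun i => arrivals r X i ω) n) (fun i => C i ω) j : ℝ≥0∞) ∂P =
    ENNReal.ofReal (∫ x, x ∂ν) *
      ∫⁻ ω, (lindley (truncArr (fun i => arrivals r X i ω) n) (fun i => C i ω) j : ℝ≥0∞) ∂P := by
  have hf : Measurable fun z : ℕ → ℝ × ℕ × ℕ =>
      lindley (truncArr (fun i => (z i).2.1) n) (fun i => (z i).2.2) j := by
    refine measurable_lindley (N := fun i z => truncArr (fun i => (z i).2.1) n i)
      (C := fun i (z : ℕ → ℝ × ℕ × ℕ) => (z i).2.2) (fun i => ?_) (fun i => by fun_prop) j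
    have h1 : Measurable fun z : ℕ → ℝ × ℕ × ℕ => ∑ l ∈ Finset.range i, (z l).2.1 := by fun_prop
    exact (measurable_of_countable fun q : ℕ × ℕ => min q.1 (n - q.2)).comp
      (Measurable.prodMk (by fun_prop) h1)
  have hind := indepFun_past (h.iIndepFun_gapData hν) h.measurable_gapData (n := j) hf
    fun z z' hz => lindley_truncArr_congr fun i hi => by rw [hz i hi]; exact ⟨rfl, rfl⟩
  have hx : Measurable fun q : ℝ × ℕ × ℕ => ENNReal.ofReal q.1 := by fun_prop
  have hc : Measurable fun n : ℕ => (n : ℝ≥0∞) := measurable_of_countable _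
  have h1 := lintegral_mul_eq_lintegral_mul_lintegral_of_indepFun''
    (hx.comp (h.measurable_gapData j)).aemeasurable
    (hc.comp (hf.comp (measurable_pi_lambda _ h.measurable_gapData))).aemeasurable
    (hind.symm.comp hx hc)
  refine h1.trans ?_
  congr 1
  simp only [Function.comp_def, gapData]
  rw [← lintegral_map (f := fun x => ENNReal.ofReal x) ENNReal.measurable_ofReal
    (h.measurable_dist j), h.law_dist, ofReal_integral_eq_lintegral_ofReal hint
    (ae_nonneg_of_measure_Iio hν)]

/-- Expected total distance of the first `n` requests. -/
lemma sum_lintegral_dist (hp : IsCapacityLaw c p) (hint : Integrable (fun x => x) ν)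
    (hpos : 0 < ∫ x, x ∂ν) (n : ℕ) :
    ∑ i ∈ Finset.range n, ∫⁻ ω, ENNReal.ofReal (dist r X C i ω) ∂P =
      meanResidual P r X n +
        ENNReal.ofReal (∫ x, x ∂ν) * IsQueue.accBacklog P (arrivals r X) C n := by
  have hq := h.isQueue hν hlam hp
  have hmt : ∀ j, Measurable fun ω => truncArr (fun i => arrivals r X i ω) n j := fun j =>
    (measurable_of_countable fun q : ℕ × ℕ => min q.1 (n - q.2)).comp
      ((h.measurable_arrivals j).prodMk (hq.measurable_arrSum j))
  have hml : ∀ j, Measurable fun ω =>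
      (lindley (truncArr (fun i => arrivals r X i ω) n) (fun i => C i ω) j : ℝ≥0∞) := fun j =>
    (measurable_of_countable fun n : ℕ => (n : ℝ≥0∞)).comp
      (measurable_lindley (N := fun j ω => truncArr (fun i => arrivals r X i ω) n j) hmt
        h.measurable_cap j)
  have hmx : ∀ j, Measurable fun ω => ENNReal.ofReal (X (j + 1) ω) *
      (lindley (truncArr (fun i => arrivals r X i ω) n) (fun i => C i ω) (j + 1) : ℝ≥0∞) :=
    fun j => (ENNReal.measurable_ofReal.comp (h.measurable_dist (j + 1))).mul (hml (j + 1))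
  have hmd : ∀ i, Measurable fun ω => ENNReal.ofReal (dist r X C i ω) := fun i =>
    ENNReal.measurable_ofReal.comp (h.measurable_reqDist i)
  rw [← lintegral_finsetSum _ fun i _ => hmd i]
  have h1 : ∫⁻ ω, ∑ i ∈ Finset.range n, ENNReal.ofReal (dist r X C i ω) ∂P =
      ∫⁻ ω, (∑ i ∈ Finset.range n, residual (fun i => r i ω) (grid fun k => X k ω) i +
        ∑' j, ENNReal.ofReal (X (j + 1) ω) * (lindley (truncArr (fun i => arrivals r X i ω) n)
          (fun i => C i ω) (j + 1) : ℝ≥0∞)) ∂P := by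
    refine lintegral_congr_ae ?_
    filter_upwards [h.ae_isRegularPath hν hp hint hpos] with ω hω
    have h2 := sum_ofReal_reqDist hω.pos hω.mono (grid_zero _) (grid_mono hω.dist_nonneg)
      hω.allocated n
    refine h2.trans ?_
    congr 1
    refine tsum_congr fun j => ?_
    rw [partialCrossing_eq_lindley hω.pos hω.mono hω.tendsto_req (grid_zero _)
      (grid_mono hω.dist_nonneg) hω.allocated, grid_succ _ (j + 1), add_sub_cancel_left]
    rfl
  rw [h1, lintegral_add_right _ (Measurable.tsum hmx), lintegral_tsum fun j => (hmx j).aemeasurable]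
  simp_rw [h.lintegral_dist_mul_lindley hlam hν hint]
  -- The backlog before the first server is `0`, so the sum over `j + 1` equals the full sum.
  have h2 := tsum_eq_zero_add' (M := ℝ≥0∞) (f := fun j => ∫⁻ ω,
    (lindley (truncArr (fun i => arrivals r X i ω) n) (fun i => C i ω) j : ℝ≥0∞) ∂P)
    ENNReal.summable
  rw [ENNReal.tsum_mul_left, meanResidual, IsQueue.accBacklog, h2]
  simp only [lindley, Nat.cast_zero, lintegral_zero, zero_add]

variable (hp : IsCapacityLaw c p) (hsq : MemLp id 2 ν) (hpos : 0 < ∫ x, x ∂ν)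
  (hπ : IsQueue.IsLimitLaw P (arrivals r X) C π)

include hp hsq hpos hπ

lemma accBacklog_ne_top (n : ℕ) : IsQueue.accBacklog P (arrivals r X) C n ≠ ⊤ := by
  have hint : Integrable (fun x => x) ν := hsq.integrable one_le_two
  refine (h.isQueue hν hlam hp).accBacklog_ne_top (h.memLp_arrivals hν hlam hsq 0) ?_ ?_ ?_ hπ n
  · rw [h.integral_arrivals hν hlam hsq]
    exact mul_pos hlam hpos
  · filter_upwards [h.ae_isRegularPath hν hp hint hpos] with ω hω
    exact h.exists_le_arrSum hlam hν hω
  · filter_upwards [h.ae_cap hν hp] with ω hω j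
    exact (hω j).1

theorem integrable_reqDist (i : ℕ) : Integrable (dist r X C i) P := by
  have hint : Integrable (fun x => x) ν := hsq.integrable one_le_two
  refine ⟨(h.measurable_reqDist i).aestronglyMeasurable, ?_⟩
  rw [hasFiniteIntegral_iff_ofReal (h.ae_reqDist_nonneg hν hp hint hpos i)]
  have h1 := h.sum_lintegral_dist hlam hν hp hint hpos (i + 1)
  have h2 : ∑ i ∈ Finset.range (i + 1), ∫⁻ ω, ENNReal.ofReal (dist r X C i ω) ∂P ≠ ⊤ := by
    rw [h1]
    exact ENNReal.add_ne_top.2 ⟨h.meanResidual_ne_top hlam hν hp hsq hpos _,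
      ENNReal.mul_ne_top ENNReal.ofReal_ne_top (h.accBacklog_ne_top hlam hν hp hsq hpos hπ _)⟩
  exact lt_top_iff_ne_top.2 (ENNReal.sum_ne_top.1 h2 i (by simp))

lemma sum_integral_reqDist (n : ℕ) :
    ∑ i ∈ Finset.range n, ∫ ω, dist r X C i ω ∂P = (meanResidual P r X n).toReal +
      (∫ x, x ∂ν) * (IsQueue.accBacklog P (arrivals r X) C n).toReal := by
  have hint : Integrable (fun x => x) ν := hsq.integrable one_le_two
  have hI := h.integrable_reqDist hlam hν hp hsq hpos hπ
  have h1 := congrArg ENNReal.toReal (h.sum_lintegral_dist hlam hν hp hint hpos n)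
  rw [ENNReal.toReal_add (h.meanResidual_ne_top hlam hν hp hsq hpos _)
    (ENNReal.mul_ne_top ENNReal.ofReal_ne_top (h.accBacklog_ne_top hlam hν hp hsq hpos hπ _)),
    ENNReal.toReal_mul, ENNReal.toReal_ofReal hpos.le] at h1
  rw [← h1, ENNReal.toReal_sum]
  · refine Finset.sum_congr rfl fun i _ => ?_
    rw [integral_eq_lintegral_of_nonneg_ae (h.ae_reqDist_nonneg hν hp hint hpos i)
      (hI i).1]
  · intro i _
    have h2 := (hI i).2
    rw [hasFiniteIntegral_iff_ofReal (h.ae_reqDist_nonneg hν hp hint hpos i)] at h2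
    exact h2.ne

/-- The expected request distance. -/
theorem tendsto_mean_reqDist :
    Tendsto (fun n : ℕ => (∑ i ∈ Finset.range n, ∫ ω, dist r X C i ω ∂P) / (n : ℝ)) atTop
      (𝓝 ((lam / 2 * ∫ x, x ^ 2 ∂ν) / (lam * ∫ x, x ∂ν) +
        (∫ x, x ∂ν) * ((∑' l : ℕ, (l : ℝ) * π l) / (lam * ∫ x, x ∂ν)))) := by
  have hint : Integrable (fun x => x) ν := hsq.integrable one_le_two
  have hEN := h.integral_arrivals hν hlam hsq 0
  have h1 := (h.isQueue hν hlam hp).tendsto_accBacklog (h.memLp_arrivals hν hlam hsq 0)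
    (by rw [hEN]; exact mul_pos hlam hpos)
    (by
      filter_upwards [h.ae_isRegularPath hν hp hint hpos] with ω hω
      exact h.exists_le_arrSum hlam hν hω)
    (by
      filter_upwards [h.ae_cap hν hp] with ω hω j
      exact (hω j).1) hπ
  rw [hEN] at h1
  refine ((h.tendsto_meanResidual hlam hν hp hsq hpos).add (h1.const_mul _)).congr fun n => ?_
  rw [h.sum_integral_reqDist hlam hν hp hsq hpos hπ, add_div, mul_div_assoc]

end IsNetwork

lemma integral_quadratic {ν : Measure ℝ} [IsProbabilityMeasure ν] (hsq : MemLp id 2 ν) (a b : ℝ) :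
    ∫ x, (a * x + b * x ^ 2) ∂ν = a * (∫ x, x ∂ν) + b * (Var[id; ν] + (∫ x, x ∂ν) ^ 2) := by
  have hint : Integrable (fun x => x) ν := hsq.integrable one_le_two
  have h1 : Integrable (fun x => a * x) ν := hint.const_mul a
  have h2 : Integrable (fun x => b * x ^ 2) ν := hsq.integrable_sq.const_mul b
  rw [integral_add h1 h2, integral_const_mul, integral_const_mul, variance_eq_sub hsq]
  simp

end

end

end HetPRGS

/-! ### Assembly of the main theorem -/

theorem mainTheorem6 {Ω : Type*} [MeasurableSpace Ω] (P : Measure Ω) [IsProbabilityMeasure P]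
    (lam μ : ℝ) (hlam : 0 < lam) (hμ : 0 < μ)
    (ν : Measure ℝ) [IsProbabilityMeasure ν] (hν_nonneg : ν (Set.Iio 0) = 0)
    (hν_sq : MemLp id 2 ν) (hν_mean : ∫ x, x ∂ν = 1 / μ)
    (c : ℕ) (p : ℕ → ℝ) (hp : HetPRGS.IsCapacityLaw c p)
    (hstable : lam / μ < HetPRGS.meanCap c p)
    (r X : ℕ → Ω → ℝ) (C : ℕ → Ω → ℕ) (hnet : HetPRGS.IsNetwork P lam ν p r X C)
    (k : ℕ → ℝ) (hk : k = HetPRGS.kProb lam ν)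
    (s : ℕ → Ω → ℝ) (hs : s = fun j ω => HetPRGS.serverLoc (fun n => X n ω) j)
    (H : ℕ → Ω → ℕ)
    (hH : H = fun j ω => HetPRGS.crossing (fun i => r i ω) (fun n => s n ω) (fun n => C n ω) j)
    (D : ℕ → Ω → ℝ)
    (hD : D = fun i ω => HetPRGS.reqDist (fun n => r n ω) (fun n => s n ω) (fun n => C n ω) i) :
    -- almost surely every request is allocated to a server
    (∀ᵐ ω ∂P, ∀ i, ∃ j, r i ω ≤ s j ω ∧
      (Finset.univ.filter fun n : Fin i =>
        HetPRGS.mtr (fun n => r n ω) (fun n => s n ω) (fun n => C n ω) n = j).card < C j ω) ∧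
    -- the generating function of the number of requests between consecutive servers
    (∀ z : ℂ, ‖z‖ ≤ 1 → HasSum (fun v => (k v : ℂ) * z ^ v) (HetPRGS.K lam ν z)) ∧
    -- `H` is a Markov chain with the stated transition matrix, started from an empty origin
    (∀ l, P.real {ω | H 0 ω = l} = HetPRGS.trans c p k 0 l) ∧
    (∀ (n : ℕ) (h : ℕ → ℕ),
      P.real {ω | ∀ m ≤ n + 1, H m ω = h m} =
        P.real {ω | ∀ m ≤ n, H m ω = h m} * HetPRGS.trans c p k (h n) (h (n + 1))) ∧
    -- the denominator has `c - 1` zeros inside the unit circle, counted with multiplicity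
    {z : ℂ | ‖z‖ < 1 ∧ HetPRGS.den c p lam ν z = 0}.Finite ∧
    (∑ᶠ z ∈ Metric.ball (0 : ℂ) 1, analyticOrderNatAt (HetPRGS.den c p lam ν) z) = c - 1 ∧
    -- and exactly one zero on it, namely the simple zero `1`
    (∀ z : ℂ, ‖z‖ = 1 → (HetPRGS.den c p lam ν z = 0 ↔ z = 1)) ∧
    HasDerivWithinAt (HetPRGS.den c p lam ν) ((HetPRGS.meanCap c p - lam / μ : ℝ) : ℂ)
      (Metric.closedBall 0 1) 1 ∧
    -- if the zeros inside are simple, the `c - 1` equations given by them and the normalizing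
    -- equation are linearly independent
    (∀ ξ : Fin (c - 1) → ℂ, Function.Injective ξ →
      Set.range ξ = {z : ℂ | ‖z‖ < 1 ∧ HetPRGS.den c p lam ν z = 0} →
      LinearIndependent ℂ (fun (q : Option (Fin (c - 1))) (j : Fin c) =>
        q.elim (deriv (HetPRGS.num c p k (Pi.single (j : ℕ) 1)) 1)
          (fun a => HetPRGS.num c p k (Pi.single (j : ℕ) 1) (ξ a)))) ∧
    ∃ π : ℕ → ℝ,
      -- `π` is the steady-state distribution
      HetPRGS.IsStationary (HetPRGS.trans c p k) π ∧
      (∀ π', HetPRGS.IsStationary (HetPRGS.trans c p k) π' → π' = π) ∧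
      (∀ l, Tendsto (fun n => P.real {ω | H n ω = l}) atTop (𝓝 (π l))) ∧
      -- formula for `N(z)`; the numerator vanishes at the zeros of the denominator
      (∀ z : ℂ, ‖z‖ ≤ 1 →
        (HetPRGS.den c p lam ν z ≠ 0 →
          HetPRGS.pgf π z =
            HetPRGS.num c p k (fun j => (π j : ℂ)) z / HetPRGS.den c p lam ν z) ∧
        (HetPRGS.den c p lam ν z = 0 → HetPRGS.num c p k (fun j => (π j : ℂ)) z = 0)) ∧
      -- vanishing of the numerator at the zeros inside (with multiplicity) and the normalization
      -- `N(z) → 1` determine `π 0, ..., π (c - 1)`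
      (∀ x : ℕ → ℂ,
        ((∀ z : ℂ, ‖z‖ < 1 → ∀ n < analyticOrderNatAt (HetPRGS.den c p lam ν) z,
            iteratedDeriv n (HetPRGS.num c p k x) z = 0) ∧
          Tendsto (fun z => HetPRGS.num c p k x z / HetPRGS.den c p lam ν z)
            (𝓝[Metric.ball 0 1] 1) (𝓝 1)) ↔
        ∀ j < c, x j = (π j : ℂ)) ∧
      -- the mean of `H`
      Summable (fun j : ℕ => (j : ℝ) * π j) ∧
      Tendsto (deriv (HetPRGS.pgf π)) (𝓝[Metric.ball 0 1] 1)
        (𝓝 ((∑' j : ℕ, (j : ℝ) * π j : ℝ) : ℂ)) ∧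
      -- expected request distance
      (∀ i, Integrable (D i) P) ∧
      Tendsto (fun n : ℕ => (∑ i ∈ Finset.range n, ∫ ω, D i ω ∂P) / (n : ℝ)) atTop
        (𝓝 (1 / (lam / μ) *
          ((∑' j : ℕ, (j : ℝ) * π j) / μ + lam / 2 * (Var[id; ν] + 1 / μ ^ 2)))) ∧
      1 / (lam / μ) * ∫ x, ((∑' j : ℕ, (j : ℝ) * π j) * x + 1 / 2 * lam * x ^ 2) ∂ν =
        1 / (lam / μ) *
          ((∑' j : ℕ, (j : ℝ) * π j) / μ + lam / 2 * (Var[id; ν] + 1 / μ ^ 2)) := by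
  subst hk hs hH hD
  have hint : Integrable (fun x => x) ν := hν_sq.integrable one_le_two
  have hpos : 0 < ∫ x, x ∂ν := by rw [hν_mean]; positivity
  have hρ : lam * ∫ x, x ∂ν = lam / μ := by rw [hν_mean]; ring
  have hk : HetPRGS.IsArrivalLaw lam ν (HetPRGS.kProb lam ν) (lam / μ) :=
    hρ ▸ HetPRGS.isArrivalLaw_kProb hlam hν_nonneg hint hpos
  have hq := hnet.isQueue hν_nonneg hlam hp
  have hN := hnet.memLp_arrivals hν_nonneg hlam hν_sq 0
  have hC := hnet.memLp_cap hν_nonneg hp 0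
  have hdrift : ∫ ω, ((HetPRGS.arrivals r X 0 ω : ℝ) - C 0 ω) ∂P < 0 := by
    rw [integral_sub (hN.integrable one_le_two) (hC.integrable one_le_two),
      hnet.integral_arrivals hν_nonneg hlam hν_sq, hnet.integral_cap hν_nonneg hp, hρ]
    exact sub_neg.2 hstable
  obtain ⟨B, hB⟩ := hq.exists_mean_bound hN hC hdrift
  obtain ⟨π, hπ⟩ := hq.exists_isLimitLaw hB
  have hst := hπ.isStationary hq
  have hreg := hnet.ae_isRegularPath hν_nonneg hp hint hpos
  have hcross : ∀ᵐ ω ∂P, ∀ j, HetPRGS.crossing (fun i => r i ω)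
      (HetPRGS.serverLoc fun n => X n ω) (fun n => C n ω) j =
      HetPRGS.IsQueue.backlog (HetPRGS.arrivals r X) C (j + 1) ω := by
    filter_upwards [hreg] with ω hω j
    exact hnet.crossing_eq_backlog hν_nonneg hω j
  have hlaw : ∀ n l, P.real {ω | HetPRGS.crossing (fun i => r i ω)
      (HetPRGS.serverLoc fun n => X n ω) (fun n => C n ω) n = l} =
      P.real {ω | HetPRGS.IsQueue.backlog (HetPRGS.arrivals r X) C (n + 1) ω = l} := by
    intro n l
    refine measureReal_congr ?_
    filter_upwards [hcross] with ω hω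
    exact congrArg (· = l) (hω n)
  -- `H m` is the backlog at time `m + 1`; a path of `H` becomes a path of the backlog by prepending
  -- the initial state `0`.
  have hpath : ∀ (n : ℕ) (a : ℕ → ℕ), P.real {ω | ∀ m ≤ n, HetPRGS.crossing (fun i => r i ω)
      (HetPRGS.serverLoc fun n => X n ω) (fun n => C n ω) m = a m} =
      P.real {ω | ∀ m ≤ n + 1, HetPRGS.IsQueue.backlog (HetPRGS.arrivals r X) C m ω =
        Nat.casesOn m 0 a} := by
    intro n a
    refine measureReal_congr ?_
    filter_upwards [hcross] with ω hω
    refine propext ⟨fun h1 m hm => ?_, fun h1 m hm => ?_⟩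
    · cases m with
      | zero => rfl
      | succ m => exact (hω m).symm.trans (h1 m (by omega))
    · exact (hω m).trans (h1 (m + 1) (by omega))
  refine ⟨?_, hk.hasSum_K, fun l => ?_, fun n a => ?_, HetPRGS.finite_zeros_den hp hk hstable,
    HetPRGS.finsum_order_den hp hk hstable, fun z hz => HetPRGS.den_eq_zero_iff hp hk hz,
    HetPRGS.hasDerivWithinAt_den hp hk, HetPRGS.linearIndependent_boundary hp hk hstable,
    π, hst, fun π' hπ' => hst.unique hπ' hp hk hstable, fun l => ?_,
    fun z hz => ⟨fun h0 => ?_, fun h0 => ?_⟩, hst.boundary_iff hp hk hstable, hπ.summable_mean,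
    HetPRGS.tendsto_deriv_pgf hst.nonneg hst.hasSum_one.summable hπ.summable_mean,
    hnet.integrable_reqDist hlam hν_nonneg hp hν_sq hpos hπ, ?_, ?_⟩
  · filter_upwards [hreg] with ω hω i
    exact hω.allocated i
  · rw [hlaw]
    refine Eq.trans ?_ (hq.measureReal_step 0 0 l)
    simp only [HetPRGS.IsQueue.backlog, HetPRGS.lindley]
  · rw [hpath, hpath]
    exact hq.measureReal_path_succ (n + 1) _
  · simp only [hlaw]
    exact (tendsto_add_atTop_iff_nat 1).2 (hπ.tendsto l)
  · rw [eq_div_iff h0, mul_comm]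
    exact hst.den_mul_pgf hk hz
  · rw [← hst.den_mul_pgf hk hz, h0, zero_mul]
  · have h1 := hnet.tendsto_mean_reqDist hlam hν_nonneg hp hν_sq hpos hπ
    -- The coefficients `0` and `1` express the second moment by the variance and the mean.
    have h2 := HetPRGS.integral_quadratic hν_sq 0 1
    simp only [zero_mul, zero_add, one_mul] at h2
    rw [h2, hν_mean] at h1
    convert! h1 using 2
    field_simp
    ring
  · rw [HetPRGS.integral_quadratic hν_sq, hν_mean]
    ring
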